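/- Let $d,p,\tilde p$ be non-negative integers, $X\in\mathbb R^{d\times p}$ with $XX^\top$ invertible, $\tilde X\in\mathbb R^{d\times\tilde p}$, and let $\sigma,\tilde\sigma>0$ be fixed. For $\beta\in\mathbb R^d$ let $p(y\mid\beta)$ be the density of $N_p(X^\top\beta,\sigma^2I_p)$ and $\tilde p(\tilde y\mid\beta)$ the density of $N_{\tilde p}(\tilde X^\top\beta,\tilde\sigma^2I_{\tilde p})$. A predictive density is a jointly measurable $q(\tilde y\mid y)\ge 0$ with $\int q(\tilde y\mid y)\,d\tilde y=1$ for every $y$; its risk is $$R(\beta,q)=\int p(y\mid\beta)\int\tilde p(\tilde y\mid\beta)\log\frac{\tilde p(\tilde y\mid\beta)}{q(\tilde y\mid y)}\,d\tilde y\,dy\in[0,\infty].$$ $q_1$ dominates $q_2$ if $R(\beta,q_1)\le R(\beta,q_2)$ for all $\beta$, with strict inequality for some $\beta$; $q$ is minimax if $\sup_\beta R(\beta,q)\le\sup_\beta R(\beta,q')$ for every predictive density $q'$. For a measurable prior density $\pi:\mathbb R^d\to[0,\infty]$, possibly improper, the Bayesian prediction based on $\pi$ is $$p_\pi(\tilde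 y\mid y)=\frac{\int\tilde p(\tilde y\mid\beta)\,p(y\mid\beta)\,\pi(\beta)\,d\beta}{\int p(y\mid\beta)\,\pi(\beta)\,d\beta},$$ and $p_I$ is the one based on the uniform prior $\pi_I\equiv1$. A function $f:\mathbb R^d\to(-\infty,\infty]$ is superharmonic if $f\not\equiv\infty$, $f$ is lower semicontinuous, and for every open $G$ with compact closure and every $w$ continuous on $\overline G$ and harmonic on $G$, $f\ge w$ on $\partial G$ implies $f\ge w$ on $G$. Let $\Sigma=\sigma^2(XX^\top)^{-1}$ and $\Sigma_w=(\sigma^{-2}XX^\top+\tilde\sigma^{-2}\tilde X\tilde X^\top)^{-1}$, let $\Sigma_w^{1/2}\Sigma^{-1}\Sigma_w^{1/2}=U^\top\Lambda U$ be any diagonalization with $U$ orthogonal and $\Lambda$ diagonal, and let $A^*=\Sigma_w^{1/2}U^\top(\Lambda^{-1}-I_d)^{1/2}$. (a) Suppose that $\tilde X\tilde X^\top$ is invertible (equivalently, $A^*$ is invertible), that $\beta\mapsto\pi(A^*\beta)$ is superharmonic and that $\pi\not\equiv0$. (i) If $\pi$ is non-constant, then $p_\pi$ dominates $p_I$. (ii)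 $p_\pi$ is minimax. (b) Let $\tilde X$ be arbitrary. Suppose that $\beta\mapsto\pi(b+A^*\beta)$ is superharmonic for every $b\in\mathbb R^d$, and that $0<\int p(y\mid\beta)\pi(\beta)\,d\beta<\infty$ for every $y$. (i) If it is not the case that, for Lebesgue-almost every $b$, $\beta\mapsto\pi(b+A^*\beta)$ is constant, then $p_\pi$ dominates $p_I$. (ii) $p_\pi$ is minimax. -/

import Mathlib

open MeasureTheory

noncomputable section

namespace RegPred

/-- Euclidean space `ℝⁿ`, with its Euclidean norm and Lebesgue measure `volume`. -/
abbrev E (n : ℕ) : Type := EuclideanSpace ℝ (Fin n)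

/-- Matrix times vector, between Euclidean spaces. -/
def act {m n : ℕ} (A : Matrix (Fin m) (Fin n) ℝ) (v : E n) : E m :=
  WithLp.toLp 2 (A.mulVec v.ofLp)

/-! ### Superharmonic functions -/

/-- An extended real-valued function `f` on an open set `R` is superharmonic: it takes values in
`(-∞, ∞]` and is not identically `∞` on any component of `R`; it is lower semicontinuous on `R`;
and for every open `G` with compact closure contained in `R` and every `w` continuous on the
closure of `G` and harmonic on `G`, if `f ≥ w` on the boundary of `G` then `f ≥ w` on `G`. -/
structure SuperharmonicOn {n : ℕ} (f : E n → EReal) (R : Set (E n)) : Prop where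
  ne_bot : ∀ x ∈ R, f x ≠ ⊥
  ne_top : ∀ x ∈ R, ∃ y ∈ connectedComponentIn R x, f y ≠ ⊤
  lsc : LowerSemicontinuousOn f R
  comparison : ∀ (G : Set (E n)) (w : E n → ℝ), IsOpen G → IsCompact (closure G) →
    closure G ⊆ R → ContinuousOn w (closure G) → InnerProductSpace.HarmonicOnNhd w G →
    (∀ x ∈ frontier G, (w x : EReal) ≤ f x) → ∀ x ∈ G, (w x : EReal) ≤ f x

/-- A `[0, ∞]`-valued function on the whole of `ℝⁿ` is superharmonic. -/
def Superharmonic {n : ℕ} (f : E n → ENNReal) : Prop :=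
  SuperharmonicOn (fun x => (f x : EReal)) Set.univ

/-! ### The normal linear model -/

/-- The density at `y` of `y = Xᵀ β + ε`, `ε ∼ N(0, σ² I_p)`. -/
def density {d p : ℕ} (X : Matrix (Fin d) (Fin p) ℝ) (σ : ℝ) (β : E d) (y : E p) : ENNReal :=
  ENNReal.ofReal ((2 * Real.pi * σ ^ 2) ^ (-(p : ℝ) / 2) *
    Real.exp (-‖y - act X.transpose β‖ ^ 2 / (2 * σ ^ 2)))

/-- A predictive density `q y ỹ` for the future sample `ỹ` given the observation `y`:
jointly measurable, and a probability density in `ỹ` for every `y`. -/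
def IsPredictiveDensity {p p' : ℕ} (q : E p → E p' → ENNReal) : Prop :=
  Measurable (Function.uncurry q) ∧ ∀ y, ∫⁻ z, q y z = 1

/-- The normalizing constant `∫ p(y | β) π(β) dβ` of the posterior given `y`. -/
def marginal {d p : ℕ} (X : Matrix (Fin d) (Fin p) ℝ) (σ : ℝ) (π : E d → ENNReal)
    (y : E p) : ENNReal :=
  ∫⁻ β, density X σ β y * π β

/-- The Bayesian predictive density based on the (possibly improper) prior density `π`,
`∫ p(ỹ | β) p(y | β) π(β) dβ / ∫ p(y | β) π(β) dβ`. -/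
def bayesPredictive {d p p' : ℕ} (X : Matrix (Fin d) (Fin p) ℝ) (X' : Matrix (Fin d) (Fin p') ℝ)
    (σ σ' : ℝ) (π : E d → ENNReal) (y : E p) (z : E p') : ENNReal :=
  (∫⁻ β, density X' σ' β z * density X σ β y * π β) / marginal X σ π y

/-- The Kullback-Leibler risk at `β`, `∫ p(y | β) D(p(ỹ | β) ‖ q(ỹ | y)) dy`, in `[0, ∞]`. -/
def risk {d p p' : ℕ} (X : Matrix (Fin d) (Fin p) ℝ) (X' : Matrix (Fin d) (Fin p') ℝ)
    (σ σ' : ℝ) (q : E p → E p' → ENNReal) (β : E d) : ENNReal :=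
  ∫⁻ y, density X σ β y *
    InformationTheory.klDiv (volume.withDensity (density X' σ' β)) (volume.withDensity (q y))

/-- `q₁` dominates `q₂`: the risk of `q₁` is nowhere larger and somewhere strictly smaller. -/
def Dominates {d p p' : ℕ} (X : Matrix (Fin d) (Fin p) ℝ) (X' : Matrix (Fin d) (Fin p') ℝ)
    (σ σ' : ℝ) (q₁ q₂ : E p → E p' → ENNReal) : Prop :=
  IsPredictiveDensity q₁ ∧ IsPredictiveDensity q₂ ∧
    (∀ β, risk X X' σ σ' q₁ β ≤ risk X X' σ σ' q₂ β) ∧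
    ∃ β, risk X X' σ σ' q₁ β < risk X X' σ σ' q₂ β

/-- `q` is minimax: it minimizes the supremum of the risk over all predictive densities. -/
def IsMinimax {d p p' : ℕ} (X : Matrix (Fin d) (Fin p) ℝ) (X' : Matrix (Fin d) (Fin p') ℝ)
    (σ σ' : ℝ) (q : E p → E p' → ENNReal) : Prop :=
  IsPredictiveDensity q ∧ ∀ q' : E p → E p' → ENNReal, IsPredictiveDensity q' →
    ⨆ β, risk X X' σ σ' q β ≤ ⨆ β, risk X X' σ σ' q' β

/-! ### The matrices -/

/-- `Σ = σ² (X Xᵀ)⁻¹`. -/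
def covMat {d p : ℕ} (X : Matrix (Fin d) (Fin p) ℝ) (σ : ℝ) : Matrix (Fin d) (Fin d) ℝ :=
  σ ^ 2 • (X * X.transpose)⁻¹

/-- `Σ_w = (σ⁻² X Xᵀ + σ̃⁻² X̃ X̃ᵀ)⁻¹`. The first summand is `Σ⁻¹`, the second one is the
Moore-Penrose inverse of `Σ̃ = σ̃² (X̃ X̃ᵀ)^†`. -/
def covMatW {d p p' : ℕ} (X : Matrix (Fin d) (Fin p) ℝ) (X' : Matrix (Fin d) (Fin p') ℝ)
    (σ σ' : ℝ) : Matrix (Fin d) (Fin d) ℝ :=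
  ((σ ^ 2)⁻¹ • (X * X.transpose) + (σ' ^ 2)⁻¹ • (X' * X'.transpose))⁻¹

open scoped MatrixOrder in
/-- The positive semidefinite square root of a positive semidefinite matrix. -/
def sqrtMat {d : ℕ} (M : Matrix (Fin d) (Fin d) ℝ) : Matrix (Fin d) (Fin d) ℝ :=
  CFC.sqrt M

/-- `Σ_w^{1/2} Σ⁻¹ Σ_w^{1/2} = Uᵀ Λ U` with `U` orthogonal and `Λ = diag(lam)`. -/
def IsDiagonalization {d p p' : ℕ} (X : Matrix (Fin d) (Fin p) ℝ)
    (X' : Matrix (Fin d) (Fin p') ℝ) (σ σ' : ℝ)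
    (U : Matrix (Fin d) (Fin d) ℝ) (lam : Fin d → ℝ) : Prop :=
  U ∈ Matrix.orthogonalGroup (Fin d) ℝ ∧
    sqrtMat (covMatW X X' σ σ') * (covMat X σ)⁻¹ * sqrtMat (covMatW X X' σ σ') =
      U.transpose * Matrix.diagonal lam * U

/-- `A* = Σ_w^{1/2} Uᵀ (Λ⁻¹ - I)^{1/2}`, with `Λ = diag(lam)`. -/
def Astar {d p p' : ℕ} (X : Matrix (Fin d) (Fin p) ℝ) (X' : Matrix (Fin d) (Fin p') ℝ)
    (σ σ' : ℝ) (U : Matrix (Fin d) (Fin d) ℝ) (lam : Fin d → ℝ) : Matrix (Fin d) (Fin d) ℝ :=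
  sqrtMat (covMatW X X' σ σ') * U.transpose *
    Matrix.diagonal (fun i => Real.sqrt ((lam i)⁻¹ - 1))

end RegPred

end

/-! Write `C = Σ`, `W = Σ_w`, `S = W^{1/2}`, `A = A*`, and `P_M f(x) = E f(x + M ξ)` with `ξ`
standard Gaussian (`gaussAvg`). The risk comparison uses only `A Aᵀ = C - W`
(`Astar_mul_transpose`). As a function of `β`, the joint likelihood of both samples is Gaussian
around the weighted estimate `w` with covariance `W`; that of `y` alone is Gaussian around the
estimate `x` with covariance `C`. Hence, with `u = P_S π`, the prediction is `p_π = c · u(w) / (P_A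
u)(x)`, where `c` depends on the data but not on the prior (`exists_bayesPredictive_eq`). Under `β`
the pair `(w, x)` has the law of `(β + S ζ, β + S ζ + A ξ)` with independent `ζ, ξ`
(`lintegral_density_estW_est`).

Two predictive densities are compared through `log t ≤ t - 1`, which gives `R(b) + 1 ≤ R(c) +
E[c/b]` (`risk_add_one_le`). For `b = p_π` and `c = p_I` the expectation is `P_S (P_A P_A u /
u)(β)`. Gaussian averages commute, so `P_A π ≤ π` implies `P_A u ≤ u`, and the expectation is at
most one. No derivative of the marginals is needed.

Superharmonicity supplies `P_A π ≤ π` (`Superharmonic.lintegral_le`): the heat flow of a bounded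
continuous minorant stays below the function, by a maximum principle using only harmonic quadratic
barriers and second-order lower bounds for the flow.

For strictness, if `P_A π = π` fails on a set of positive measure, then `P_A u < u` everywhere,
because the Gaussian with covariance `W` charges all nonempty open sets and has the same null sets
as Lebesgue measure; the risk of `p_I` being finite, the inequality is strict. If equality holds
almost everywhere, a Harnack inequality between the averages at scales `n + 1` and `n + 2`, with
constant tending to one, makes `π` constant on almost every translate of the range of `A`
(`ae_forall_eq_of_gaussAvg_ae_eq`).

For minimaxity, `p_I` has constant risk by translation invariance. The finite priors `exp(-ε‖β‖)`
are so flat that their predictions exceed `p_I` in mean ratio by a factor tending to one as `ε → 0`,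
while under its own prior a Bayesian prediction cannot be beaten on average
(`risk_bayes_one_add_mul_le`). This bounds the constant risk by every maximal risk; applied to a
fixed density of the model, the same inequality shows that the constant risk is finite. -/

open MeasureTheory

noncomputable section

namespace RegPred

open ProbabilityTheory
open scoped ENNReal RealInnerProductSpace

/-! ### Matrices acting on Euclidean spaces -/

section act

variable {l m n : ℕ}

/-- The action of a matrix as a continuous linear map. -/
def actL (A : Matrix (Fin m) (Fin n) ℝ) : E n →L[ℝ] E m :=
  LinearMap.toContinuousLinearMap (Matrix.toLpLin 2 2 A)

@[simp] lemma actL_apply (A : Matrix (Fin m) (Fin n) ℝ) (v : E n) : actL A v = act A v := rfl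

@[fun_prop] lemma continuous_act (A : Matrix (Fin m) (Fin n) ℝ) : Continuous (act A) :=
  (actL A).continuous

@[fun_prop] lemma measurable_act (A : Matrix (Fin m) (Fin n) ℝ) : Measurable (act A) :=
  (continuous_act A).measurable

@[simp] lemma act_add (A : Matrix (Fin m) (Fin n) ℝ) (v w : E n) :
    act A (v + w) = act A v + act A w := map_add (actL A) v w

@[simp] lemma act_sub (A : Matrix (Fin m) (Fin n) ℝ) (v w : E n) :
    act A (v - w) = act A v - act A w := map_sub (actL A) v w

@[simp] lemma act_smul (A : Matrix (Fin m) (Fin n) ℝ) (c : ℝ) (v : E n) :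
    act A (c • v) = c • act A v := map_smul (actL A) c v

@[simp] lemma act_zero (A : Matrix (Fin m) (Fin n) ℝ) : act A 0 = 0 := map_zero (actL A)

@[simp] lemma zero_act (v : E n) : act (0 : Matrix (Fin m) (Fin n) ℝ) v = 0 := by
  simp [act]

lemma act_mul (A : Matrix (Fin l) (Fin m) ℝ) (B : Matrix (Fin m) (Fin n) ℝ) (v : E n) :
    act (A * B) v = act A (act B v) := by
  simp [act, Matrix.mulVec_mulVec]

lemma add_act (A B : Matrix (Fin m) (Fin n) ℝ) (v : E n) :
    act (A + B) v = act A v + act B v := by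
  simp [act, Matrix.add_mulVec]

lemma sub_act (A B : Matrix (Fin m) (Fin n) ℝ) (v : E n) :
    act (A - B) v = act A v - act B v := by
  simp [act, Matrix.sub_mulVec]

lemma smul_act (c : ℝ) (A : Matrix (Fin m) (Fin n) ℝ) (v : E n) :
    act (c • A) v = c • act A v := by
  simp [act, Matrix.smul_mulVec]

@[simp] lemma one_act (v : E n) : act (1 : Matrix (Fin n) (Fin n) ℝ) v = v := by
  simp [act]

lemma inner_act (A : Matrix (Fin m) (Fin n) ℝ) (v : E n) (w : E m) :
    ⟪act A v, w⟫ = ⟪v, act A.transpose w⟫ := by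
  simp only [act, EuclideanSpace.inner_eq_star_dotProduct, star_trivial]
  rw [Matrix.mulVec_transpose, Matrix.dotProduct_mulVec]

lemma norm_act_sq (A : Matrix (Fin m) (Fin n) ℝ) (v : E n) :
    ‖act A v‖ ^ 2 = ⟪v, act (A.transpose * A) v⟫ := by
  rw [← real_inner_self_eq_norm_sq, inner_act, act_mul]

lemma norm_act_transpose_sq (A : Matrix (Fin m) (Fin n) ℝ) (v : E m) :
    ‖act A.transpose v‖ ^ 2 = ⟪v, act (A * A.transpose) v⟫ := by
  rw [norm_act_sq, Matrix.transpose_transpose]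

lemma norm_act_le (A : Matrix (Fin m) (Fin n) ℝ) (v : E n) : ‖act A v‖ ≤ ‖actL A‖ * ‖v‖ :=
  (actL A).le_opNorm v

lemma act_inv_act {A : Matrix (Fin n) (Fin n) ℝ} (hA : IsUnit A.det) (v : E n) :
    act A⁻¹ (act A v) = v := by
  rw [← act_mul, Matrix.nonsing_inv_mul _ hA, one_act]

lemma act_act_inv {A : Matrix (Fin n) (Fin n) ℝ} (hA : IsUnit A.det) (v : E n) :
    act A (act A⁻¹ v) = v := by
  rw [← act_mul, Matrix.mul_nonsing_inv _ hA, one_act]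

/-- An affine change of variables with an invertible matrix. -/
lemma lintegral_comp_affine {A : Matrix (Fin n) (Fin n) ℝ} (hA : IsUnit A.det) (b : E n)
    {f : E n → ℝ≥0∞} (hf : Measurable f) :
    ∫⁻ x, f x = ENNReal.ofReal |A.det| * ∫⁻ x, f (b + act A x) := by
  have hdet : LinearMap.det (Matrix.toLpLin 2 2 A : E n →ₗ[ℝ] E n) = A.det :=
    LinearMap.det_toLpLin 2 A
  have hA0 := hA.ne_zero
  have h := Measure.map_linearMap_addHaar_eq_smul_addHaar (volume : Measure (E n))
    (f := Matrix.toLpLin 2 2 A) (by rwa [hdet])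
  have h2 : ∫⁻ x, f (b + act A x) = ∫⁻ y, f (b + y) ∂(volume.map (act A)) := by
    rw [lintegral_map (by fun_prop) (by fun_prop)]
  have h3 : volume.map (act A) = ENNReal.ofReal |A.det⁻¹| • (volume : Measure (E n)) := by
    rw [← hdet]; exact h
  rw [h2, h3, lintegral_smul_measure, lintegral_add_left_eq_self, smul_eq_mul, ← mul_assoc,
    ← ENNReal.ofReal_mul (abs_nonneg _), ← abs_mul, mul_inv_cancel₀ hA0]
  simp

end act

/-! ### The standard Gaussian measure -/

/-- The density of the standard Gaussian measure. -/
def gaussDensity {n : ℕ} (x : E n) : ℝ≥0∞ :=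
  ENNReal.ofReal ((2 * Real.pi) ^ (-(n : ℝ) / 2) * Real.exp (-‖x‖ ^ 2 / 2))

lemma measurable_gaussDensity {n : ℕ} : Measurable (gaussDensity (n := n)) := by
  unfold gaussDensity; fun_prop

lemma gaussDensity_ne_top {n : ℕ} (x : E n) : gaussDensity x ≠ ∞ := ENNReal.ofReal_ne_top

lemma gaussDensity_pos {n : ℕ} (x : E n) : 0 < gaussDensity x :=
  ENNReal.ofReal_pos.2 (by positivity)

lemma integrable_exp_neg_mul_norm_sq {n : ℕ} {b : ℝ} (hb : 0 < b) :
    Integrable (fun x : E n => Real.exp (-b * ‖x‖ ^ 2)) := by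
  have h := (GaussianFourier.integrable_cexp_neg_mul_sq_norm_add (V := E n) (b := (b : ℂ))
    (by simpa using hb) 0 0).re
  refine h.congr (Filter.Eventually.of_forall fun x => ?_)
  simp only [zero_mul, add_zero]
  rw [show (-(b : ℂ) * (‖x‖ : ℂ) ^ 2) = ((-b * ‖x‖ ^ 2 : ℝ) : ℂ) by push_cast; ring,
    ← Complex.ofReal_exp]
  exact Complex.ofReal_re _

/-- Both measures have the characteristic function `exp(-‖t‖²/2)`. -/
lemma stdGaussian_eq_withDensity (n : ℕ) :
    stdGaussian (E n) = volume.withDensity gaussDensity := by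
  have hint : Integrable (fun x : E n =>
      (2 * Real.pi) ^ (-(n : ℝ) / 2) * Real.exp (-‖x‖ ^ 2 / 2)) := by
    refine ((integrable_exp_neg_mul_norm_sq (n := n) (b := 1 / 2) (by norm_num)).const_mul
      ((2 * Real.pi) ^ (-(n : ℝ) / 2))).congr (Filter.Eventually.of_forall fun x => ?_)
    simp only
    congr 2
    ring
  have hfin : IsFiniteMeasure (volume.withDensity (gaussDensity (n := n))) :=
    isFiniteMeasure_withDensity_ofReal hint.2
  refine Measure.ext_of_charFun (funext fun t => ?_)
  rw [charFun_stdGaussian, charFun_apply,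
    integral_withDensity_eq_integral_toReal_smul measurable_gaussDensity
      (Filter.Eventually.of_forall fun x => (gaussDensity_ne_top x).lt_top)]
  have key := GaussianFourier.integral_cexp_neg_mul_sq_norm_add (V := E n) (b := (1 / 2 : ℂ))
    (by norm_num) Complex.I t
  have : ∀ x : E n, (gaussDensity x).toReal • Complex.exp ((⟪x, t⟫ : ℝ) * Complex.I) =
      ((2 * Real.pi : ℝ) ^ (-(n : ℝ) / 2) : ℝ) *
        Complex.exp (-(1 / 2 : ℂ) * ‖x‖ ^ 2 + Complex.I * (⟪t, x⟫ : ℝ)) := by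
    intro x
    rw [gaussDensity, ENNReal.toReal_ofReal (by positivity), Complex.real_smul, Complex.exp_add,
      real_inner_comm x t]
    push_cast
    rw [mul_assoc, mul_comm Complex.I]
    congr 3
    ring
  simp_rw [this]
  rw [integral_const_mul, key, finrank_euclideanSpace_fin, Complex.I_sq]
  have h2 : ((Real.pi : ℂ) / (1 / 2)) ^ ((n : ℂ) / 2) =
      (((2 * Real.pi : ℝ) ^ ((n : ℝ) / 2) : ℝ) : ℂ) := by
    rw [Complex.ofReal_cpow (by positivity)]
    push_cast
    congr 1
    ring
  rw [h2, ← mul_assoc, ← Complex.ofReal_mul, ← Real.rpow_add (by positivity)]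
  rw [show -(n : ℝ) / 2 + (n : ℝ) / 2 = 0 by ring, Real.rpow_zero, Complex.ofReal_one, one_mul]
  congr 1
  ring

lemma lintegral_stdGaussian {n : ℕ} {f : E n → ℝ≥0∞} (hf : Measurable f) :
    ∫⁻ x, f x ∂stdGaussian (E n) = ∫⁻ x, gaussDensity x * f x := by
  rw [stdGaussian_eq_withDensity, lintegral_withDensity_eq_lintegral_mul _
    measurable_gaussDensity hf]
  rfl

/-- Two linear images of standard Gaussian vectors with the same covariance have the same law. -/
lemma map_stdGaussian_prod_eq {a b a' b' : ℕ} {G : Type*} [NormedAddCommGroup G] [NormedSpace ℝ G]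
    [CompleteSpace G] [SecondCountableTopology G] [MeasurableSpace G] [BorelSpace G]
    (K : E a × E b →L[ℝ] G) (N : E a' × E b' →L[ℝ] G)
    (h : ∀ φ : StrongDual ℝ G,
      ‖(φ.comp K).comp (.inl ℝ (E a) (E b))‖ ^ 2 + ‖(φ.comp K).comp (.inr ℝ (E a) (E b))‖ ^ 2 =
      ‖(φ.comp N).comp (.inl ℝ (E a') (E b'))‖ ^ 2 +
        ‖(φ.comp N).comp (.inr ℝ (E a') (E b'))‖ ^ 2) :
    ((stdGaussian (E a)).prod (stdGaussian (E b))).map K =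
      ((stdGaussian (E a')).prod (stdGaussian (E b'))).map N := by
  have : IsProbabilityMeasure (((stdGaussian (E a)).prod (stdGaussian (E b))).map K) :=
    Measure.isProbabilityMeasure_map K.continuous.measurable.aemeasurable
  have : IsProbabilityMeasure (((stdGaussian (E a')).prod (stdGaussian (E b'))).map N) :=
    Measure.isProbabilityMeasure_map N.continuous.measurable.aemeasurable
  refine Measure.ext_of_charFunDual (funext fun φ => ?_)
  rw [charFunDual_map, charFunDual_map, charFunDual_prod, charFunDual_prod]
  simp only [charFunDual_stdGaussian]
  rw [← Complex.exp_add, ← Complex.exp_add, ← add_div, ← add_div]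
  congr 2
  have := h φ
  rw [← neg_add, ← neg_add]
  congr 1
  exact_mod_cast this

lemma norm_dual_eq {n : ℕ} {φ : E n →L[ℝ] ℝ} {k : E n} (h : ∀ x, φ x = ⟪k, x⟫) :
    ‖φ‖ = ‖k‖ := by
  have : φ = innerSL ℝ k := by ext x; simp [h]
  rw [this, innerSL_apply_norm]

lemma exists_dual_eq {n : ℕ} (φ : E n →L[ℝ] ℝ) : ∃ k : E n, ∀ x, φ x = ⟪k, x⟫ :=
  ⟨(InnerProductSpace.toDual ℝ (E n)).symm φ, fun x => by simp⟩

/-- Gaussian average of `f` around `x`, with covariance `A Aᵀ`. -/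
def gaussAvg {m n : ℕ} (A : Matrix (Fin m) (Fin n) ℝ) (f : E m → ℝ≥0∞) (x : E m) : ℝ≥0∞ :=
  ∫⁻ ξ, f (x + act A ξ) ∂stdGaussian (E n)

section gaussAvg

variable {m n k : ℕ}

lemma measurable_gaussAvg (A : Matrix (Fin m) (Fin n) ℝ) {f : E m → ℝ≥0∞} (hf : Measurable f) :
    Measurable (gaussAvg A f) := by
  unfold gaussAvg
  exact Measurable.lintegral_prod_right' (f := fun q : E m × E n => f (q.1 + act A q.2))
    (by fun_prop)

lemma gaussAvg_mono (A : Matrix (Fin m) (Fin n) ℝ) {f g : E m → ℝ≥0∞} (h : ∀ x, f x ≤ g x)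
    (x : E m) : gaussAvg A f x ≤ gaussAvg A g x :=
  lintegral_mono fun _ => h _

lemma gaussAvg_const (A : Matrix (Fin m) (Fin n) ℝ) (c : ℝ≥0∞) (x : E m) :
    gaussAvg A (fun _ => c) x = c := by
  simp [gaussAvg]

lemma gaussAvg_comm (A : Matrix (Fin m) (Fin n) ℝ) (B : Matrix (Fin m) (Fin k) ℝ)
    {f : E m → ℝ≥0∞} (hf : Measurable f) (x : E m) :
    gaussAvg A (gaussAvg B f) x = gaussAvg B (gaussAvg A f) x := by
  unfold gaussAvg
  rw [lintegral_lintegral_swap]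
  · simp only [add_right_comm]
  · exact Measurable.aemeasurable
      (by unfold Function.uncurry; fun_prop)

/-- Gaussian averages compose by adding the covariances. -/
lemma gaussAvg_gaussAvg {k' : ℕ} {A : Matrix (Fin m) (Fin n) ℝ} {B : Matrix (Fin m) (Fin k) ℝ}
    {C : Matrix (Fin m) (Fin k') ℝ}
    (h : A * A.transpose + B * B.transpose = C * C.transpose)
    {f : E m → ℝ≥0∞} (hf : Measurable f) (x : E m) :
    gaussAvg A (gaussAvg B f) x = gaussAvg C f x := by
  have key := map_stdGaussian_prod_eq
    ((actL A).comp (.fst ℝ (E n) (E k)) + (actL B).comp (.snd ℝ (E n) (E k)))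
    -- The trivial factor `E 0` gives the single average the product form that the comparison lemma
    -- expects.
    ((actL C).comp (.fst ℝ (E k') (E 0))) (fun φ => by
      obtain ⟨s, hs⟩ := exists_dual_eq φ
      rw [norm_dual_eq (k := act A.transpose s), norm_dual_eq (k := act B.transpose s),
        norm_dual_eq (k := act C.transpose s), norm_dual_eq (k := 0)]
      · rw [norm_act_transpose_sq, norm_act_transpose_sq, norm_act_transpose_sq, ← h, add_act,
          inner_add_right]
        simp
      all_goals intro x; simp [hs, inner_act])
  have e := congrArg (fun μ : Measure (E m) => ∫⁻ y, f (x + y) ∂μ) key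
  simp only at e
  rw [lintegral_map (by fun_prop) (ContinuousLinearMap.continuous _).measurable,
    lintegral_map (by fun_prop) (ContinuousLinearMap.continuous _).measurable] at e
  simp only [_root_.add_apply, ContinuousLinearMap.comp_apply, actL_apply,
    ContinuousLinearMap.coe_fst', ContinuousLinearMap.coe_snd'] at e
  rw [lintegral_prod _ (Measurable.aemeasurable (by fun_prop)),
    lintegral_prod _ (Measurable.aemeasurable (by fun_prop))] at e
  simpa [gaussAvg, add_assoc] using e

lemma gaussAvg_eq_lintegral {A : Matrix (Fin n) (Fin n) ℝ} (hA : IsUnit A.det)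
    {f : E n → ℝ≥0∞} (hf : Measurable f) (x : E n) :
    gaussAvg A f x =
      ENNReal.ofReal |A⁻¹.det| * ∫⁻ β, gaussDensity (act A⁻¹ (β - x)) * f β := by
  unfold gaussAvg
  rw [lintegral_stdGaussian (by fun_prop),
    lintegral_comp_affine (A := A⁻¹) (Matrix.isUnit_nonsing_inv_det _ hA) (act A⁻¹ (-x))
      (by have := measurable_gaussDensity (n := n); fun_prop)]
  congr 1
  refine lintegral_congr fun β => ?_
  rw [← act_add, act_act_inv hA, sub_eq_neg_add]
  congr 2
  abel

lemma gaussAvg_eq_zero_iff {A : Matrix (Fin n) (Fin n) ℝ} (hA : IsUnit A.det)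
    {f : E n → ℝ≥0∞} (hf : Measurable f) (x : E n) :
    gaussAvg A f x = 0 ↔ f =ᵐ[volume] 0 := by
  have := (Matrix.isUnit_nonsing_inv_det _ hA).ne_zero
  rw [gaussAvg_eq_lintegral hA hf, mul_eq_zero, or_iff_right (by simpa using this),
    lintegral_eq_zero_iff (by have := measurable_gaussDensity (n := n); fun_prop)]
  refine ⟨fun h => ?_, fun h => ?_⟩
  · filter_upwards [h] with β hβ
    simpa [(gaussDensity_pos _).ne'] using hβ
  · filter_upwards [h] with β hβ
    simp [hβ]

end gaussAvg

/-! ### Sufficient statistics and posteriors -/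

section model

variable {d p p' : ℕ}

/-- The precision matrix `σ⁻² X Xᵀ + σ'⁻² X' X'ᵀ`. -/
def prec (X : Matrix (Fin d) (Fin p) ℝ) (X' : Matrix (Fin d) (Fin p') ℝ) (σ σ' : ℝ) :
    Matrix (Fin d) (Fin d) ℝ :=
  (σ ^ 2)⁻¹ • (X * X.transpose) + (σ' ^ 2)⁻¹ • (X' * X'.transpose)

/-- The weighted least squares estimate of `β` from both samples. -/
def estW (X : Matrix (Fin d) (Fin p) ℝ) (X' : Matrix (Fin d) (Fin p') ℝ) (σ σ' : ℝ)
    (y : E p) (z : E p') : E d :=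
  act (covMatW X X' σ σ') ((σ ^ 2)⁻¹ • act X y + (σ' ^ 2)⁻¹ • act X' z)

/-- The least squares estimate of `β` from the first sample. -/
def est (X : Matrix (Fin d) (Fin p) ℝ) (σ : ℝ) (y : E p) : E d :=
  act (covMat X σ) ((σ ^ 2)⁻¹ • act X y)

lemma continuous_estW_right (X : Matrix (Fin d) (Fin p) ℝ) (X' : Matrix (Fin d) (Fin p') ℝ)
    (σ σ' : ℝ) (y : E p) : Continuous (estW X X' σ σ' y) := by
  unfold estW; fun_prop

@[fun_prop] lemma continuous_est (X : Matrix (Fin d) (Fin p) ℝ) (σ : ℝ) :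
    Continuous (est X σ) := by
  unfold est; fun_prop

lemma posDef_mul_transpose {X : Matrix (Fin d) (Fin p) ℝ} (hX : IsUnit (X * X.transpose).det) :
    (X * X.transpose).PosDef := by
  have h : (X * X.transpose).PosSemidef := by
    simpa using Matrix.posSemidef_self_mul_conjTranspose X
  exact h.posDef_iff_isUnit.2 ((Matrix.isUnit_iff_isUnit_det _).2 hX)

lemma posSemidef_mul_transpose (X : Matrix (Fin d) (Fin p) ℝ) :
    (X * X.transpose).PosSemidef := by
  simpa using Matrix.posSemidef_self_mul_conjTranspose X

variable {X : Matrix (Fin d) (Fin p) ℝ} {X' : Matrix (Fin d) (Fin p') ℝ} {σ σ' : ℝ}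

lemma posDef_prec (hX : IsUnit (X * X.transpose).det) (hσ : 0 < σ) :
    (prec X X' σ σ').PosDef :=
  ((posDef_mul_transpose hX).smul (by positivity)).add_posSemidef
    ((posSemidef_mul_transpose X').smul (by positivity))

lemma posDef_covMatW (hX : IsUnit (X * X.transpose).det) (hσ : 0 < σ) :
    (covMatW X X' σ σ').PosDef := (posDef_prec hX hσ).inv

/-- The one-sample model is the two-sample model with an empty future sample, so every fact about
`C` follows from the one about `W`. -/
lemma covMat_eq_covMatW (X : Matrix (Fin d) (Fin p) ℝ) (σ : ℝ) (hσ : 0 < σ)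
    (hX : IsUnit (X * X.transpose).det) :
    covMat X σ = covMatW X (0 : Matrix (Fin d) (Fin 0) ℝ) σ 1 := by
  symm
  simp only [covMatW, covMat, Matrix.zero_mul, smul_zero, add_zero]
  refine Matrix.inv_eq_left_inv ?_
  rw [Matrix.smul_mul, Matrix.mul_smul, smul_smul, Matrix.nonsing_inv_mul _ hX,
    mul_inv_cancel₀ (by positivity), one_smul]

lemma posDef_covMat (hX : IsUnit (X * X.transpose).det) (hσ : 0 < σ) :
    (covMat X σ).PosDef := by
  rw [covMat_eq_covMatW X σ hσ hX]
  exact posDef_covMatW hX hσ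

lemma est_eq_estW (hX : IsUnit (X * X.transpose).det) (hσ : 0 < σ) (y : E p) :
    est X σ y = estW X (0 : Matrix (Fin d) (Fin 0) ℝ) σ 1 y 0 := by
  simp [est, estW, covMat_eq_covMatW X σ hσ hX]

open scoped MatrixOrder in
lemma sqrtMat_mul_self {M : Matrix (Fin d) (Fin d) ℝ} (hM : M.PosDef) :
    sqrtMat M * sqrtMat M = M :=
  CFC.sqrt_mul_sqrt_self M hM.posSemidef.nonneg

open scoped MatrixOrder in
lemma sqrtMat_transpose (M : Matrix (Fin d) (Fin d) ℝ) :
    (sqrtMat M).transpose = sqrtMat M := by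
  have h : (sqrtMat M).PosSemidef := Matrix.nonneg_iff_posSemidef.1 (CFC.sqrt_nonneg M)
  simpa using h.isHermitian.eq

lemma isUnit_det_sqrtMat {M : Matrix (Fin d) (Fin d) ℝ} (hM : M.PosDef) :
    IsUnit (sqrtMat M).det := by
  have h := congrArg Matrix.det (sqrtMat_mul_self hM)
  rw [Matrix.det_mul] at h
  have h2 := hM.det_pos.ne'
  rw [isUnit_iff_ne_zero]
  rintro h0
  rw [h0, zero_mul] at h
  exact h2 h.symm

lemma prec_mul_covMatW (hX : IsUnit (X * X.transpose).det) (hσ : 0 < σ) :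
    prec X X' σ σ' * covMatW X X' σ σ' = 1 :=
  Matrix.mul_nonsing_inv _ ((Matrix.isUnit_iff_isUnit_det _).1 (posDef_prec hX hσ).isUnit)

lemma covMatW_mul_prec (hX : IsUnit (X * X.transpose).det) (hσ : 0 < σ) :
    covMatW X X' σ σ' * prec X X' σ σ' = 1 :=
  Matrix.nonsing_inv_mul _ ((Matrix.isUnit_iff_isUnit_det _).1 (posDef_prec hX hσ).isUnit)

lemma sqrt_mul_prec_mul_sqrt (hX : IsUnit (X * X.transpose).det) (hσ : 0 < σ) :
    sqrtMat (covMatW X X' σ σ') * prec X X' σ σ' * sqrtMat (covMatW X X' σ σ') = 1 := by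
  set S := sqrtMat (covMatW X X' σ σ')
  have h : S * (S * prec X X' σ σ') = 1 := by
    rw [← mul_assoc, sqrtMat_mul_self (posDef_covMatW hX hσ), covMatW_mul_prec hX hσ]
  exact mul_eq_one_comm.1 h

/-- Completing the square in the exponent of the joint density of both samples. -/
lemma sum_sq_affine (hX : IsUnit (X * X.transpose).det) (hσ : 0 < σ) (y : E p) (z : E p')
    (ζ : E d) :
    let b := estW X X' σ σ' y z
    let β := b + act (sqrtMat (covMatW X X' σ σ')) ζ
    (σ ^ 2)⁻¹ * ‖y - act X.transpose β‖ ^ 2 + (σ' ^ 2)⁻¹ * ‖z - act X'.transpose β‖ ^ 2 =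
      (σ ^ 2)⁻¹ * ‖y - act X.transpose b‖ ^ 2 + (σ' ^ 2)⁻¹ * ‖z - act X'.transpose b‖ ^ 2 +
        ‖ζ‖ ^ 2 := by
  intro b β
  set S := sqrtMat (covMatW X X' σ σ') with hS
  set v := act S ζ with hv
  -- These are the normal equations for `b`; they make the cross term `hc` vanish.
  have hb : (σ ^ 2)⁻¹ • act X (act X.transpose b) + (σ' ^ 2)⁻¹ • act X' (act X'.transpose b) =
      (σ ^ 2)⁻¹ • act X y + (σ' ^ 2)⁻¹ • act X' z := by
    have : act (prec X X' σ σ') b = (σ ^ 2)⁻¹ • act X y + (σ' ^ 2)⁻¹ • act X' z := by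
      simp only [b, estW]
      rw [← act_mul, prec_mul_covMatW hX hσ, one_act]
    rw [← this, prec, add_act, smul_act, smul_act, act_mul, act_mul]
  have hv2 : (σ ^ 2)⁻¹ * ‖act X.transpose v‖ ^ 2 + (σ' ^ 2)⁻¹ * ‖act X'.transpose v‖ ^ 2 =
      ‖ζ‖ ^ 2 := by
    have h1 : (σ ^ 2)⁻¹ * ‖act X.transpose v‖ ^ 2 + (σ' ^ 2)⁻¹ * ‖act X'.transpose v‖ ^ 2 =
        ⟪v, act (prec X X' σ σ') v⟫ := by
      rw [norm_act_transpose_sq, norm_act_transpose_sq, prec, add_act, smul_act, smul_act,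
        inner_add_right, inner_smul_right, inner_smul_right]
    rw [h1, hv, inner_act, ← act_mul, ← act_mul, hS, sqrtMat_transpose,
      sqrt_mul_prec_mul_sqrt hX hσ, one_act, real_inner_self_eq_norm_sq]
  have hc : (σ ^ 2)⁻¹ * ⟪y - act X.transpose b, act X.transpose v⟫ +
      (σ' ^ 2)⁻¹ * ⟪z - act X'.transpose b, act X'.transpose v⟫ = 0 := by
    have e1 : ∀ {q : ℕ} (Y : Matrix (Fin d) (Fin q) ℝ) (w : E q),
        ⟪w, act Y.transpose v⟫ = ⟪act Y w, v⟫ := fun Y w => by rw [inner_act]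
    rw [e1, e1, ← real_inner_smul_left, ← real_inner_smul_left, ← inner_add_left]
    have : (σ ^ 2)⁻¹ • act X (y - act X.transpose b) +
        (σ' ^ 2)⁻¹ • act X' (z - act X'.transpose b) = 0 := by
      rw [act_sub, act_sub, smul_sub, smul_sub, sub_add_sub_comm, hb, sub_self]
    rw [this, inner_zero_left]
  have e2 : ∀ {q : ℕ} (Y : Matrix (Fin d) (Fin q) ℝ) (w : E q),
      ‖w - act Y.transpose β‖ ^ 2 = ‖w - act Y.transpose b‖ ^ 2 -
        2 * ⟪w - act Y.transpose b, act Y.transpose v⟫ + ‖act Y.transpose v‖ ^ 2 := by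
    intro q Y w
    rw [← norm_sub_sq_real]
    simp only [β, act_add, sub_sub, hv, hS]
  rw [e2, e2, ← hv2]
  linear_combination (-2) * hc

lemma density_pos (hσ : 0 < σ) (β : E d) (y : E p) : 0 < density X σ β y :=
  ENNReal.ofReal_pos.2 (by positivity)

lemma density_ne_top (β : E d) (y : E p) : density X σ β y ≠ ∞ := ENNReal.ofReal_ne_top

lemma measurable_density (X : Matrix (Fin d) (Fin p) ℝ) (σ : ℝ) :
    Measurable (fun q : E d × E p => density X σ q.1 q.2) := by
  unfold density; fun_prop

lemma measurable_density_left (X : Matrix (Fin d) (Fin p) ℝ) (σ : ℝ) (y : E p) :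
    Measurable (fun β => density X σ β y) := by
  unfold density; fun_prop

lemma measurable_density_right (X : Matrix (Fin d) (Fin p) ℝ) (σ : ℝ) (β : E d) :
    Measurable (fun y => density X σ β y) := by
  unfold density; fun_prop

/-- The posterior after both samples is a Gaussian average around the estimate of `β`. -/
lemma exists_lintegral_density_mul_density (hX : IsUnit (X * X.transpose).det) (hσ : 0 < σ)
    (hσ' : 0 < σ') (y : E p) (z : E p') :
    ∃ c : ℝ≥0∞, c ≠ 0 ∧ c ≠ ∞ ∧ ∀ π : E d → ℝ≥0∞, Measurable π →
      ∫⁻ β, density X' σ' β z * density X σ β y * π β =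
        c * gaussAvg (sqrtMat (covMatW X X' σ σ')) π (estW X X' σ σ' y z) := by
  set S := sqrtMat (covMatW X X' σ σ') with hS
  set b := estW X X' σ σ' y z with hb
  have hdet : IsUnit S.det := isUnit_det_sqrtMat (posDef_covMatW hX hσ)
  -- The joint density at its maximum `b`; the power of `2π` cancels the normalization of
  -- `gaussDensity`.
  set c₀ : ℝ≥0∞ := density X' σ' b z * density X σ b y *
    ENNReal.ofReal ((2 * Real.pi) ^ ((d : ℝ) / 2)) with hc₀
  have h₀ : ∀ ζ, density X' σ' (b + act S ζ) z * density X σ (b + act S ζ) y =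
      c₀ * gaussDensity ζ := by
    intro ζ
    have key := sum_sq_affine (X' := X') (σ' := σ') hX hσ y z ζ
    simp only [← hb, ← hS] at key
    simp only [hc₀, density, gaussDensity]
    rw [← ENNReal.ofReal_mul (by positivity), ← ENNReal.ofReal_mul (by positivity),
      ← ENNReal.ofReal_mul (by positivity), ← ENNReal.ofReal_mul (by positivity)]
    congr 1
    have hexp : ∀ a b : ℝ, ∀ s : ℝ, -a / (2 * s) = -(1 / 2) * (s⁻¹ * a) := by
      intro a b s
      rw [div_eq_mul_inv, mul_inv]; ring
    have e1 : Real.exp (-‖z - act X'.transpose (b + act S ζ)‖ ^ 2 / (2 * σ' ^ 2)) *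
        Real.exp (-‖y - act X.transpose (b + act S ζ)‖ ^ 2 / (2 * σ ^ 2)) =
        Real.exp (-‖z - act X'.transpose b‖ ^ 2 / (2 * σ' ^ 2)) *
        Real.exp (-‖y - act X.transpose b‖ ^ 2 / (2 * σ ^ 2)) * Real.exp (-‖ζ‖ ^ 2 / 2) := by
      rw [← Real.exp_add, ← Real.exp_add, ← Real.exp_add]
      congr 1
      rw [hexp _ 0, hexp _ 0, hexp _ 0, hexp _ 0]
      linear_combination (-1 / 2) * key
    have e2 : (2 * Real.pi) ^ ((d : ℝ) / 2) * (2 * Real.pi) ^ (-(d : ℝ) / 2) = 1 := by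
      rw [← Real.rpow_add (by positivity)]
      rw [show (d : ℝ) / 2 + -(d : ℝ) / 2 = 0 by ring, Real.rpow_zero]
    linear_combination (2 * Real.pi * σ' ^ 2) ^ (-(p' : ℝ) / 2) *
      (2 * Real.pi * σ ^ 2) ^ (-(p : ℝ) / 2) * e1 -
      (2 * Real.pi * σ' ^ 2) ^ (-(p' : ℝ) / 2) *
      (2 * Real.pi * σ ^ 2) ^ (-(p : ℝ) / 2) *
      (Real.exp (-‖z - act X'.transpose b‖ ^ 2 / (2 * σ' ^ 2)) *
        Real.exp (-‖y - act X.transpose b‖ ^ 2 / (2 * σ ^ 2)) * Real.exp (-‖ζ‖ ^ 2 / 2)) * e2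
  have hc₀0 : c₀ ≠ 0 := by
    simp only [hc₀, ne_eq, mul_eq_zero, not_or]
    exact ⟨⟨(density_pos hσ' _ _).ne', (density_pos hσ _ _).ne'⟩,
      (ENNReal.ofReal_pos.2 (by positivity)).ne'⟩
  have hc₀t : c₀ ≠ ∞ :=
    ENNReal.mul_ne_top (ENNReal.mul_ne_top (density_ne_top _ _) (density_ne_top _ _))
      ENNReal.ofReal_ne_top
  refine ⟨ENNReal.ofReal |S.det| * c₀, ?_, ENNReal.mul_ne_top ENNReal.ofReal_ne_top hc₀t, ?_⟩
  · simpa [hc₀0] using hdet.ne_zero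
  · intro π hπ
    have m1 := measurable_density_left X' σ' z
    have m2 := measurable_density_left X σ y
    have mg := measurable_gaussDensity (n := d)
    refine (lintegral_comp_affine hdet b (by fun_prop)).trans ?_
    simp only [h₀]
    rw [gaussAvg, lintegral_stdGaussian (by fun_prop), mul_assoc]
    simp only [mul_assoc]
    rw [lintegral_const_mul _ (by fun_prop)]

/-- The posterior after the first sample is a Gaussian average around the estimate of `β`. -/
lemma exists_marginal_eq (hX : IsUnit (X * X.transpose).det) (hσ : 0 < σ) (y : E p) :
    ∃ c : ℝ≥0∞, c ≠ 0 ∧ c ≠ ∞ ∧ ∀ π : E d → ℝ≥0∞, Measurable π →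
      marginal X σ π y = c * gaussAvg (sqrtMat (covMat X σ)) π (est X σ y) := by
  obtain ⟨c, h0, ht, h⟩ := exists_lintegral_density_mul_density
    (X' := (0 : Matrix (Fin d) (Fin 0) ℝ)) hX hσ one_pos y 0
  refine ⟨c, h0, ht, fun π hπ => ?_⟩
  rw [est_eq_estW hX hσ, covMat_eq_covMatW X σ hσ hX, ← h π hπ]
  have h0 : ∀ β, density (0 : Matrix (Fin d) (Fin 0) ℝ) 1 β 0 = 1 := by
    intro β
    have : act (0 : Matrix (Fin 0) (Fin d) ℝ) β = 0 := Subsingleton.elim _ _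
    simp [density, this]
  simp [marginal, h0]

/-- Integration against the density of a sample, in terms of standard Gaussian noise. -/
lemma lintegral_density (hσ : 0 < σ) (β : E d) {f : E p → ℝ≥0∞} (hf : Measurable f) :
    ∫⁻ y, density X σ β y * f y =
      ∫⁻ ε, f (act X.transpose β + σ • ε) ∂stdGaussian (E p) := by
  have m2 := measurable_density_right X σ β
  have hdet : (σ • (1 : Matrix (Fin p) (Fin p) ℝ)).det = σ ^ p := by simp
  have hpos : 0 < σ ^ p := pow_pos hσ p
  have mf : Measurable (fun ε : E p =>
      density X σ β (act X.transpose β + act (σ • (1 : Matrix (Fin p) (Fin p) ℝ)) ε) *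
        f (act X.transpose β + act (σ • (1 : Matrix (Fin p) (Fin p) ℝ)) ε)) := by fun_prop
  refine (lintegral_comp_affine (A := σ • (1 : Matrix (Fin p) (Fin p) ℝ))
    (by rw [hdet]; exact hpos.ne'.isUnit) (act X.transpose β) (by fun_prop)).trans ?_
  rw [lintegral_stdGaussian (by fun_prop), ← lintegral_const_mul _ mf]
  · refine lintegral_congr fun ε => ?_
    rw [smul_act, one_act, ← mul_assoc]
    congr 1
    rw [density, gaussDensity, ← ENNReal.ofReal_mul (abs_nonneg _), hdet, abs_of_pos hpos]
    congr 1
    have e1 : act X.transpose β + σ • ε - act X.transpose β = σ • ε := by abel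
    have e2 : (2 * Real.pi * σ ^ 2) ^ (-(p : ℝ) / 2) =
        (2 * Real.pi) ^ (-(p : ℝ) / 2) * (σ ^ p)⁻¹ := by
      rw [Real.mul_rpow (by positivity) (by positivity), ← Real.rpow_natCast σ 2,
        ← Real.rpow_mul hσ.le, ← Real.rpow_natCast σ p, ← Real.rpow_neg hσ.le]
      congr 2
      push_cast
      ring
    rw [e1, e2, norm_smul, mul_pow, Real.norm_eq_abs, sq_abs]
    have e3 : -(σ ^ 2 * ‖ε‖ ^ 2) / (2 * σ ^ 2) = -‖ε‖ ^ 2 / 2 := by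
      field_simp
    rw [e3]
    field_simp

/-- Since `W` inverts the precision matrix, the estimate reproduces `β` exactly and adds a linear
image of the noise. -/
lemma estW_affine (hX : IsUnit (X * X.transpose).det) (hσ : 0 < σ) (hσ' : 0 < σ') (β : E d)
    (ε : E p) (ε' : E p') :
    estW X X' σ σ' (act X.transpose β + σ • ε) (act X'.transpose β + σ' • ε') =
      β + (act (σ⁻¹ • (covMatW X X' σ σ' * X)) ε + act (σ'⁻¹ • (covMatW X X' σ σ' * X')) ε') := by
  have : act (covMatW X X' σ σ') (act (prec X X' σ σ') β) = β := by
    rw [← act_mul, covMatW_mul_prec hX hσ, one_act]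
  rw [prec, add_act, smul_act, smul_act, act_mul, act_mul] at this
  simp only [estW, smul_act, act_mul, act_add, act_smul, smul_add, smul_smul]
  simp only [act_add, act_smul] at this
  nth_rewrite 3 [← this]
  rw [show (σ ^ 2)⁻¹ * σ = σ⁻¹ by field_simp, show (σ' ^ 2)⁻¹ * σ' = σ'⁻¹ by field_simp]
  abel

lemma covMat_inv_mul (hX : IsUnit (X * X.transpose).det) (hσ : 0 < σ) :
    ((σ ^ 2)⁻¹ • (X * X.transpose)) * covMat X σ = 1 := by
  rw [covMat, Matrix.smul_mul, Matrix.mul_smul, smul_smul, inv_mul_cancel₀ (by positivity),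
    Matrix.mul_nonsing_inv _ hX, one_smul]

lemma est_affine (hX : IsUnit (X * X.transpose).det) (hσ : 0 < σ) (β : E d) (ε : E p) :
    est X σ (act X.transpose β + σ • ε) = β + act (σ⁻¹ • (covMat X σ * X)) ε := by
  have : act (covMat X σ) (act ((σ ^ 2)⁻¹ • (X * X.transpose)) β) = β := by
    rw [← act_mul, mul_eq_one_comm.1 (covMat_inv_mul hX hσ), one_act]
  rw [smul_act, act_mul] at this
  simp only [est, smul_act, act_mul, act_add, act_smul, smul_add, smul_smul]
  simp only [act_smul] at this
  rw [this, show (σ ^ 2)⁻¹ * σ = σ⁻¹ by field_simp]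

lemma covMat_transpose (hX : IsUnit (X * X.transpose).det) (hσ : 0 < σ) :
    (covMat X σ).transpose = covMat X σ := by
  simpa using (posDef_covMat (X := X) (σ := σ) hX hσ).isHermitian.eq

lemma covMatW_transpose (hX : IsUnit (X * X.transpose).det) (hσ : 0 < σ) :
    (covMatW X X' σ σ').transpose = covMatW X X' σ σ' := by
  simpa using (posDef_covMatW (X := X) (X' := X') (σ := σ) (σ' := σ') hX hσ).isHermitian.eq

/-- The joint covariance of the two estimates of `β`. -/
lemma joint_covariance (hX : IsUnit (X * X.transpose).det) (hσ : 0 < σ)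
    {A : Matrix (Fin d) (Fin d) ℝ}
    (hA : A * A.transpose = covMat X σ - covMatW X X' σ σ') (s t : E d) :
    ‖act (σ⁻¹ • (covMatW X X' σ σ' * X)).transpose s + act (σ⁻¹ • (covMat X σ * X)).transpose t‖ ^ 2
      + ‖act (σ'⁻¹ • (covMatW X X' σ σ' * X')).transpose s‖ ^ 2 =
    ‖act (sqrtMat (covMatW X X' σ σ')).transpose (s + t)‖ ^ 2 + ‖act A.transpose t‖ ^ 2 := by
  have hSS := sqrtMat_mul_self (posDef_covMatW (X' := X') (σ' := σ') hX hσ)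
  have hCsymm := covMat_transpose hX hσ
  have hWsymm := covMatW_transpose (X' := X') (σ' := σ') hX hσ
  have hCinv := covMat_inv_mul hX hσ
  have hWprec : prec X X' σ σ' * covMatW X X' σ σ' = 1 := prec_mul_covMatW hX hσ
  rw [prec] at hWprec
  set S := sqrtMat (covMatW X X' σ σ') with hS
  have hST : S.transpose = S := sqrtMat_transpose _
  clear_value S
  generalize covMatW X X' σ σ' = W at *
  generalize covMat X σ = C at *
  have e1 : act (σ⁻¹ • (W * X)).transpose s + act (σ⁻¹ • (C * X)).transpose t =
      σ⁻¹ • act X.transpose (act W s + act C t) := by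
    simp only [Matrix.transpose_smul, Matrix.transpose_mul, hWsymm, hCsymm, smul_act,
      act_mul, act_add, smul_add]
  have e2 : act (σ'⁻¹ • (W * X')).transpose s = σ'⁻¹ • act X'.transpose (act W s) := by
    simp only [Matrix.transpose_smul, Matrix.transpose_mul, hWsymm, smul_act, act_mul]
  have e3 : act ((σ ^ 2)⁻¹ • (X * X.transpose)) (act C t) = t := by
    rw [← act_mul, hCinv, one_act]
  have e4 : act ((σ ^ 2)⁻¹ • (X * X.transpose)) (act W s) +
      act ((σ' ^ 2)⁻¹ • (X' * X'.transpose)) (act W s) = s := by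
    rw [← add_act, ← act_mul, hWprec, one_act]
  rw [e1, e2, norm_smul, norm_smul, mul_pow, mul_pow, norm_act_transpose_sq,
    norm_act_transpose_sq, norm_act_transpose_sq, norm_act_transpose_sq, hA, hST, hSS]
  have n1 : ‖σ⁻¹‖ ^ 2 = (σ ^ 2)⁻¹ := by rw [Real.norm_eq_abs, sq_abs, inv_pow]
  have n2 : ‖σ'⁻¹‖ ^ 2 = (σ' ^ 2)⁻¹ := by rw [Real.norm_eq_abs, sq_abs, inv_pow]
  rw [n1, n2, ← inner_smul_right, ← inner_smul_right, ← smul_act, ← smul_act]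
  have hPsymm : ((σ ^ 2)⁻¹ • (X * X.transpose)).transpose = (σ ^ 2)⁻¹ • (X * X.transpose) := by
    simp
  generalize (σ ^ 2)⁻¹ • (X * X.transpose) = P at *
  generalize (σ' ^ 2)⁻¹ • (X' * X'.transpose) = Q at *
  have c2 : ⟪act W s, t⟫ = ⟪s, act W t⟫ := by rw [inner_act, hWsymm]
  have c3 : ⟪act W s, s⟫ = ⟪s, act W s⟫ := real_inner_comm _ _
  have c4 : ⟪act C t, t⟫ = ⟪t, act C t⟫ := real_inner_comm _ _
  have c5 : ⟪act C t, act P (act W s)⟫ = ⟪t, act W s⟫ := by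
    rw [real_inner_comm, inner_act, hPsymm, e3, real_inner_comm]
  have c6 : ⟪t, act W s⟫ = ⟪s, act W t⟫ := by rw [real_inner_comm, c2]
  -- The relation `(P + Q) W s = s` eliminates `Q`, the precision of the future sample; what remains
  -- is symmetry of `W`, `C` and `P`.
  rw [eq_sub_of_add_eq' e4, sub_act, act_add, e3, act_add]
  simp only [inner_add_left, inner_add_right, inner_sub_right]
  rw [c2, c3, c4, c5, c6]
  ring

/-- The errors of the two estimates have covariances `W` and `C` and cross-covariance `W`. So the
first-sample estimate is, in law, the weighted one plus independent noise of covariance `C - W`. -/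
lemma lintegral_noise_estW_est (hX : IsUnit (X * X.transpose).det) (hσ : 0 < σ)
    {A : Matrix (Fin d) (Fin d) ℝ}
    (hA : A * A.transpose = covMat X σ - covMatW X X' σ σ')
    {F : E d × E d → ℝ≥0∞} (hF : Measurable F) :
    ∫⁻ ε, ∫⁻ ε', F (act (σ⁻¹ • (covMatW X X' σ σ' * X)) ε +
        act (σ'⁻¹ • (covMatW X X' σ σ' * X')) ε', act (σ⁻¹ • (covMat X σ * X)) ε)
        ∂stdGaussian (E p') ∂stdGaussian (E p) =
      ∫⁻ ζ, ∫⁻ ξ, F (act (sqrtMat (covMatW X X' σ σ')) ζ,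
        act (sqrtMat (covMatW X X' σ σ')) ζ + act A ξ) ∂stdGaussian (E d)
        ∂stdGaussian (E d) := by
  have hcov := joint_covariance hX hσ hA
  generalize sqrtMat (covMatW X X' σ σ') = S at *
  generalize σ⁻¹ • (covMatW X X' σ σ' * X) = B₁ at *
  generalize σ'⁻¹ • (covMatW X X' σ σ' * X') = B₂ at *
  generalize σ⁻¹ • (covMat X σ * X) = B₃ at *
  have key := map_stdGaussian_prod_eq
    (((actL B₁).comp (.fst ℝ (E p) (E p')) + (actL B₂).comp (.snd ℝ (E p) (E p'))).prod
      ((actL B₃).comp (.fst ℝ (E p) (E p'))))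
    (((actL S).comp (.fst ℝ (E d) (E d))).prod
      ((actL S).comp (.fst ℝ (E d) (E d)) + (actL A).comp (.snd ℝ (E d) (E d)))) (fun φ => by
      obtain ⟨s, hs⟩ := exists_dual_eq (φ.comp (.inl ℝ (E d) (E d)))
      obtain ⟨t, ht⟩ := exists_dual_eq (φ.comp (.inr ℝ (E d) (E d)))
      have hφ : ∀ a b, φ (a, b) = ⟪s, a⟫ + ⟪t, b⟫ := by
        intro a b
        rw [← hs, ← ht]
        simp [← map_add]
      rw [norm_dual_eq (k := act B₁.transpose s + act B₃.transpose t),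
        norm_dual_eq (k := act B₂.transpose s),
        norm_dual_eq (k := act S.transpose (s + t)), norm_dual_eq (k := act A.transpose t)]
      · exact hcov s t
      all_goals
        intro x
        simp [hφ, inner_act, inner_add_left])
  have e := congrArg (fun μ : Measure (E d × E d) => ∫⁻ q, F q ∂μ) key
  simp only at e
  rw [lintegral_map hF (ContinuousLinearMap.continuous _).measurable,
    lintegral_map hF (ContinuousLinearMap.continuous _).measurable] at e
  simp only [_root_.add_apply, ContinuousLinearMap.comp_apply, actL_apply,
    ContinuousLinearMap.coe_fst', ContinuousLinearMap.coe_snd', ContinuousLinearMap.prod_apply]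
    at e
  rw [lintegral_prod _ (Measurable.aemeasurable (by fun_prop)),
    lintegral_prod _ (Measurable.aemeasurable (by fun_prop))] at e
  exact e

/-- The joint law of the two estimates of `β`. -/
lemma lintegral_density_estW_est (hX : IsUnit (X * X.transpose).det) (hσ : 0 < σ)
    (hσ' : 0 < σ') {A : Matrix (Fin d) (Fin d) ℝ}
    (hA : A * A.transpose = covMat X σ - covMatW X X' σ σ') (β : E d)
    {F : E d × E d → ℝ≥0∞} (hF : Measurable F) :
    ∫⁻ y, density X σ β y * ∫⁻ z, density X' σ' β z * F (estW X X' σ σ' y z, est X σ y) =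
      ∫⁻ ζ, ∫⁻ ξ, F (β + act (sqrtMat (covMatW X X' σ σ')) ζ,
        β + act (sqrtMat (covMatW X X' σ σ')) ζ + act A ξ) ∂stdGaussian (E d)
        ∂stdGaussian (E d) := by
  have hm : ∀ y, Measurable (fun z => F (estW X X' σ σ' y z, est X σ y)) := fun y =>
    hF.comp ((continuous_estW_right X X' σ σ' y).measurable.prodMk measurable_const)
  have hz : ∀ y, ∫⁻ z, density X' σ' β z * F (estW X X' σ σ' y z, est X σ y) =
      ∫⁻ ε', F (estW X X' σ σ' y (act X'.transpose β + σ' • ε'), est X σ y)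
        ∂stdGaussian (E p') := fun y => lintegral_density hσ' β (hm y)
  have mG : Measurable (fun y =>
      ∫⁻ ε', F (estW X X' σ σ' y (act X'.transpose β + σ' • ε'), est X σ y)
        ∂stdGaussian (E p')) :=
    Measurable.lintegral_prod_right' (f := fun q : E p × E p' =>
      F (estW X X' σ σ' q.1 (act X'.transpose β + σ' • q.2), est X σ q.1))
      (hF.comp (Measurable.prodMk (by unfold estW; fun_prop) (by fun_prop)))
  have e := lintegral_noise_estW_est (X' := X') (σ' := σ') hX hσ hA
    (F := fun q => F (β + q.1, β + q.2)) (by fun_prop)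
  refine (lintegral_congr fun y => ?_).trans ((lintegral_density (X := X) hσ β mG).trans
    ((lintegral_congr fun ε => ?_).trans (e.trans ?_)))
  · rw [hz]
  · simp only [estW_affine hX hσ hσ', est_affine hX hσ]
  · simp only [add_assoc]

end model

section divergence

open InformationTheory

/-! ### Kullback-Leibler divergences of densities -/

section kl

variable {α : Type*} {mα : MeasurableSpace α} {μ : Measure α}

lemma isFiniteMeasure_withDensity_of_eq_one {a : α → ℝ≥0∞} (h : ∫⁻ x, a x ∂μ = 1) :
    IsFiniteMeasure (μ.withDensity a) :=
  isFiniteMeasure_withDensity (by simp [h])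

/-- With `klFun` the integrand is nonnegative, so the formula holds in `[0, ∞]` without
integrability of the log ratio. -/
lemma klDiv_withDensity {a b : α → ℝ≥0∞} (ha : Measurable a) (hb : Measurable b)
    (ha1 : ∫⁻ x, a x ∂μ = 1) (hb1 : ∫⁻ x, b x ∂μ = 1) (hb0 : ∀ᵐ x ∂μ, b x ≠ 0) :
    klDiv (μ.withDensity a) (μ.withDensity b) =
      ∫⁻ x, ENNReal.ofReal (klFun (a x / b x).toReal) * b x ∂μ := by
  have := isFiniteMeasure_withDensity_of_eq_one ha1
  have := isFiniteMeasure_withDensity_of_eq_one hb1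
  have hbt : ∀ᵐ x ∂μ, b x ≠ ∞ := (ae_lt_top hb (by simp [hb1])).mono fun x hx => hx.ne
  have e : μ.withDensity a = (μ.withDensity b).withDensity (fun x => a x / b x) := by
    rw [← withDensity_mul μ hb (g := fun x => a x / b x) (ha.div hb)]
    refine withDensity_congr_ae ?_
    filter_upwards [hb0, hbt] with x h0 ht
    simp [ENNReal.mul_div_cancel h0 ht]
  have hac : μ.withDensity a ≪ μ.withDensity b := by
    rw [e]; exact withDensity_absolutelyContinuous _ _
  rw [klDiv_eq_lintegral_klFun_of_ac hac]
  have hr : (μ.withDensity a).rnDeriv (μ.withDensity b) =ᵐ[μ.withDensity b]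
      fun x => a x / b x := by
    rw [e]; exact Measure.rnDeriv_withDensity _ (ha.div hb)
  rw [lintegral_congr_ae (g := fun x => ENNReal.ofReal (klFun (a x / b x).toReal))
    (hr.mono fun x hx => by simp only [hx])]
  have mk : Measurable fun x => ENNReal.ofReal (klFun (a x / b x).toReal) := by
    have := measurable_klFun
    fun_prop
  rw [lintegral_withDensity_eq_lintegral_mul _ hb mk]
  simp [mul_comm]

/-- This is `a log(c/b) ≤ a (c/b - 1)`. All terms are moved to the side where they are positive, so
that the inequality passes to `[0, ∞]`. -/
lemma klFun_mul_add_le {a b c : ℝ} (ha : 0 < a) (hb : 0 < b) (hc : 0 < c) :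
    klFun (a / b) * b + a + c ≤ klFun (a / c) * c + a * (c / b) + b := by
  have h1 : Real.log (a / b) = Real.log a - Real.log b := Real.log_div ha.ne' hb.ne'
  have h2 : Real.log (a / c) = Real.log a - Real.log c := Real.log_div ha.ne' hc.ne'
  have h3 : Real.log c - Real.log b ≤ c / b - 1 := by
    rw [← Real.log_div hc.ne' hb.ne']
    exact Real.log_le_sub_one_of_pos (by positivity)
  have e1 : klFun (a / b) * b = a * (Real.log a - Real.log b) + b - a := by
    rw [klFun_apply, h1]; field_simp
  have e2 : klFun (a / c) * c = a * (Real.log a - Real.log c) + c - a := by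
    rw [klFun_apply, h2]; field_simp
  rw [e1, e2]
  nlinarith [mul_le_mul_of_nonneg_left h3 ha.le]

lemma ofReal_klFun_mul_add_le {a b c : ℝ≥0∞} (ha : a ≠ 0) (ha' : a ≠ ∞) (hb : b ≠ 0) (hb' : b ≠ ∞)
    (hc : c ≠ 0) (hc' : c ≠ ∞) :
    ENNReal.ofReal (klFun (a / b).toReal) * b + a + c ≤
      ENNReal.ofReal (klFun (a / c).toReal) * c + a * (c / b) + b := by
  lift a to NNReal using ha'
  lift b to NNReal using hb'
  lift c to NNReal using hc'
  have ha0 : 0 < (a : ℝ) := by exact_mod_cast pos_iff_ne_zero.2 (by simpa using ha)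
  have hb0 : 0 < (b : ℝ) := by exact_mod_cast pos_iff_ne_zero.2 (by simpa using hb)
  have hc0 : 0 < (c : ℝ) := by exact_mod_cast pos_iff_ne_zero.2 (by simpa using hc)
  have key := ENNReal.ofReal_le_ofReal (klFun_mul_add_le ha0 hb0 hc0)
  have n1 : 0 ≤ klFun ((a : ℝ) / b) := klFun_nonneg (by positivity)
  have n2 : 0 ≤ klFun ((a : ℝ) / c) := klFun_nonneg (by positivity)
  rw [ENNReal.ofReal_add (by positivity) (by positivity),
    ENNReal.ofReal_add (by positivity) (by positivity),
    ENNReal.ofReal_add (by positivity) (by positivity),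
    ENNReal.ofReal_add (by positivity) (by positivity), ENNReal.ofReal_mul n1,
    ENNReal.ofReal_mul n2, ENNReal.ofReal_mul ha0.le, ENNReal.ofReal_div_of_pos hb0] at key
  simpa [ENNReal.toReal_div] using key

/-- Comparison of the divergences of two densities from a third one. -/
lemma klDiv_withDensity_add_one_le {a b c : α → ℝ≥0∞} (ha : Measurable a) (hb : Measurable b)
    (hc : Measurable c) (ha1 : ∫⁻ x, a x ∂μ = 1) (hb1 : ∫⁻ x, b x ∂μ = 1)
    (hc1 : ∫⁻ x, c x ∂μ = 1) (ha0 : ∀ x, a x ≠ 0) (hat : ∀ x, a x ≠ ∞) (hb0 : ∀ x, b x ≠ 0)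
    (hbt : ∀ x, b x ≠ ∞) :
    klDiv (μ.withDensity a) (μ.withDensity b) + 1 ≤
      klDiv (μ.withDensity a) (μ.withDensity c) + ∫⁻ x, a x * (c x / b x) ∂μ := by
  by_cases hac : μ.withDensity a ≪ μ.withDensity c
  swap
  · rw [klDiv_of_not_ac hac]; simp
  have hμa : μ ≪ μ.withDensity a :=
    withDensity_absolutelyContinuous' ha.aemeasurable (Filter.Eventually.of_forall ha0)
  -- As `a` is nowhere zero, absolute continuity forces `c` to be positive almost everywhere.
  have hc0 : ∀ᵐ x ∂μ, c x ≠ 0 := by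
    refine (hμa.trans hac) ?_
    rw [withDensity_apply_eq_zero hc]
    convert! measure_empty (μ := μ)
    ext x
    simp
  have hct : ∀ᵐ x ∂μ, c x ≠ ∞ := (ae_lt_top hc (by simp [hc1])).mono fun x hx => hx.ne
  rw [klDiv_withDensity ha hb ha1 hb1 (Filter.Eventually.of_forall hb0),
    klDiv_withDensity ha hc ha1 hc1 hc0]
  have key : ∫⁻ x, (ENNReal.ofReal (klFun (a x / b x).toReal) * b x + a x + c x) ∂μ ≤
      ∫⁻ x, (ENNReal.ofReal (klFun (a x / c x).toReal) * c x + a x * (c x / b x) + b x) ∂μ := by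
    refine lintegral_mono_ae ?_
    filter_upwards [hc0, hct] with x h0 ht
    exact ofReal_klFun_mul_add_le (ha0 x) (hat x) (hb0 x) (hbt x) h0 ht
  rw [lintegral_add_right _ hc, lintegral_add_right _ ha, lintegral_add_right _ hb,
    lintegral_add_right _ (by fun_prop), ha1, hb1, hc1] at key
  exact (ENNReal.add_le_add_iff_right ENNReal.one_ne_top).1 key

end kl

/-! ### Risks and Bayesian predictive densities -/

section risk

variable {d p p' : ℕ} {X : Matrix (Fin d) (Fin p) ℝ} {X' : Matrix (Fin d) (Fin p') ℝ} {σ σ' : ℝ}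

lemma lintegral_density_eq_one (hσ : 0 < σ) (β : E d) : ∫⁻ y, density X σ β y = 1 := by
  have h := lintegral_density (X := X) hσ β (f := fun _ => 1) measurable_const
  simpa using h

/-- Comparison of two risks through the average of a likelihood ratio. -/
lemma risk_add_one_le (hσ : 0 < σ) (hσ' : 0 < σ') {b c : E p → E p' → ℝ≥0∞}
    (hb : IsPredictiveDensity b) (hc : IsPredictiveDensity c) (hb0 : ∀ y z, b y z ≠ 0)
    (hbt : ∀ y z, b y z ≠ ∞) (β : E d) :
    risk X X' σ σ' b β + 1 ≤ risk X X' σ σ' c β +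
      ∫⁻ y, density X σ β y * ∫⁻ z, density X' σ' β z * (c y z / b y z) := by
  have m1 := measurable_density_right X σ β
  have m2 := measurable_density_right X' σ' β
  have mb : ∀ y, Measurable (b y) := fun y => hb.1.comp measurable_prodMk_left
  have mc : ∀ y, Measurable (c y) := fun y => hc.1.comp measurable_prodMk_left
  have mcb : Measurable (fun q : E p × E p' => c q.1 q.2 / b q.1 q.2) := hc.1.div hb.1
  have mI : Measurable (fun y => ∫⁻ z, density X' σ' β z * (c y z / b y z)) :=
    Measurable.lintegral_prod_right' (f := fun q : E p × E p' =>
      density X' σ' β q.2 * (c q.1 q.2 / b q.1 q.2)) ((m2.comp measurable_snd).mul mcb)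
  have h1 : risk X X' σ σ' b β + 1 = ∫⁻ y, (density X σ β y *
      klDiv (volume.withDensity (density X' σ' β)) (volume.withDensity (b y)) +
        density X σ β y) := by
    -- Only the second summand has to be measurable, so measurability of the divergence in `y` is
    -- not needed.
    rw [lintegral_add_right _ m1, lintegral_density_eq_one hσ]; rfl
  have h2 : risk X X' σ σ' c β +
      ∫⁻ y, density X σ β y * ∫⁻ z, density X' σ' β z * (c y z / b y z) =
      ∫⁻ y, (density X σ β y *
        klDiv (volume.withDensity (density X' σ' β)) (volume.withDensity (c y)) +
        density X σ β y * ∫⁻ z, density X' σ' β z * (c y z / b y z)) := by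
    have m3 : Measurable (fun y => density X σ β y *
      ∫⁻ z, density X' σ' β z * (c y z / b y z)) := m1.mul mI
    rw [lintegral_add_right _ m3]; rfl
  rw [h1, h2]
  refine lintegral_mono fun y => ?_
  have key := klDiv_withDensity_add_one_le (μ := volume) m2 (mb y) (mc y)
    (lintegral_density_eq_one hσ' β) (hb.2 y) (hc.2 y) (fun z => (density_pos hσ' β z).ne')
    (fun z => density_ne_top β z) (hb0 y) (hbt y)
  calc _ = density X σ β y *
      (klDiv (volume.withDensity (density X' σ' β)) (volume.withDensity (b y)) + 1) := by
        rw [mul_add, mul_one]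
    _ ≤ _ := by rw [← mul_add]; gcongr

variable {π : E d → ℝ≥0∞}

lemma measurable_marginal (X : Matrix (Fin d) (Fin p) ℝ) (σ : ℝ) (hπ : Measurable π) :
    Measurable (marginal X σ π) := by
  unfold marginal
  exact Measurable.lintegral_prod_right' (f := fun q : E p × E d => density X σ q.2 q.1 * π q.2)
    (((measurable_density X σ).comp measurable_swap).mul (hπ.comp measurable_snd))

lemma measurable_joint (X : Matrix (Fin d) (Fin p) ℝ) (X' : Matrix (Fin d) (Fin p') ℝ)
    (σ σ' : ℝ) (hπ : Measurable π) :
    Measurable (fun q : (E p × E p') × E d =>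
      density X' σ' q.2 q.1.2 * density X σ q.2 q.1.1 * π q.2) := by
  unfold density
  fun_prop

lemma isPredictiveDensity_bayes (hσ' : 0 < σ') (hπ : Measurable π)
    (hm : ∀ y, marginal X σ π y ≠ 0 ∧ marginal X σ π y ≠ ⊤) :
    IsPredictiveDensity (bayesPredictive X X' σ σ' π) := by
  have mj := measurable_joint X X' σ σ' hπ
  refine ⟨?_, fun y => ?_⟩
  · exact (Measurable.lintegral_prod_right' mj).div
      ((measurable_marginal X σ hπ).comp measurable_fst)
  · unfold bayesPredictive
    simp only [div_eq_mul_inv]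
    have mz : Measurable (fun z => ∫⁻ β, density X' σ' β z * density X σ β y * π β) :=
      Measurable.lintegral_prod_right' (f := fun q : E p' × E d =>
        density X' σ' q.2 q.1 * density X σ q.2 y * π q.2) (by unfold density; fun_prop)
    rw [lintegral_mul_const _ mz, lintegral_lintegral_swap]
    · have : ∀ β, ∫⁻ z, density X' σ' β z * density X σ β y * π β = density X σ β y * π β := by
        intro β
        have m2 := measurable_density_right X' σ' β
        simp only [mul_assoc]
        rw [lintegral_mul_const _ m2, lintegral_density_eq_one hσ', one_mul]
      simp only [this]
      exact ENNReal.mul_inv_cancel (hm y).1 (hm y).2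
    · refine Measurable.aemeasurable ?_
      unfold Function.uncurry density
      fun_prop

/-- The Bayesian predictive density in terms of Gaussian averages of the prior. -/
lemma exists_bayesPredictive_eq (hX : IsUnit (X * X.transpose).det) (hσ : 0 < σ) (hσ' : 0 < σ')
    {A : Matrix (Fin d) (Fin d) ℝ}
    (hA : A * A.transpose = covMat X σ - covMatW X X' σ σ') (y : E p) (z : E p') :
    ∃ c : ℝ≥0∞, c ≠ 0 ∧ c ≠ ∞ ∧ ∀ π : E d → ℝ≥0∞, Measurable π →
      bayesPredictive X X' σ σ' π y z =
        c * (gaussAvg (sqrtMat (covMatW X X' σ σ')) π (estW X X' σ σ' y z) /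
          gaussAvg A (gaussAvg (sqrtMat (covMatW X X' σ σ')) π) (est X σ y)) := by
  obtain ⟨c₁, h10, h1t, h1⟩ := exists_marginal_eq hX hσ y
  obtain ⟨c₂, h20, h2t, h2⟩ := exists_lintegral_density_mul_density (X' := X') hX hσ hσ' y z
  refine ⟨c₂ / c₁, ENNReal.div_ne_zero.2 ⟨h20, h1t⟩, ENNReal.div_ne_top h2t h10, fun π hπ => ?_⟩
  have hTT : A * A.transpose + sqrtMat (covMatW X X' σ σ') *
      (sqrtMat (covMatW X X' σ σ')).transpose =
      sqrtMat (covMat X σ) * (sqrtMat (covMat X σ)).transpose := by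
    rw [sqrtMat_transpose, sqrtMat_transpose, sqrtMat_mul_self (posDef_covMat hX hσ),
      sqrtMat_mul_self (posDef_covMatW hX hσ), hA, sub_add_cancel]
  rw [bayesPredictive, h1 π hπ, h2 π hπ, gaussAvg_gaussAvg hTT hπ]
  rw [div_eq_mul_inv, div_eq_mul_inv, div_eq_mul_inv,
    ENNReal.mul_inv (Or.inl h10) (Or.inl h1t)]
  ring

lemma marginal_eq_gaussAvg (hX : IsUnit (X * X.transpose).det) (hσ : 0 < σ)
    {A : Matrix (Fin d) (Fin d) ℝ}
    (hA : A * A.transpose = covMat X σ - covMatW X X' σ σ') (y : E p) :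
    ∃ c : ℝ≥0∞, c ≠ 0 ∧ c ≠ ∞ ∧ ∀ π : E d → ℝ≥0∞, Measurable π →
      marginal X σ π y =
        c * gaussAvg A (gaussAvg (sqrtMat (covMatW X X' σ σ')) π) (est X σ y) := by
  obtain ⟨c₁, h10, h1t, h1⟩ := exists_marginal_eq hX hσ y
  refine ⟨c₁, h10, h1t, fun π hπ => ?_⟩
  have hTT : A * A.transpose + sqrtMat (covMatW X X' σ σ') *
      (sqrtMat (covMatW X X' σ σ')).transpose =
      sqrtMat (covMat X σ) * (sqrtMat (covMat X σ)).transpose := by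
    rw [sqrtMat_transpose, sqrtMat_transpose, sqrtMat_mul_self (posDef_covMat hX hσ),
      sqrtMat_mul_self (posDef_covMatW hX hσ), hA, sub_add_cancel]
  rw [h1 π hπ, gaussAvg_gaussAvg hTT hπ]

lemma marginal_one_ne (hX : IsUnit (X * X.transpose).det) (hσ : 0 < σ) (y : E p) :
    marginal X σ (fun _ => 1) y ≠ 0 ∧ marginal X σ (fun _ => 1) y ≠ ⊤ := by
  obtain ⟨c, h0, ht, h⟩ := exists_marginal_eq hX hσ y
  rw [h _ measurable_const, gaussAvg_const, mul_one]
  exact ⟨h0, ht⟩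

lemma density_le (X : Matrix (Fin d) (Fin p) ℝ) (σ : ℝ) (β : E d) (y : E p) :
    density X σ β y ≤ ENNReal.ofReal ((2 * Real.pi * σ ^ 2) ^ (-(p : ℝ) / 2)) := by
  unfold density
  refine ENNReal.ofReal_le_ofReal ?_
  refine mul_le_of_le_one_right (by positivity) (Real.exp_le_one_iff.2 ?_)
  rw [neg_div]
  exact neg_nonpos.2 (by positivity)

/-- Noise-free samples are estimated exactly. This turns facts about the marginals at data points
into facts at every point of the parameter space. -/
lemma estW_surjective (hX : IsUnit (X * X.transpose).det) (hσ : 0 < σ) (hσ' : 0 < σ') (x : E d) :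
    estW X X' σ σ' (act X.transpose x) (act X'.transpose x) = x := by
  simpa using estW_affine (X := X) (X' := X') hX hσ hσ' x 0 0

lemma est_surjective (hX : IsUnit (X * X.transpose).det) (hσ : 0 < σ) (x : E d) :
    est X σ (act X.transpose x) = x := by
  simpa using est_affine (X := X) hX hσ x 0

/-- If the marginals are finite and positive, so are the Gaussian averages of the prior. -/
lemma gaussAvg_sqrt_ne (hX : IsUnit (X * X.transpose).det) (hσ : 0 < σ) (hσ' : 0 < σ')
    (hπ : Measurable π) (hm : ∀ y, marginal X σ π y ≠ 0 ∧ marginal X σ π y ≠ ⊤) (x : E d) :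
    gaussAvg (sqrtMat (covMatW X X' σ σ')) π x ≠ 0 ∧
      gaussAvg (sqrtMat (covMatW X X' σ σ')) π x ≠ ⊤ := by
  obtain ⟨c₂, h20, h2t, h2⟩ := exists_lintegral_density_mul_density (X' := X') hX hσ hσ'
    (act X.transpose x) (act X'.transpose x)
  have e := h2 π hπ
  rw [estW_surjective hX hσ hσ'] at e
  have hm0 := hm (act X.transpose x)
  constructor
  · intro h0
    rw [gaussAvg_eq_zero_iff (isUnit_det_sqrtMat (posDef_covMatW hX hσ)) hπ] at h0
    refine hm0.1 ?_
    unfold marginal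
    rw [lintegral_congr_ae (g := fun _ => 0) (h0.mono fun β hβ => by simp [hβ])]
    simp
  · intro ht
    rw [ht, ENNReal.mul_top h20] at e
    refine (?_ : ∫⁻ β, density X' σ' β (act X'.transpose x) * density X σ β (act X.transpose x) *
      π β ≠ ⊤) e
    -- The density of the future sample is bounded, so the joint integral is at most a multiple of
    -- the marginal.
    refine ne_top_of_le_ne_top (ENNReal.mul_ne_top (ENNReal.ofReal_ne_top
      (r := (2 * Real.pi * σ' ^ 2) ^ (-(p' : ℝ) / 2))) hm0.2) ?_
    unfold marginal
    rw [← lintegral_const_mul' _ _ ENNReal.ofReal_ne_top]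
    refine lintegral_mono fun β => ?_
    rw [← mul_assoc]
    gcongr
    exact density_le X' σ' _ _

lemma gaussAvg_gaussAvg_sqrt_ne (hX : IsUnit (X * X.transpose).det) (hσ : 0 < σ)
    {A : Matrix (Fin d) (Fin d) ℝ}
    (hA : A * A.transpose = covMat X σ - covMatW X X' σ σ')
    (hπ : Measurable π) (hm : ∀ y, marginal X σ π y ≠ 0 ∧ marginal X σ π y ≠ ⊤) (x : E d) :
    gaussAvg A (gaussAvg (sqrtMat (covMatW X X' σ σ')) π) x ≠ 0 ∧
      gaussAvg A (gaussAvg (sqrtMat (covMatW X X' σ σ')) π) x ≠ ⊤ := by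
  obtain ⟨c, h0, ht, h⟩ := marginal_eq_gaussAvg (X' := X') (σ' := σ') hX hσ hA (act X.transpose x)
  have hm0 := hm (act X.transpose x)
  rw [h π hπ, est_surjective hX hσ] at hm0
  refine ⟨right_ne_zero_of_mul hm0.1, fun h' => hm0.2 ?_⟩
  rw [h', ENNReal.mul_top h0]

lemma bayesPredictive_ne (hX : IsUnit (X * X.transpose).det) (hσ : 0 < σ) (hσ' : 0 < σ')
    {A : Matrix (Fin d) (Fin d) ℝ}
    (hA : A * A.transpose = covMat X σ - covMatW X X' σ σ')
    (hπ : Measurable π) (hm : ∀ y, marginal X σ π y ≠ 0 ∧ marginal X σ π y ≠ ⊤) (y : E p)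
    (z : E p') :
    bayesPredictive X X' σ σ' π y z ≠ 0 ∧ bayesPredictive X X' σ σ' π y z ≠ ⊤ := by
  obtain ⟨c, h0, ht, h⟩ := exists_bayesPredictive_eq (X' := X') hX hσ hσ' hA y z
  have h1 := gaussAvg_sqrt_ne (X' := X') hX hσ hσ' hπ hm (estW X X' σ σ' y z)
  have h2 := gaussAvg_gaussAvg_sqrt_ne (X' := X') hX hσ hA hπ hm (est X σ y)
  rw [h π hπ]
  exact ⟨mul_ne_zero h0 (ENNReal.div_ne_zero.2 ⟨h1.1, h2.2⟩),
    ENNReal.mul_ne_top ht (ENNReal.div_ne_top h1.2 h2.1)⟩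

/-- The average of the likelihood ratio of two Bayesian predictive densities, in terms of the
Gaussian averages of the priors. -/
lemma lintegral_bayes_div_bayes (hX : IsUnit (X * X.transpose).det) (hσ : 0 < σ) (hσ' : 0 < σ')
    {A : Matrix (Fin d) (Fin d) ℝ}
    (hA : A * A.transpose = covMat X σ - covMatW X X' σ σ')
    {τ : E d → ℝ≥0∞} (hπ : Measurable π) (hτ : Measurable τ) (β : E d) :
    ∫⁻ y, density X σ β y * ∫⁻ z, density X' σ' β z *
      (bayesPredictive X X' σ σ' τ y z / bayesPredictive X X' σ σ' π y z) =
    gaussAvg (sqrtMat (covMatW X X' σ σ')) (fun x => ∫⁻ ξ,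
      (gaussAvg (sqrtMat (covMatW X X' σ σ')) τ x /
        gaussAvg A (gaussAvg (sqrtMat (covMatW X X' σ σ')) τ) (x + act A ξ)) /
      (gaussAvg (sqrtMat (covMatW X X' σ σ')) π x /
        gaussAvg A (gaussAvg (sqrtMat (covMatW X X' σ σ')) π) (x + act A ξ))
      ∂stdGaussian (E d)) β := by
  have mu : ∀ {ρ : E d → ℝ≥0∞}, Measurable ρ →
      Measurable (gaussAvg (sqrtMat (covMatW X X' σ σ')) ρ) := fun h => measurable_gaussAvg _ h
  have mv : ∀ {ρ : E d → ℝ≥0∞}, Measurable ρ →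
      Measurable (gaussAvg A (gaussAvg (sqrtMat (covMatW X X' σ σ')) ρ)) :=
    fun h => measurable_gaussAvg _ (mu h)
  have m1 := mu hπ
  have m2 := mu hτ
  have m3 := mv hπ
  have m4 := mv hτ
  have key := lintegral_density_estW_est (X' := X') hX hσ hσ' hA β (F := fun q =>
    (gaussAvg (sqrtMat (covMatW X X' σ σ')) τ q.1 /
        gaussAvg A (gaussAvg (sqrtMat (covMatW X X' σ σ')) τ) q.2) /
      (gaussAvg (sqrtMat (covMatW X X' σ σ')) π q.1 /
        gaussAvg A (gaussAvg (sqrtMat (covMatW X X' σ σ')) π) q.2)) (by fun_prop)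
  refine Eq.trans (lintegral_congr fun y => ?_) key
  congr 1
  refine lintegral_congr fun z => ?_
  obtain ⟨c, h0, ht, h⟩ := exists_bayesPredictive_eq (X' := X') hX hσ hσ' hA y z
  -- The factor `c` was obtained before the prior, hence is common to both predictions and cancels.
  rw [h π hπ, h τ hτ, ENNReal.mul_div_mul_left _ _ h0 ht]

end risk

end divergence

/-! ### Superharmonic functions and quadratic test functions -/

section superharmonic

variable {d : ℕ}

lemma sum_inner_act_single (B : Matrix (Fin d) (Fin d) ℝ) :
    ∑ i, ⟪EuclideanSpace.single i (1 : ℝ), act B (EuclideanSpace.single i (1 : ℝ))⟫ = B.trace := by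
  simp [act, Matrix.trace, EuclideanSpace.inner_single_left]

/-- A quadratic polynomial with trace-free quadratic part is harmonic. -/
lemma harmonicAt_quadratic {B : Matrix (Fin d) (Fin d) ℝ} (hB : B.transpose = B)
    (htr : B.trace = 0) (v : ℝ) (b x₀ x : E d) :
    InnerProductSpace.HarmonicAt
      (fun x => v + ⟪b, x - x₀⟫ + ⟪x - x₀, act B (x - x₀)⟫) x := by
  set w : E d → ℝ := fun x => v + ⟪b, x - x₀⟫ + ⟪x - x₀, act B (x - x₀)⟫ with hw
  have h1 : ∀ x, HasFDerivAt w
      (innerSL ℝ b + (2 : ℝ) • innerSL ℝ (act B (x - x₀))) x := by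
    intro x
    have hid : HasFDerivAt (fun x : E d => x - x₀) (ContinuousLinearMap.id ℝ (E d)) x :=
      (hasFDerivAt_id x).sub_const x₀
    have hA : HasFDerivAt (fun x : E d => act B (x - x₀)) (actL B) x :=
      (actL B).hasFDerivAt.comp x hid
    have hb : HasFDerivAt (fun x : E d => ⟪b, x - x₀⟫) (innerSL ℝ b) x :=
      (innerSL ℝ b).hasFDerivAt.comp x hid
    have := (hb.const_add v).add (hid.inner ℝ hA)
    refine this.congr_fderiv ?_
    generalize x - x₀ = u
    ext h
    have e1 : ⟪u, act B h⟫ = ⟪act B u, h⟫ := by rw [inner_act, hB]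
    simp [fderivInnerCLM_apply, e1, real_inner_comm (act B u) h]
    ring
  have h2 : fderiv ℝ w = fun x => innerSL ℝ b + (2 : ℝ) • innerSL ℝ (act B (x - x₀)) :=
    funext fun x => (h1 x).fderiv
  have h3 : ∀ x h, fderiv ℝ (fderiv ℝ w) x h = (2 : ℝ) • innerSL ℝ (act B h) := by
    intro x h
    have hid : HasFDerivAt (fun x : E d => x - x₀) (ContinuousLinearMap.id ℝ (E d)) x :=
      (hasFDerivAt_id x).sub_const x₀
    have : HasFDerivAt (fderiv ℝ w) ((2 : ℝ) • ((innerSL ℝ (E := E d)).comp (actL B))) x := by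
      rw [h2]
      have := (((innerSL ℝ (E := E d)).comp (actL B)).hasFDerivAt.comp x hid).const_smul (2 : ℝ)
      simpa using this.const_add (innerSL ℝ b)
    rw [this.fderiv]
    simp
  refine ⟨?_, Filter.Eventually.of_forall fun y => ?_⟩
  · have : ContDiff ℝ 2 w := by
      have hA : ContDiff ℝ 2 (fun x : E d => act B (x - x₀)) :=
        (actL B).contDiff.comp (contDiff_id.sub contDiff_const)
      exact (contDiff_const.add (contDiff_const.inner ℝ (contDiff_id.sub contDiff_const))).add
        ((contDiff_id.sub contDiff_const).inner ℝ hA)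
    exact this.contDiffAt
  · rw [InnerProductSpace.laplacian_eq_iteratedFDeriv_orthonormalBasis w
      (EuclideanSpace.basisFun (Fin d) ℝ)]
    simp only [iteratedFDeriv_two_apply, h3]
    simp only [Matrix.cons_val_zero, Matrix.cons_val_one, EuclideanSpace.basisFun_apply,
      _root_.smul_apply, innerSL_apply_apply, Pi.zero_apply, smul_eq_mul]
    rw [← Finset.mul_sum]
    rw [Finset.sum_congr rfl fun i _ => real_inner_comm _ _, sum_inner_act_single, htr, mul_zero]

lemma Superharmonic.lowerSemicontinuous {f : E d → ℝ≥0∞} (hf : Superharmonic f) :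
    LowerSemicontinuous f := by
  intro x y hy
  have h := hf.lsc x (Set.mem_univ x) (y : EReal) (by simpa using hy)
  rw [nhdsWithin_univ] at h
  exact h.mono fun z hz => by simpa using hz

/-- A quadratic polynomial touching a superharmonic function from below, up to third order, has a
non-positive Laplacian. -/
lemma Superharmonic.trace_nonpos {f : E d → ℝ≥0∞} (hf : Superharmonic f) {x₀ : E d}
    {b : E d} {B : Matrix (Fin d) (Fin d) ℝ} (hB : B.transpose = B) {v C : ℝ}
    (hx₀ : f x₀ = ENNReal.ofReal v) (hv : 0 ≤ v)
    (h : ∀ h : E d, ‖h‖ ≤ 1 →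
      ((v + ⟪b, h⟫ + ⟪h, act B h⟫ - C * ‖h‖ ^ 3 : ℝ) : EReal) ≤ f (x₀ + h)) :
    B.trace ≤ 0 := by
  by_contra! htr
  have hd : 0 < (d : ℝ) := by
    rcases Nat.eq_zero_or_pos d with rfl | h0
    · simp [Matrix.trace] at htr
    · exact_mod_cast h0
  set c := B.trace / d with hc
  have hc0 : 0 < c := div_pos htr hd
  -- On this radius the cubic error is at most half of the gain `c r²` made by removing the trace.
  set r := min 1 (c / (2 * (|C| + 1))) with hr
  have hr0 : 0 < r := lt_min one_pos (by positivity)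
  have hr1 : r ≤ 1 := min_le_left _ _
  have hrC : C * r ≤ c / 2 := by
    have h1 : r ≤ c / (2 * (|C| + 1)) := min_le_right _ _
    rw [le_div_iff₀ (by positivity)] at h1
    nlinarith [le_abs_self C]
  set B' := B - c • (1 : Matrix (Fin d) (Fin d) ℝ) with hB'
  have hB'T : B'.transpose = B' := by simp [hB', hB]
  have hB'tr : B'.trace = 0 := by
    simp only [hB', Matrix.trace_sub, Matrix.trace_smul, Matrix.trace_one, Fintype.card_fin,
      smul_eq_mul, hc]
    field_simp
    ring
  -- A harmonic barrier: on the sphere it lies below `f`, yet at the centre it exceeds `f x₀ = v` by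
  -- `c r² / 2`.
  set w : E d → ℝ := fun x => (v + c / 2 * r ^ 2) + ⟪b, x - x₀⟫ + ⟪x - x₀, act B' (x - x₀)⟫
    with hw
  have key := hf.comparison (Metric.ball x₀ r) w Metric.isOpen_ball
    (by rw [closure_ball _ hr0.ne']; exact isCompact_closedBall _ _) (Set.subset_univ _)
    (by have := continuous_act B'; fun_prop)
    (fun x _ => harmonicAt_quadratic hB'T hB'tr _ _ _ _) ?_ x₀ (Metric.mem_ball_self hr0)
  · have e : w x₀ = v + c / 2 * r ^ 2 := by simp [hw]
    simp only [hx₀, e] at key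
    rw [EReal.coe_ennreal_ofReal, max_eq_left hv] at key
    have := EReal.coe_le_coe_iff.1 key
    nlinarith [mul_pos hc0 (pow_pos hr0 2)]
  · intro x hx
    rw [frontier_ball _ hr0.ne', mem_sphere_iff_norm] at hx
    have h1 := h (x - x₀) (by rw [hx]; exact hr1)
    rw [add_sub_cancel] at h1
    refine le_trans (EReal.coe_le_coe_iff.2 ?_) h1
    simp only [hw, hB', sub_act B, smul_act, one_act, inner_sub_right _ (act B _),
      inner_smul_right, real_inner_self_eq_norm_sq, hx]
    have : C * r ^ 3 ≤ c / 2 * r ^ 2 := by nlinarith [pow_pos hr0 2]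
    linarith [this]

end superharmonic

/-! ### Second order lower bounds for Gaussian averages -/

section heat

variable {d : ℕ}

lemma integral_stdGaussian (F : E d → ℝ) :
    ∫ ξ, F ξ ∂stdGaussian (E d) =
      ∫ ξ, (2 * Real.pi) ^ (-(d : ℝ) / 2) * Real.exp (-‖ξ‖ ^ 2 / 2) * F ξ := by
  rw [stdGaussian_eq_withDensity, integral_withDensity_eq_integral_toReal_smul
    measurable_gaussDensity (Filter.Eventually.of_forall fun x => (gaussDensity_ne_top x).lt_top)]
  refine integral_congr_ae (Filter.Eventually.of_forall fun x => ?_)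
  simp only [gaussDensity, smul_eq_mul]
  rw [ENNReal.toReal_ofReal (by positivity)]

/-- The Cameron-Martin formula. It moves the shift onto the Gaussian weight, so averages can be
expanded in space without differentiating `F`. -/
lemma integral_stdGaussian_shift (F : E d → ℝ) (a : E d) :
    ∫ ξ, F (ξ + a) ∂stdGaussian (E d) =
      ∫ ξ, F ξ * Real.exp (⟪a, ξ⟫ - ‖a‖ ^ 2 / 2) ∂stdGaussian (E d) := by
  rw [integral_stdGaussian, integral_stdGaussian, ← integral_sub_right_eq_self _ a]
  refine integral_congr_ae (Filter.Eventually.of_forall fun x => ?_)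
  simp only [sub_add_cancel]
  have : Real.exp (-‖x - a‖ ^ 2 / 2) =
      Real.exp (-‖x‖ ^ 2 / 2) * Real.exp (⟪a, x⟫ - ‖a‖ ^ 2 / 2) := by
    rw [← Real.exp_add, norm_sub_sq_real, real_inner_comm]
    congr 1
    ring
  rw [this]
  ring

/-- The analogue for dilations, used to expand in time. -/
lemma integral_stdGaussian_scale (F : E d → ℝ) {μ : ℝ} (hμ : 0 < μ) :
    ∫ ξ, F (μ⁻¹ • ξ) ∂stdGaussian (E d) =
      μ ^ d * ∫ ξ, F ξ * Real.exp (-((μ ^ 2 - 1) / 2 * ‖ξ‖ ^ 2)) ∂stdGaussian (E d) := by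
  rw [integral_stdGaussian, integral_stdGaussian]
  have h := Measure.integral_comp_smul (volume : Measure (E d))
    (fun ξ : E d => (2 * Real.pi) ^ (-(d : ℝ) / 2) * Real.exp (-‖μ • ξ‖ ^ 2 / 2) * F ξ) μ⁻¹
  simp only [smul_smul, mul_inv_cancel₀ hμ.ne', one_smul] at h
  rw [h, finrank_euclideanSpace_fin, inv_pow, inv_inv, abs_of_pos (pow_pos hμ d), smul_eq_mul]
  congr 1
  refine integral_congr_ae (Filter.Eventually.of_forall fun x => ?_)
  simp only
  have : Real.exp (-‖μ • x‖ ^ 2 / 2) =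
      Real.exp (-‖x‖ ^ 2 / 2) * Real.exp (-((μ ^ 2 - 1) / 2 * ‖x‖ ^ 2)) := by
    rw [← Real.exp_add, norm_smul, mul_pow, Real.norm_eq_abs, sq_abs]
    congr 1
    ring
  rw [this]
  ring

lemma integrable_one_add_norm_pow (d k : ℕ) :
    Integrable (fun ξ : E d => (1 + ‖ξ‖) ^ k) (stdGaussian (E d)) := by
  have h1 : MemLp (fun ξ : E d => ‖ξ‖) (k : ℝ≥0∞) (stdGaussian (E d)) :=
    (IsGaussian.memLp_id (stdGaussian (E d)) k (by simp)).norm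
  have h2 : MemLp (fun _ : E d => (1 : ℝ)) (k : ℝ≥0∞) (stdGaussian (E d)) := memLp_const 1
  have h : Integrable (fun ξ : E d => ‖1 + ‖ξ‖‖ ^ k) (stdGaussian (E d)) :=
    (h2.add h1).integrable_norm_pow'
  refine h.congr (Filter.Eventually.of_forall fun x => ?_)
  simp only
  rw [Real.norm_of_nonneg (by positivity)]

lemma integrable_of_le_one_add_norm_pow {G : Type*} [NormedAddCommGroup G] {F : E d → G}
    (hF : AEStronglyMeasurable F (stdGaussian (E d))) (C : ℝ) (k : ℕ)
    (h : ∀ ξ, ‖F ξ‖ ≤ C * (1 + ‖ξ‖) ^ k) : Integrable F (stdGaussian (E d)) :=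
  Integrable.mono' ((integrable_one_add_norm_pow d k).const_mul C) hF
    (Filter.Eventually.of_forall h)

/-- A Taylor polynomial of odd degree bounds `exp` from below on the whole line. A global bound is
needed because `⟪a, ξ⟫` is unbounded. For `x ≤ 0` the difference `k` has derivative `h ≤ 0` and
vanishes at zero. -/
lemma cubic_le_exp (x : ℝ) : 1 + x + x ^ 2 / 2 + x ^ 3 / 6 ≤ Real.exp x := by
  rcases le_total 0 x with hx | hx
  · have := Real.sum_le_exp_of_nonneg hx 4
    simp only [Finset.sum_range_succ, Finset.sum_range_zero, Nat.factorial] at this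
    norm_num at this
    linarith
  · set h : ℝ → ℝ := fun x => Real.exp x - 1 - x - x ^ 2 / 2 with hh
    have dh : ∀ x, HasDerivAt h (Real.exp x - 1 - x) x := fun x => by
      refine ((((Real.hasDerivAt_exp x).sub_const 1).sub (hasDerivAt_id x)).sub
        ((hasDerivAt_pow 2 x).div_const 2)).congr_deriv ?_
      simp only [Nat.cast_ofNat]
      ring
    have mh : Monotone h := monotone_of_deriv_nonneg (fun x => (dh x).differentiableAt) fun x => by
      rw [(dh x).deriv]
      linarith [Real.add_one_le_exp x]
    set k : ℝ → ℝ := fun x => Real.exp x - 1 - x - x ^ 2 / 2 - x ^ 3 / 6 with hk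
    have dk : ∀ x, HasDerivAt k (h x) x := fun x => by
      refine (((((Real.hasDerivAt_exp x).sub_const 1).sub (hasDerivAt_id x)).sub
        ((hasDerivAt_pow 2 x).div_const 2)).sub ((hasDerivAt_pow 3 x).div_const 6)).congr_deriv ?_
      simp only [Nat.cast_ofNat, hh]
      ring
    have mk : AntitoneOn k (Set.Iic 0) := by
      refine antitoneOn_of_deriv_nonpos (convex_Iic 0)
        (fun x _ => (dk x).continuousAt.continuousWithinAt)
        (fun x _ => (dk x).differentiableAt.differentiableWithinAt) fun x hx => ?_
      rw [interior_Iic, Set.mem_Iio] at hx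
      rw [(dk x).deriv]
      have := mh hx.le
      simpa [hh] using this
    have := mk (Set.mem_Iic.2 hx) (Set.mem_Iic.2 le_rfl) hx
    simp only [hk] at this
    norm_num at this
    linarith

lemma integrable_exp_inner (a : E d) :
    Integrable (fun ξ : E d => Real.exp (⟪a, ξ⟫ - ‖a‖ ^ 2 / 2)) (stdGaussian (E d)) := by
  rw [stdGaussian_eq_withDensity, integrable_withDensity_iff_integrable_smul'
    measurable_gaussDensity (Filter.Eventually.of_forall fun x => (gaussDensity_ne_top x).lt_top)]
  refine (((integrable_exp_neg_mul_norm_sq (n := d) (b := 1 / 2) (by norm_num)).comp_sub_right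
    a).const_mul ((2 * Real.pi) ^ (-(d : ℝ) / 2))).congr (Filter.Eventually.of_forall fun x => ?_)
  simp only [gaussDensity, smul_eq_mul]
  rw [ENNReal.toReal_ofReal (by positivity), mul_assoc, ← Real.exp_add, norm_sub_sq_real,
    real_inner_comm]
  congr 2
  ring

/-- Lower bound of the Cameron-Martin density up to third order. -/
lemma quadratic_le_exp_inner {R : ℝ} (hR : 0 ≤ R) {a ξ : E d} (ha : ‖a‖ ≤ R) :
    1 + ⟪a, ξ⟫ - ‖a‖ ^ 2 / 2 + ⟪a, ξ⟫ ^ 2 / 2 - (1 + (1 + R) ^ 3) * ‖a‖ ^ 3 * (1 + ‖ξ‖) ^ 3 ≤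
      Real.exp (⟪a, ξ⟫ - ‖a‖ ^ 2 / 2) := by
  set s := ⟪a, ξ⟫ with hs
  set α := ‖a‖ with hα
  have hα0 : 0 ≤ α := norm_nonneg a
  have hn : 0 ≤ ‖ξ‖ := norm_nonneg ξ
  have hsabs : |s| ≤ α * ‖ξ‖ := abs_real_inner_le_norm a ξ
  refine le_trans ?_ (cubic_le_exp (s - α ^ 2 / 2))
  set T := 1 + ‖ξ‖ with hT
  have hT1 : 1 ≤ T := by linarith
  have hx : |s - α ^ 2 / 2| ≤ α * (1 + R) * T := by
    have h1 : α ^ 2 / 2 ≤ α * R * T := by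
      nlinarith [mul_nonneg hα0 hR, mul_le_mul_of_nonneg_left ha hα0,
        mul_nonneg (mul_nonneg hα0 hR) hn]
    have h2 : |s - α ^ 2 / 2| ≤ |s| + α ^ 2 / 2 := by
      refine (abs_sub _ _).trans ?_
      rw [abs_of_nonneg (by positivity : 0 ≤ α ^ 2 / 2)]
    nlinarith [mul_nonneg hα0 hn]
  -- The cube accounts for the part `(1 + R) ^ 3` of the constant, the mixed term `s α² / 2` of the
  -- square for the remaining `1`.
  have hcube : -(α * (1 + R) * T) ^ 3 ≤ (s - α ^ 2 / 2) ^ 3 := by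
    have := pow_le_pow_left₀ (abs_nonneg _) hx 3
    rw [← abs_pow] at this
    linarith [neg_abs_le ((s - α ^ 2 / 2) ^ 3)]
  have hmix : -(α ^ 3 * T ^ 3) ≤ -(s * α ^ 2) / 2 := by
    have h1 : s * α ^ 2 ≤ α ^ 3 * T := by
      have : s ≤ α * T := (le_abs_self s).trans (hsabs.trans (by nlinarith))
      nlinarith [mul_le_mul_of_nonneg_right this (pow_nonneg hα0 2)]
    have h2 : α ^ 3 * T ≤ α ^ 3 * T ^ 3 := by
      have : T ≤ T ^ 3 := le_self_pow₀ hT1 (by norm_num)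
      exact mul_le_mul_of_nonneg_left this (by positivity)
    have h3 : 0 ≤ α ^ 3 * T ^ 3 := by positivity
    linarith
  have e1 : (α * (1 + R) * T) ^ 3 = (1 + R) ^ 3 * α ^ 3 * T ^ 3 := by ring
  rw [e1] at hcube
  have h4 : 0 ≤ (1 + R) ^ 3 * α ^ 3 * T ^ 3 := by positivity
  have e2 : (s - α ^ 2 / 2) ^ 2 = s ^ 2 - s * α ^ 2 + α ^ 4 / 4 := by ring
  rw [e2]
  have h5 : 0 ≤ α ^ 4 := by positivity
  linarith

variable {Φ : E d → ℝ} {K : ℝ}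

/-- The matrix of second moments of `Φ` under the standard Gaussian measure. -/
def secondMoment (Φ : E d → ℝ) : Matrix (Fin d) (Fin d) ℝ :=
  Matrix.of fun i j => ∫ ξ, Φ ξ * (ξ i * ξ j) ∂stdGaussian (E d)

lemma secondMoment_transpose (Φ : E d → ℝ) : (secondMoment Φ).transpose = secondMoment Φ := by
  ext i j
  simp [secondMoment, mul_comm]

lemma abs_coord_le (ξ : E d) (i : Fin d) : |ξ i| ≤ 1 + ‖ξ‖ := by
  have := PiLp.norm_apply_le ξ i
  rw [Real.norm_eq_abs] at this
  linarith [this]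

lemma integrable_moment (hΦ : Continuous Φ) (hΦ0 : ∀ ξ, 0 ≤ Φ ξ) (hΦK : ∀ ξ, Φ ξ ≤ K)
    (i j : Fin d) :
    Integrable (fun ξ => Φ ξ * (ξ i * ξ j)) (stdGaussian (E d)) := by
  refine integrable_of_le_one_add_norm_pow (by fun_prop) K 2 fun ξ => ?_
  rw [Real.norm_eq_abs, abs_mul, abs_mul, abs_of_nonneg (hΦ0 ξ), pow_two]
  have hK := (hΦ0 ξ).trans (hΦK ξ)
  have h1 := abs_coord_le ξ i
  have h2 := abs_coord_le ξ j
  have h3 := hΦK ξ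
  gcongr

lemma inner_secondMoment (hΦ : Continuous Φ) (hΦ0 : ∀ ξ, 0 ≤ Φ ξ) (hΦK : ∀ ξ, Φ ξ ≤ K) (a : E d) :
    ⟪a, act (secondMoment Φ) a⟫ = ∫ ξ, Φ ξ * ⟪a, ξ⟫ ^ 2 ∂stdGaussian (E d) := by
  have e : ∀ ξ : E d, Φ ξ * ⟪a, ξ⟫ ^ 2 = ∑ i, ∑ j, a i * a j * (Φ ξ * (ξ i * ξ j)) := by
    intro ξ
    have : ⟪a, ξ⟫ = ∑ i, a i * ξ i := by
      simp [PiLp.inner_apply, mul_comm]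
    rw [this, pow_two, Finset.sum_mul_sum, Finset.mul_sum]
    refine Finset.sum_congr rfl fun i _ => ?_
    rw [Finset.mul_sum]
    refine Finset.sum_congr rfl fun j _ => ?_
    ring
  simp only [e]
  rw [integral_finsetSum _ fun i _ => integrable_finsetSum _ fun j _ =>
    (integrable_moment hΦ hΦ0 hΦK i j).const_mul _]
  simp only [act, PiLp.inner_apply, Matrix.mulVec, dotProduct, secondMoment, Matrix.of_apply]
  refine Finset.sum_congr rfl fun i _ => ?_
  rw [integral_finsetSum _ fun j _ => (integrable_moment hΦ hΦ0 hΦK i j).const_mul _]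
  simp only [RCLike.inner_apply, conj_trivial, Finset.sum_mul]
  refine Finset.sum_congr rfl fun j _ => ?_
  rw [integral_const_mul]
  ring

lemma trace_secondMoment (hΦ : Continuous Φ) (hΦ0 : ∀ ξ, 0 ≤ Φ ξ) (hΦK : ∀ ξ, Φ ξ ≤ K) :
    (secondMoment Φ).trace = ∫ ξ, Φ ξ * ‖ξ‖ ^ 2 ∂stdGaussian (E d) := by
  have e : ∀ ξ : E d, Φ ξ * ‖ξ‖ ^ 2 = ∑ i, Φ ξ * (ξ i * ξ i) := by
    intro ξ
    rw [EuclideanSpace.real_norm_sq_eq, Finset.mul_sum]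
    simp [pow_two]
  simp only [e]
  rw [integral_finsetSum _ fun i _ => integrable_moment hΦ hΦ0 hΦK i i]
  simp [Matrix.trace, secondMoment]

/-- Second order lower bound of a Gaussian average in the space variable. -/
lemma exists_space_lower_bound (hΦ : Continuous Φ) (hΦ0 : ∀ ξ, 0 ≤ Φ ξ) (hΦK : ∀ ξ, Φ ξ ≤ K)
    {R : ℝ} (hR : 0 ≤ R) :
    ∃ (m : E d) (C : ℝ), 0 ≤ C ∧ ∀ a : E d, ‖a‖ ≤ R →
      ∫ ξ, Φ ξ ∂stdGaussian (E d) + ⟪m, a⟫ - ‖a‖ ^ 2 / 2 * ∫ ξ, Φ ξ ∂stdGaussian (E d) +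
        ⟪a, act (secondMoment Φ) a⟫ / 2 - C * ‖a‖ ^ 3 ≤
      ∫ ξ, Φ (ξ + a) ∂stdGaussian (E d) := by
  have hK : ∀ ξ : E d, 0 ≤ K := fun ξ => (hΦ0 ξ).trans (hΦK ξ)
  have i0 : Integrable Φ (stdGaussian (E d)) :=
    integrable_of_le_one_add_norm_pow (by fun_prop) K 0 fun ξ => by
      rw [Real.norm_of_nonneg (hΦ0 ξ)]; simpa using hΦK ξ
  have i1 : Integrable (fun ξ => Φ ξ • ξ) (stdGaussian (E d)) :=
    integrable_of_le_one_add_norm_pow (by fun_prop) K 1 fun ξ => by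
      rw [norm_smul, Real.norm_of_nonneg (hΦ0 ξ), pow_one]
      have := hΦK ξ
      have := hK ξ
      gcongr
      linarith
  have i3 : Integrable (fun ξ => Φ ξ * (1 + ‖ξ‖) ^ 3) (stdGaussian (E d)) :=
    integrable_of_le_one_add_norm_pow (by fun_prop) K 3 fun ξ => by
      rw [norm_mul, Real.norm_of_nonneg (hΦ0 ξ), Real.norm_of_nonneg (by positivity)]
      have := hΦK ξ
      gcongr
  -- The gradient term is the first moment of `Φ`; the bound is `quadratic_le_exp_inner` integrated
  -- against `Φ ≥ 0`.
  refine ⟨∫ ξ, Φ ξ • ξ ∂stdGaussian (E d),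
    (1 + (1 + R) ^ 3) * ∫ ξ, Φ ξ * (1 + ‖ξ‖) ^ 3 ∂stdGaussian (E d), ?_, fun a ha => ?_⟩
  · have : 0 ≤ ∫ ξ, Φ ξ * (1 + ‖ξ‖) ^ 3 ∂stdGaussian (E d) :=
      integral_nonneg fun ξ => mul_nonneg (hΦ0 ξ) (by positivity)
    positivity
  have i2 : Integrable (fun ξ => Φ ξ * ⟪a, ξ⟫ ^ 2) (stdGaussian (E d)) :=
    integrable_of_le_one_add_norm_pow (by fun_prop) (K * ‖a‖ ^ 2) 2 fun ξ => by
      rw [norm_mul, Real.norm_of_nonneg (hΦ0 ξ), Real.norm_of_nonneg (by positivity), mul_assoc,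
        ← mul_pow, ← sq_abs]
      have := hΦK ξ
      have := hK ξ
      have h1 : |⟪a, ξ⟫| ≤ ‖a‖ * (1 + ‖ξ‖) :=
        (abs_real_inner_le_norm a ξ).trans (by nlinarith [norm_nonneg a])
      gcongr
  have i1' : Integrable (fun ξ => Φ ξ * ⟪a, ξ⟫) (stdGaussian (E d)) := by
    refine (i1.const_inner a).congr (Filter.Eventually.of_forall fun ξ => ?_)
    simp [inner_smul_right]
  have hm : ⟪∫ ξ, Φ ξ • ξ ∂stdGaussian (E d), a⟫ = ∫ ξ, Φ ξ * ⟪a, ξ⟫ ∂stdGaussian (E d) := by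
    rw [real_inner_comm, ← integral_inner i1]
    simp [inner_smul_right]
  rw [integral_stdGaussian_shift, inner_secondMoment hΦ hΦ0 hΦK, hm]
  have iE : Integrable (fun ξ => Φ ξ * Real.exp (⟪a, ξ⟫ - ‖a‖ ^ 2 / 2)) (stdGaussian (E d)) := by
    refine Integrable.mono' ((integrable_exp_inner a).const_mul K) (by fun_prop)
      (Filter.Eventually.of_forall fun ξ => ?_)
    rw [norm_mul, Real.norm_of_nonneg (hΦ0 ξ), Real.norm_of_nonneg (Real.exp_nonneg _)]
    exact mul_le_mul_of_nonneg_right (hΦK ξ) (Real.exp_nonneg _)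
  have iL1 := i0.add i1'
  have iL2 := iL1.sub (i0.const_mul (‖a‖ ^ 2 / 2))
  have iL3 := iL2.add (i2.const_mul (1 / 2))
  have iL4 := iL3.sub (i3.const_mul ((1 + (1 + R) ^ 3) * ‖a‖ ^ 3))
  have hle := integral_mono iL4 iE fun ξ => by
    have := mul_le_mul_of_nonneg_left (quadratic_le_exp_inner (ξ := ξ) hR ha) (hΦ0 ξ)
    refine le_trans (le_of_eq ?_) this
    simp only [Pi.add_apply, Pi.sub_apply]
    ring
  rw [integral_sub' iL3 (i3.const_mul _), integral_add' iL2 (i2.const_mul _),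
    integral_sub' iL1 (i0.const_mul _), integral_add' i0 i1', integral_const_mul,
    integral_const_mul, integral_const_mul] at hle
  linarith

/-- Second order lower bound of a Gaussian average in the time variable. -/
lemma exists_time_lower_bound (hΦ : Continuous Φ) (hΦ0 : ∀ ξ, 0 ≤ Φ ξ) (hΦK : ∀ ξ, Φ ξ ≤ K) :
    ∃ C : ℝ, 0 ≤ C ∧ ∀ τ : ℝ, 0 ≤ τ → τ ≤ 1 →
      ∫ ξ, Φ ξ ∂stdGaussian (E d) + τ * (d * ∫ ξ, Φ ξ ∂stdGaussian (E d) -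
        ∫ ξ, Φ ξ * ‖ξ‖ ^ 2 ∂stdGaussian (E d)) - C * τ ^ 2 ≤
      ∫ ξ, Φ ((1 + τ)⁻¹ • ξ) ∂stdGaussian (E d) := by
  have i0 : Integrable Φ (stdGaussian (E d)) :=
    integrable_of_le_one_add_norm_pow (by fun_prop) K 0 fun ξ => by
      rw [Real.norm_of_nonneg (hΦ0 ξ)]; simpa using hΦK ξ
  have i2 : Integrable (fun ξ => Φ ξ * ‖ξ‖ ^ 2) (stdGaussian (E d)) :=
    integrable_of_le_one_add_norm_pow (by fun_prop) K 2 fun ξ => by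
      rw [norm_mul, Real.norm_of_nonneg (hΦ0 ξ), Real.norm_of_nonneg (by positivity)]
      have := hΦK ξ
      have := (hΦ0 ξ).trans (hΦK ξ)
      gcongr
      linarith
  set U := ∫ ξ, Φ ξ ∂stdGaussian (E d) with hU
  set Q := ∫ ξ, Φ ξ * ‖ξ‖ ^ 2 ∂stdGaussian (E d) with hQ
  have hQ0 : 0 ≤ Q := integral_nonneg fun ξ => mul_nonneg (hΦ0 ξ) (by positivity)
  -- In `(1 + dτ)(U - (τ + τ²/2) Q)` the terms beyond first order are `-τ² (Q/2 + dQ) - τ³ dQ/2`,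
  -- and `τ³ ≤ τ²`.
  refine ⟨Q / 2 + 3 / 2 * d * Q, by positivity, fun τ h0 h1 => ?_⟩
  rw [integral_stdGaussian_scale Φ (by linarith : 0 < 1 + τ)]
  set J := ∫ ξ, Φ ξ * Real.exp (-(((1 + τ) ^ 2 - 1) / 2 * ‖ξ‖ ^ 2)) ∂stdGaussian (E d) with hJ
  have iJ : Integrable (fun ξ => Φ ξ * Real.exp (-(((1 + τ) ^ 2 - 1) / 2 * ‖ξ‖ ^ 2)))
      (stdGaussian (E d)) := by
    refine Integrable.mono' i0 (by fun_prop) (Filter.Eventually.of_forall fun ξ => ?_)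
    rw [norm_mul, Real.norm_of_nonneg (hΦ0 ξ), Real.norm_of_nonneg (by positivity)]
    refine mul_le_of_le_one_right (hΦ0 ξ) (Real.exp_le_one_iff.2 ?_)
    have : 0 ≤ (1 + τ) ^ 2 - 1 := by nlinarith
    rw [neg_nonpos]
    positivity
  have hJ1 : U - (τ + τ ^ 2 / 2) * Q ≤ J := by
    rw [hU, hQ, ← integral_const_mul, ← integral_sub i0 (i2.const_mul _)]
    refine integral_mono (i0.sub (i2.const_mul _)) iJ fun ξ => ?_
    have := Real.add_one_le_exp (-(((1 + τ) ^ 2 - 1) / 2 * ‖ξ‖ ^ 2))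
    have := mul_le_mul_of_nonneg_left this (hΦ0 ξ)
    refine le_trans (le_of_eq ?_) this
    ring
  have hJ0 : 0 ≤ J := integral_nonneg fun ξ => mul_nonneg (hΦ0 ξ) (Real.exp_nonneg _)
  have hB : 1 + d * τ ≤ (1 + τ) ^ d := one_add_mul_le_pow (by linarith) d
  have hd : (0 : ℝ) ≤ d := Nat.cast_nonneg d
  calc U + τ * (d * U - Q) - (Q / 2 + 3 / 2 * d * Q) * τ ^ 2
      ≤ (1 + d * τ) * (U - (τ + τ ^ 2 / 2) * Q) := by
        have : 0 ≤ d * Q * τ ^ 2 * (1 - τ) :=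
          mul_nonneg (by positivity) (by linarith)
        nlinarith [this]
    _ ≤ (1 + d * τ) * J := mul_le_mul_of_nonneg_left hJ1 (by positivity)
    _ ≤ (1 + τ) ^ d * J := mul_le_mul_of_nonneg_right hB hJ0

end heat

/-! ### Gaussian averages of superharmonic functions -/

section supermean

variable {d : ℕ}

/-- The heat semigroup applied to `φ`. -/
def heat (φ : E d → ℝ) (t : ℝ) (x : E d) : ℝ :=
  ∫ ξ, φ (x + Real.sqrt t • ξ) ∂stdGaussian (E d)

lemma heat_le {φ : E d → ℝ} {K : ℝ} (hφ : Continuous φ) (hφ0 : ∀ ξ, 0 ≤ φ ξ)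
    (hφK : ∀ ξ, φ ξ ≤ K) (t : ℝ) (x : E d) : heat φ t x ≤ K := by
  have h : heat φ t x ≤ ∫ _, K ∂stdGaussian (E d) := by
    refine integral_mono ?_ (integrable_const K) fun ξ => hφK _
    refine Integrable.mono' (integrable_const K) (by fun_prop)
      (Filter.Eventually.of_forall fun ξ => ?_)
    rw [Real.norm_of_nonneg (hφ0 _)]
    exact hφK _
  simpa using h

lemma continuous_heat {φ : E d → ℝ} {K : ℝ} (hφ : Continuous φ) (hφ0 : ∀ ξ, 0 ≤ φ ξ)
    (hφK : ∀ ξ, φ ξ ≤ K) : Continuous (fun q : ℝ × E d => heat φ q.1 q.2) := by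
  unfold heat
  refine continuous_of_dominated (bound := fun _ => K) (fun q => by fun_prop)
    (fun q => Filter.Eventually.of_forall fun ξ => ?_) (integrable_const K)
    (Filter.Eventually.of_forall fun ξ => by fun_prop)
  rw [Real.norm_of_nonneg (hφ0 _)]
  exact hφK _

lemma heat_zero (φ : E d → ℝ) (x : E d) : heat φ 0 x = φ x := by
  simp [heat]

/-- A strict subsolution of the heat equation cannot touch a superharmonic function from below. -/
lemma Superharmonic.not_isMax {f : E d → ℝ≥0∞} (hf : Superharmonic f) {φ : E d → ℝ} {K : ℝ}
    (hφ : Continuous φ) (hφ0 : ∀ ξ, 0 ≤ φ ξ) (hφK : ∀ ξ, φ ξ ≤ K) {δ : ℝ} (hδ : 0 < δ)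
    {t : ℝ} (ht0 : 0 < t) (ht1 : t ≤ 1) {x₀ : E d} {v : ℝ} (hv : 0 ≤ v)
    (hx₀ : f x₀ = ENNReal.ofReal v)
    (hmax : ∀ s x, 0 ≤ s → s ≤ 1 →
      ((heat φ s x - δ * ‖x‖ ^ 2 - (d + 1) * δ * s -
        (heat φ t x₀ - δ * ‖x₀‖ ^ 2 - (d + 1) * δ * t - v) : ℝ) : EReal) ≤ f x) : False := by
  set r := Real.sqrt t with hr
  have hr0 : 0 < r := Real.sqrt_pos.2 ht0
  have hr2 : r ^ 2 = t := Real.sq_sqrt ht0.le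
  set Φ : E d → ℝ := fun ξ => φ (x₀ + r • ξ) with hΦdef
  have hΦ : Continuous Φ := by fun_prop
  have hΦ0 : ∀ ξ, 0 ≤ Φ ξ := fun ξ => hφ0 _
  have hΦK : ∀ ξ, Φ ξ ≤ K := fun ξ => hφK _
  set U := ∫ ξ, Φ ξ ∂stdGaussian (E d) with hU
  set Q := ∫ ξ, Φ ξ * ‖ξ‖ ^ 2 ∂stdGaussian (E d) with hQ
  have hUt : heat φ t x₀ = U := rfl
  -- the time derivative
  have htime : 2 * (d + 1) * δ * t ≤ Q - d * U := by
    obtain ⟨C, hC0, hC⟩ := exists_time_lower_bound hΦ hΦ0 hΦK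
    have hτ : ∀ τ : ℝ, 0 < τ → τ ≤ 1 →
        d * U - Q + 2 * (d + 1) * δ * t ≤ (C + 3 * (d + 1) * δ * t) * τ := by
      intro τ h0 h1
      -- Only times before `t` are tested, so the maximum may sit at the final time `t = 1`.
      have e : heat φ (t / (1 + τ) ^ 2) x₀ = ∫ ξ, Φ ((1 + τ)⁻¹ • ξ) ∂stdGaussian (E d) := by
        have : Real.sqrt (t / (1 + τ) ^ 2) = r * (1 + τ)⁻¹ := by
          rw [Real.sqrt_div ht0.le, Real.sqrt_sq (by linarith), div_eq_mul_inv]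
        simp only [heat, this, hΦdef, smul_smul]
      have hs1 : t / (1 + τ) ^ 2 ≤ 1 := by
        rw [div_le_one (by positivity)]
        nlinarith
      have h2 := hmax (t / (1 + τ) ^ 2) x₀ (by positivity) hs1
      rw [hx₀, EReal.coe_ennreal_ofReal, max_eq_left hv, EReal.coe_le_coe_iff, hUt, e] at h2
      have h3 := hC τ h0.le h1
      rw [← hU, ← hQ] at h3
      have h4 : t / (1 + τ) ^ 2 ≤ t * (1 - 2 * τ + 3 * τ ^ 2) := by
        rw [div_le_iff₀ (by positivity), mul_assoc]
        refine le_mul_of_one_le_right ht0.le ?_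
        nlinarith [pow_pos h0 3, pow_pos h0 4, pow_pos h0 2]
      have hD : (0 : ℝ) ≤ (d + 1) * δ := by positivity
      have h5 := mul_le_mul_of_nonneg_left h4 hD
      have h6 : τ * (d * U - Q + 2 * (d + 1) * δ * t) ≤
          τ * ((C + 3 * (d + 1) * δ * t) * τ) := by nlinarith
      exact le_of_mul_le_mul_left h6 h0
    -- Let `τ` tend to zero in `hτ`.
    have hlim : d * U - Q + 2 * (d + 1) * δ * t ≤ 0 := by
      by_contra! hpos
      set C' := C + 3 * (d + 1) * δ * t with hC'
      have hC'0 : 0 < C' + 1 := by positivity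
      set P := d * U - Q + 2 * (d + 1) * δ * t with hP
      have h1 := hτ (min 1 (P / (2 * (C' + 1)))) (lt_min one_pos (by positivity)) (min_le_left _ _)
      have h2 : min 1 (P / (2 * (C' + 1))) ≤ P / (2 * (C' + 1)) := min_le_right _ _
      rw [le_div_iff₀ (by positivity)] at h2
      have h3 : 0 < min 1 (P / (2 * (C' + 1))) := lt_min one_pos (by positivity)
      nlinarith
    linarith
  -- the space derivatives
  obtain ⟨m, C, hC0, hC⟩ := exists_space_lower_bound hΦ hΦ0 hΦK (R := r⁻¹) (by positivity)
  -- `B` is half the Hessian of the test function: Gaussian second moments give that of the heat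
  -- flow, and `-δ • 1` comes from `-δ‖x‖²`.
  have htr := hf.trace_nonpos (x₀ := x₀) (b := r⁻¹ • m - (2 * δ) • x₀)
    (B := (2 * t)⁻¹ • (secondMoment Φ - U • 1) - δ • 1) (C := C * (r⁻¹) ^ 3)
    (by simp [secondMoment_transpose]) hx₀ hv ?_
  · rw [Matrix.trace_sub, Matrix.trace_smul, Matrix.trace_sub, Matrix.trace_smul,
      Matrix.trace_smul, Matrix.trace_one, trace_secondMoment hΦ hΦ0 hΦK, ← hQ, Fintype.card_fin,
      smul_eq_mul, smul_eq_mul, smul_eq_mul] at htr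
    -- Half the Laplacian of the flow equals its time derivative. It would be at least `(d + 1) δ`
    -- by `htime` and at most `d δ` by `htr`.
    have h1 : (d + 1) * δ ≤ (2 * t)⁻¹ * (Q - U * d) := by
      rw [inv_mul_eq_div, le_div_iff₀ (by positivity)]
      linarith
    linarith
  · intro h hh
    have ha : ‖r⁻¹ • h‖ ≤ r⁻¹ := by
      rw [norm_smul, Real.norm_of_nonneg (by positivity)]
      exact mul_le_of_le_one_right (by positivity) hh
    have h1 := hC (r⁻¹ • h) ha
    have e : heat φ t (x₀ + h) = ∫ ξ, Φ (ξ + r⁻¹ • h) ∂stdGaussian (E d) := by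
      simp only [heat, hΦdef, smul_add, smul_smul, ← hr, mul_inv_cancel₀ hr0.ne', one_smul]
      refine integral_congr_ae (Filter.Eventually.of_forall fun ξ => ?_)
      simp only
      congr 1
      abel
    rw [← e, ← hU] at h1
    refine le_trans (EReal.coe_le_coe_iff.2 ?_) (hmax t (x₀ + h) ht0.le ht1)
    rw [hUt]
    have e1 : ‖r⁻¹ • h‖ = r⁻¹ * ‖h‖ := by
      rw [norm_smul, Real.norm_of_nonneg (by positivity)]
    have e2 : ⟪r⁻¹ • h, act (secondMoment Φ) (r⁻¹ • h)⟫ =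
        t⁻¹ * ⟪h, act (secondMoment Φ) h⟫ := by
      rw [act_smul, real_inner_smul_left, inner_smul_right, ← mul_assoc, ← hr2]
      congr 1
      field_simp
    have e3 : (r⁻¹ * ‖h‖) ^ 2 = t⁻¹ * ‖h‖ ^ 2 := by
      rw [mul_pow, inv_pow, hr2]
    rw [e1, e2, e3, inner_smul_right] at h1
    have e4 : ‖x₀ + h‖ ^ 2 = ‖x₀‖ ^ 2 + 2 * ⟪x₀, h⟫ + ‖h‖ ^ 2 := norm_add_sq_real x₀ h
    rw [e4]
    simp only [sub_act, smul_act, one_act, inner_sub_left, inner_sub_right, inner_smul_right,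
      real_inner_smul_left, real_inner_self_eq_norm_sq, mul_inv]
    have e5 : (r⁻¹ * ‖h‖) ^ 3 = r⁻¹ ^ 3 * ‖h‖ ^ 3 := by ring
    rw [e5] at h1
    linarith

/-- A parabolic maximum principle. If the flow exceeded `f` at time one, a slightly tilted
difference would have a positive maximum on a compact set, at a positive time, which `not_isMax`
excludes. -/
lemma Superharmonic.heat_one_le {f : E d → ℝ≥0∞} (hf : Superharmonic f) {φ : E d → ℝ} {K : ℝ}
    (hφ : Continuous φ) (hφ0 : ∀ ξ, 0 ≤ φ ξ) (hφK : ∀ ξ, φ ξ ≤ K)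
    (hφf : ∀ ξ, ENNReal.ofReal (φ ξ) ≤ f ξ) (x : E d) : ENNReal.ofReal (heat φ 1 x) ≤ f x := by
  have hK : 0 ≤ K := (hφ0 x).trans (hφK x)
  by_contra! hlt
  -- `f` may be infinite; cutting at `K` is harmless because the flow never exceeds `K`.
  set g : E d → ℝ := fun x => (min (f x) (ENNReal.ofReal K)).toReal with hg
  have hgK : ∀ x, g x ≤ K := fun x =>
    ENNReal.toReal_le_of_le_ofReal hK (min_le_right _ _)
  have hg0 : ∀ x, 0 ≤ g x := fun x => ENNReal.toReal_nonneg
  have hgf : ∀ x, ENNReal.ofReal (g x) ≤ f x := fun x => by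
    rw [hg, ENNReal.ofReal_toReal (ne_top_of_le_ne_top ENNReal.ofReal_ne_top (min_le_right _ _))]
    exact min_le_left _ _
  have hgeq : ∀ x, g x < K → f x = ENNReal.ofReal (g x) := fun x hx => by
    rw [hg, ENNReal.ofReal_toReal (ne_top_of_le_ne_top ENNReal.ofReal_ne_top (min_le_right _ _))]
    rw [eq_comm, min_eq_left_iff]
    by_contra! h
    simp only [hg, min_eq_right h.le, ENNReal.toReal_ofReal hK, lt_irrefl] at hx
  have hφg : ∀ x, φ x ≤ g x := fun x => by
    rw [← ENNReal.ofReal_le_iff_le_toReal (ne_top_of_le_ne_top ENNReal.ofReal_ne_top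
      (min_le_right _ _))]
    exact le_min (hφf x) (ENNReal.ofReal_le_ofReal (hφK x))
  have hglsc : LowerSemicontinuous g := by
    have hc : Continuous (fun a : ℝ≥0∞ => (min a (ENNReal.ofReal K)).toReal) :=
      ENNReal.continuousOn_toReal.comp_continuous (by fun_prop) fun a =>
        ne_top_of_le_ne_top ENNReal.ofReal_ne_top (min_le_right _ _)
    have hm : Monotone (fun a : ℝ≥0∞ => (min a (ENNReal.ofReal K)).toReal) := fun a b hab =>
      ENNReal.toReal_mono (ne_top_of_le_ne_top ENNReal.ofReal_ne_top (min_le_right _ _))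
        (min_le_min_right _ hab)
    exact hc.comp_lowerSemicontinuous hf.lowerSemicontinuous hm
  have hgx : g x < heat φ 1 x := by
    by_contra! h
    exact absurd (hlt.trans_le (ENNReal.ofReal_le_ofReal h)) (not_lt.2 (hgf x))
  set D := heat φ 1 x - g x with hD
  have hD0 : 0 < D := sub_pos.2 hgx
  -- The perturbation then costs exactly `D / 2` at `(1, x)`, so the maximum stays positive.
  set δ := D / (2 * (‖x‖ ^ 2 + (d + 1))) with hδ
  have hδ0 : 0 < δ := by positivity
  have hδD : δ * (‖x‖ ^ 2 + (d + 1)) = D / 2 := by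
    rw [hδ]; field_simp
  -- the comparison function
  set G : ℝ × E d → ℝ := fun q => heat φ q.1 q.2 - δ * ‖q.2‖ ^ 2 - (d + 1) * δ * q.1 - g q.2
    with hG
  have hGusc : UpperSemicontinuous G := by
    have h1 : Continuous (fun q : ℝ × E d =>
        heat φ q.1 q.2 - δ * ‖q.2‖ ^ 2 - (d + 1) * δ * q.1) := by
      have := continuous_heat hφ hφ0 hφK
      fun_prop
    have h2 : UpperSemicontinuous (fun q : ℝ × E d => -g q.2) := by
      have : LowerSemicontinuous (fun q : ℝ × E d => g q.2) :=
        fun q y hy => continuous_snd.continuousAt.eventually (hglsc q.2 y hy)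
      intro q y hy
      filter_upwards [this q (-y) (by linarith)] with q' hq'
      linarith
    have := h1.upperSemicontinuous.add h2
    exact this
  -- Outside this ball `δ‖y‖² ≥ K`, hence `G ≤ 0` there, and the maximum over the compact set is
  -- global.
  set ρ := max ‖x‖ (Real.sqrt (K / δ)) with hρ
  have hcompact : IsCompact (Set.Icc (0 : ℝ) 1 ×ˢ Metric.closedBall (0 : E d) ρ) :=
    isCompact_Icc.prod (isCompact_closedBall _ _)
  have hxmem : ((1 : ℝ), x) ∈ Set.Icc (0 : ℝ) 1 ×ˢ Metric.closedBall (0 : E d) ρ := by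
    refine ⟨by simp, ?_⟩
    rw [mem_closedBall_zero_iff]
    exact le_max_left _ _
  obtain ⟨⟨t, x₀⟩, hmem, hmax⟩ := (hGusc.upperSemicontinuousOn _).exists_isMaxOn ⟨_, hxmem⟩ hcompact
  have hG1 : 0 < G (1, x) := by
    simp only [hG]
    nlinarith
  have hGm : 0 < G (t, x₀) := hG1.trans_le (hmax hxmem)
  have hglob : ∀ s y, 0 ≤ s → s ≤ 1 → G (s, y) ≤ G (t, x₀) := by
    intro s y h0 h1
    by_cases hy : ‖y‖ ≤ ρ
    · exact hmax (show (s, y) ∈ _ from ⟨⟨h0, h1⟩, by rwa [mem_closedBall_zero_iff]⟩)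
    · push Not at hy
      refine le_trans ?_ hGm.le
      have h2 : K / δ ≤ ‖y‖ ^ 2 := by
        have : Real.sqrt (K / δ) ≤ ‖y‖ := (le_max_right _ _).trans hy.le
        calc K / δ = Real.sqrt (K / δ) ^ 2 := (Real.sq_sqrt (by positivity)).symm
          _ ≤ _ := pow_le_pow_left₀ (Real.sqrt_nonneg _) this 2
      rw [div_le_iff₀ hδ0] at h2
      have h3 := heat_le hφ hφ0 hφK s y
      have h4 := hg0 y
      have h5 : 0 ≤ (d + 1) * δ * s := by positivity
      simp only [hG]
      linarith
  -- At time zero `G ≤ φ - g ≤ 0`.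
  have ht0 : 0 < t := by
    rcases hmem.1.1.eq_or_lt with h | h
    · simp only at h
      subst h
      simp only [hG, heat_zero] at hGm
      have := hφg x₀
      have : 0 ≤ δ * ‖x₀‖ ^ 2 := by positivity
      linarith
    · exact h
  -- Positivity of `G` shows that the truncation is inactive at `x₀`, so `f x₀ = g x₀` is finite.
  have hgx₀ : g x₀ < K := by
    have h3 := heat_le hφ hφ0 hφK t x₀
    have : 0 ≤ δ * ‖x₀‖ ^ 2 := by positivity
    have h5 : 0 ≤ (d + 1) * δ * t := by positivity
    simp only [hG] at hGm
    linarith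
  refine hf.not_isMax hφ hφ0 hφK hδ0 ht0 hmem.1.2 (hg0 x₀) (hgeq x₀ hgx₀) fun s y h0 h1 => ?_
  have h2 := hglob s y h0 h1
  simp only [hG] at h2
  have h3 : (g y : EReal) ≤ f y := by
    have := EReal.coe_ennreal_le_coe_ennreal_iff.2 (hgf y)
    rwa [EReal.coe_ennreal_ofReal, max_eq_left (hg0 y)] at this
  refine le_trans (EReal.coe_le_coe_iff.2 ?_) h3
  linarith

/-- Lipschitz approximation of a lower semicontinuous function from below. -/
lemma exists_continuous_approx {f : E d → ℝ≥0∞} (hf : LowerSemicontinuous f) :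
    ∃ φ : ℕ → E d → ℝ, (∀ n, Continuous (φ n)) ∧ (∀ n x, 0 ≤ φ n x) ∧ (∀ n x, φ n x ≤ n) ∧
      (∀ n x, ENNReal.ofReal (φ n x) ≤ f x) ∧
      ∀ x, f x ≤ Filter.liminf (fun n => ENNReal.ofReal (φ n x)) Filter.atTop := by
  set g : ℕ → E d → ℝ := fun n x => (min (f x) n).toReal with hg
  have hnt : ∀ (n : ℕ) x, min (f x) n ≠ ∞ := fun n x =>
    ne_top_of_le_ne_top (ENNReal.natCast_ne_top n) (min_le_right _ _)
  have hgn : ∀ n x, g n x ≤ n := fun n x => by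
    have := ENNReal.toReal_mono (ENNReal.natCast_ne_top n) (min_le_right (f x) n)
    simpa using this
  have hg0 : ∀ n x, 0 ≤ g n x := fun n x => ENNReal.toReal_nonneg
  -- The infimal convolution of the truncation with a cone of slope `n` is `n`-Lipschitz.
  set φ : ℕ → E d → ℝ := fun n x => ⨅ y, (g n y + n * dist x y) with hφ
  have hbdd : ∀ n x, BddBelow (Set.range fun y => g n y + n * dist x y) := fun n x =>
    ⟨0, by rintro _ ⟨y, rfl⟩; have := hg0 n y; positivity⟩
  have hφg : ∀ n x, φ n x ≤ g n x := fun n x => by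
    have := ciInf_le (hbdd n x) x
    simpa using this
  refine ⟨φ, fun n => ?_, fun n x => ?_, fun n x => (hφg n x).trans (hgn n x), fun n x => ?_,
    fun x => ?_⟩
  · have : LipschitzWith n (φ n) := by
      refine LipschitzWith.of_le_add_mul _ fun x y => ?_
      rw [← sub_le_iff_le_add]
      refine le_ciInf fun z => ?_
      rw [sub_le_iff_le_add]
      refine (ciInf_le (hbdd n x) z).trans ?_
      have := dist_triangle x y z
      have hn : (0 : ℝ) ≤ n := Nat.cast_nonneg n
      have := mul_le_mul_of_nonneg_left this hn
      simp only [NNReal.coe_natCast]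
      linarith
    exact this.continuous
  · exact le_ciInf fun y => by have := hg0 n y; positivity
  · refine (ENNReal.ofReal_le_ofReal (hφg n x)).trans ?_
    rw [hg, ENNReal.ofReal_toReal (hnt n x)]
    exact min_le_left _ _
  · refine le_of_forall_lt fun a ha => ?_
    obtain ⟨b, hab, hb⟩ := exists_between ha
    refine hab.trans_le ?_
    have hbt : b ≠ ∞ := hb.ne_top
    refine Filter.le_liminf_of_le (by isBoundedDefault) ?_
    obtain ⟨r, hr0, hr⟩ := Metric.eventually_nhds_iff.1 (hf x b hb)
    -- Beyond `N` the truncation level is above `b`, and outside the `r`-ball the cone alone exceeds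
    -- `b`.
    obtain ⟨N, hN⟩ := exists_nat_ge (max b.toReal (b.toReal / r))
    filter_upwards [Filter.eventually_ge_atTop N] with n hn
    have hnN : (N : ℝ) ≤ n := by exact_mod_cast hn
    rw [ENNReal.le_ofReal_iff_toReal_le hbt (le_ciInf fun y => by have := hg0 n y; positivity)]
    refine le_ciInf fun y => ?_
    by_cases hy : dist y x < r
    · have h1 : b.toReal ≤ g n y := by
        refine ENNReal.toReal_mono (hnt n y) (le_min (hr hy).le ?_)
        rw [← ENNReal.ofReal_toReal hbt, ← ENNReal.ofReal_natCast]
        exact ENNReal.ofReal_le_ofReal ((le_max_left _ _).trans (hN.trans hnN))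
      have : 0 ≤ (n : ℝ) * dist x y := by positivity
      linarith
    · push Not at hy
      have h1 : b.toReal ≤ n * r := by
        have := (le_max_right b.toReal _).trans (hN.trans hnN)
        rwa [div_le_iff₀ hr0] at this
      rw [dist_comm] at hy
      have := mul_le_mul_of_nonneg_left hy (Nat.cast_nonneg (α := ℝ) n)
      have := hg0 n y
      linarith

/-- A superharmonic function is at least its Gaussian averages. -/
theorem Superharmonic.lintegral_le {f : E d → ℝ≥0∞} (hf : Superharmonic f) (x : E d) :
    ∫⁻ ξ, f (x + ξ) ∂stdGaussian (E d) ≤ f x := by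
  obtain ⟨φ, hc, h0, hK, hle, hlim⟩ := exists_continuous_approx hf.lowerSemicontinuous
  calc ∫⁻ ξ, f (x + ξ) ∂stdGaussian (E d)
      ≤ ∫⁻ ξ, Filter.liminf (fun n => ENNReal.ofReal (φ n (x + ξ))) Filter.atTop
        ∂stdGaussian (E d) := lintegral_mono fun ξ => hlim _
    _ ≤ Filter.liminf (fun n => ∫⁻ ξ, ENNReal.ofReal (φ n (x + ξ)) ∂stdGaussian (E d))
        Filter.atTop := lintegral_liminf_le fun n => by have := hc n; fun_prop
    _ ≤ f x := by
      refine Filter.liminf_le_of_le (by isBoundedDefault) fun b hb => ?_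
      obtain ⟨n, hn⟩ := hb.exists
      refine hn.trans ?_
      rw [← ofReal_integral_eq_lintegral_ofReal]
      · have := hf.heat_one_le (hc n) (h0 n) (hK n) (hle n) x
        simpa [heat] using this
      · refine Integrable.mono' (integrable_const (n : ℝ)) (by have := hc n; fun_prop)
          (Filter.Eventually.of_forall fun ξ => ?_)
        rw [Real.norm_of_nonneg (h0 n _)]
        exact hK n _
      · exact Filter.Eventually.of_forall fun ξ => h0 n _

end supermean

/-! ### The shrinkage matrix and a Liouville theorem -/

section shrinkage

variable {d p p' : ℕ} {X : Matrix (Fin d) (Fin p) ℝ} {X' : Matrix (Fin d) (Fin p') ℝ} {σ σ' : ℝ}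
  {U : Matrix (Fin d) (Fin d) ℝ} {lam : Fin d → ℝ}

lemma covMat_inv (hX : IsUnit (X * X.transpose).det) (hσ : 0 < σ) :
    (covMat X σ)⁻¹ = (σ ^ 2)⁻¹ • (X * X.transpose) :=
  Matrix.inv_eq_left_inv (covMat_inv_mul hX hσ)

namespace IsDiagonalization

lemma mul_transpose (h : IsDiagonalization X X' σ σ' U lam) : U * U.transpose = 1 := 
  (Matrix.mem_orthogonalGroup_iff _ _).1 h.1

lemma transpose_mul (h : IsDiagonalization X X' σ σ' U lam) : U.transpose * U = 1 :=
  mul_eq_one_comm.1 h.mul_transpose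

lemma diagonal_eq (h : IsDiagonalization X X' σ σ' U lam) :
    Matrix.diagonal lam = (sqrtMat (covMatW X X' σ σ') * U.transpose).conjTranspose *
      (covMat X σ)⁻¹ * (sqrtMat (covMatW X X' σ σ') * U.transpose) := by
  rw [Matrix.conjTranspose_mul, Matrix.conjTranspose_eq_transpose_of_trivial,
    Matrix.conjTranspose_eq_transpose_of_trivial, Matrix.transpose_transpose, sqrtMat_transpose]
  calc Matrix.diagonal lam = (U * U.transpose) * Matrix.diagonal lam * (U * U.transpose) := by
        rw [h.mul_transpose, one_mul, mul_one]
    _ = U * (U.transpose * Matrix.diagonal lam * U) * U.transpose := by simp only [mul_assoc]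
    _ = _ := by rw [← h.2]; simp only [mul_assoc]

/-- With `V = S Uᵀ`, congruence by `V` takes the total precision to the identity and that of the
first sample to `Λ`. The precision of the future sample therefore goes to `I - Λ`, which locates the
entries of `Λ` in `(0, 1]`. -/
lemma one_sub_diagonal_eq (h : IsDiagonalization X X' σ σ' U lam)
    (hX : IsUnit (X * X.transpose).det) (hσ : 0 < σ) :
    Matrix.diagonal (fun i => 1 - lam i) =
      (sqrtMat (covMatW X X' σ σ') * U.transpose).conjTranspose *
      ((σ' ^ 2)⁻¹ • (X' * X'.transpose)) * (sqrtMat (covMatW X X' σ σ') * U.transpose) := by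
  have h1 : (1 : Matrix (Fin d) (Fin d) ℝ) =
      (sqrtMat (covMatW X X' σ σ') * U.transpose).conjTranspose *
      prec X X' σ σ' * (sqrtMat (covMatW X X' σ σ') * U.transpose) := by
    rw [Matrix.conjTranspose_mul, Matrix.conjTranspose_eq_transpose_of_trivial,
      Matrix.conjTranspose_eq_transpose_of_trivial, Matrix.transpose_transpose, sqrtMat_transpose]
    calc (1 : Matrix (Fin d) (Fin d) ℝ) = U * 1 * U.transpose := by rw [mul_one, h.mul_transpose]
      _ = _ := by rw [← sqrt_mul_prec_mul_sqrt (X' := X') (σ' := σ') hX hσ]; simp only [mul_assoc]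
  rw [← Matrix.diagonal_sub, Matrix.diagonal_one, h.diagonal_eq]
  conv_lhs => rw [h1]
  rw [covMat_inv hX hσ, prec, Matrix.mul_add, Matrix.add_mul, add_sub_cancel_left]

lemma injective (h : IsDiagonalization X X' σ σ' U lam)
    (hX : IsUnit (X * X.transpose).det) (hσ : 0 < σ) :
    Function.Injective (sqrtMat (covMatW X X' σ σ') * U.transpose).mulVec := by
  rw [Matrix.mulVec_injective_iff_isUnit, Matrix.isUnit_iff_isUnit_det, Matrix.det_mul]
  refine (isUnit_det_sqrtMat (posDef_covMatW hX hσ)).mul ?_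
  exact (Matrix.isUnit_iff_isUnit_det _).1 (IsUnit.of_mul_eq_one _ h.transpose_mul)

lemma pos (h : IsDiagonalization X X' σ σ' U lam)
    (hX : IsUnit (X * X.transpose).det) (hσ : 0 < σ) (i : Fin d) : 0 < lam i := by
  have : (Matrix.diagonal lam).PosDef := by
    rw [h.diagonal_eq]
    exact (posDef_covMat hX hσ).inv.conjTranspose_mul_mul_same (h.injective hX hσ)
  exact Matrix.posDef_diagonal_iff.1 this i

lemma le_one (h : IsDiagonalization X X' σ σ' U lam)
    (hX : IsUnit (X * X.transpose).det) (hσ : 0 < σ) (i : Fin d) : lam i ≤ 1 := by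
  have : (Matrix.diagonal fun i => 1 - lam i).PosSemidef := by
    rw [h.one_sub_diagonal_eq hX hσ]
    exact ((posSemidef_mul_transpose X').smul (by positivity)).conjTranspose_mul_mul_same _
  simpa using Matrix.posSemidef_diagonal_iff.1 this i

lemma lt_one (h : IsDiagonalization X X' σ σ' U lam)
    (hX : IsUnit (X * X.transpose).det) (hσ : 0 < σ) (hσ' : 0 < σ')
    (hX' : IsUnit (X' * X'.transpose).det) (i : Fin d) : lam i < 1 := by
  have : (Matrix.diagonal fun i => 1 - lam i).PosDef := by
    rw [h.one_sub_diagonal_eq hX hσ]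
    exact ((posDef_mul_transpose hX').smul (by positivity)).conjTranspose_mul_mul_same
      (h.injective hX hσ)
  simpa using Matrix.posDef_diagonal_iff.1 this i

end IsDiagonalization

/-- Inverting the diagonalization gives `C = S Uᵀ Λ⁻¹ U S`, while `W = S Uᵀ U S`; the bound `Λ ≤ I`
makes the square root in `A*` genuine. The choice of `U` is then irrelevant to the risks. -/
lemma Astar_mul_transpose (h : IsDiagonalization X X' σ σ' U lam)
    (hX : IsUnit (X * X.transpose).det) (hσ : 0 < σ) :
    Astar X X' σ σ' U lam * (Astar X X' σ σ' U lam).transpose =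
      covMat X σ - covMatW X X' σ σ' := by
  set S := sqrtMat (covMatW X X' σ σ') with hS
  set N := U.transpose * Matrix.diagonal (fun i => (lam i)⁻¹) * U with hN
  have hD : Matrix.diagonal lam * Matrix.diagonal (fun i => (lam i)⁻¹) = 1 := by
    rw [Matrix.diagonal_mul_diagonal, ← Matrix.diagonal_one]
    congr 1; ext i; exact mul_inv_cancel₀ (h.pos hX hσ i).ne'
  have h1 : S * (covMat X σ)⁻¹ * S * N = 1 := by
    rw [h.2, hN]
    calc U.transpose * Matrix.diagonal lam * U *
          (U.transpose * Matrix.diagonal (fun i => (lam i)⁻¹) * U)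
        = U.transpose * (Matrix.diagonal lam * (U * U.transpose) *
          Matrix.diagonal (fun i => (lam i)⁻¹)) * U := by simp only [mul_assoc]
      _ = 1 := by rw [h.mul_transpose, mul_one, hD, mul_one, h.transpose_mul]
  have h2 : (covMat X σ)⁻¹ * (S * N * S) = 1 := by
    have : S * ((covMat X σ)⁻¹ * (S * N)) = 1 := by rw [← h1]; simp only [mul_assoc]
    rw [← mul_eq_one_comm.1 this]; simp only [mul_assoc]
  have h3 : S * N * S = covMat X σ := by
    have hu : IsUnit (covMat X σ).det :=
      (Matrix.isUnit_iff_isUnit_det _).1 (posDef_covMat hX hσ).isUnit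
    calc S * N * S = (covMat X σ * (covMat X σ)⁻¹) * (S * N * S) := by
          rw [Matrix.mul_nonsing_inv _ hu, one_mul]
      _ = _ := by rw [mul_assoc, h2, mul_one]
  have hsq : Matrix.diagonal (fun i => Real.sqrt ((lam i)⁻¹ - 1)) *
      Matrix.diagonal (fun i => Real.sqrt ((lam i)⁻¹ - 1)) =
      Matrix.diagonal (fun i => (lam i)⁻¹) - 1 := by
    rw [Matrix.diagonal_mul_diagonal, ← Matrix.diagonal_one, Matrix.diagonal_sub]
    congr 1; ext i
    refine Real.mul_self_sqrt ?_
    have := (one_le_inv₀ (h.pos hX hσ i)).2 (h.le_one hX hσ i)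
    linarith
  rw [Astar, Matrix.transpose_mul, Matrix.transpose_mul, Matrix.transpose_transpose,
    Matrix.diagonal_transpose, sqrtMat_transpose, ← hS]
  calc _ = S * (U.transpose * (Matrix.diagonal (fun i => Real.sqrt ((lam i)⁻¹ - 1)) *
        Matrix.diagonal (fun i => Real.sqrt ((lam i)⁻¹ - 1))) * U) * S := by simp only [mul_assoc]
    _ = S * N * S - S * (U.transpose * U) * S := by
      rw [hsq, hN]
      simp only [Matrix.mul_sub, Matrix.sub_mul, mul_one]
    _ = _ := by rw [h.transpose_mul, mul_one, h3, sqrtMat_mul_self (posDef_covMatW hX hσ)]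

lemma isUnit_det_Astar (h : IsDiagonalization X X' σ σ' U lam)
    (hX : IsUnit (X * X.transpose).det) (hσ : 0 < σ) (hσ' : 0 < σ')
    (hX' : IsUnit (X' * X'.transpose).det) : IsUnit (Astar X X' σ σ' U lam).det := by
  rw [Astar, Matrix.det_mul, Matrix.det_mul, Matrix.det_diagonal]
  refine ((isUnit_det_sqrtMat (posDef_covMatW hX hσ)).mul ?_).mul ?_
  · exact (Matrix.isUnit_iff_isUnit_det _).1 (IsUnit.of_mul_eq_one _ h.transpose_mul)
  · rw [isUnit_iff_ne_zero, Finset.prod_ne_zero_iff]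
    intro i _
    have := (one_lt_inv₀ (h.pos hX hσ i)).2 (h.lt_one hX hσ hσ' hX' i)
    exact (Real.sqrt_pos.2 (by linarith)).ne'

end shrinkage

/-! ### Supermean-valued functions and a Liouville theorem -/

section Liouville

variable {d : ℕ} {A : Matrix (Fin d) (Fin d) ℝ} {π : E d → ℝ≥0∞}

lemma volume_absolutelyContinuous_stdGaussian (d : ℕ) :
    (volume : Measure (E d)) ≪ stdGaussian (E d) := by
  rw [stdGaussian_eq_withDensity]
  exact withDensity_absolutelyContinuous' measurable_gaussDensity.aemeasurable
    (Filter.Eventually.of_forall fun x => (gaussDensity_pos x).ne')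

/-- For singular `A` the averages live on null sets, so the conclusion holds only for almost every
centre. Exchange the null sets by Fubini: for fixed `ξ` the shift preserves Lebesgue measure. -/
lemma gaussAvg_ae_congr {m n : ℕ} (A : Matrix (Fin m) (Fin n) ℝ) {f g : E m → ℝ≥0∞}
    (hf : Measurable f) (hg : Measurable g) (h : f =ᵐ[volume] g) :
    gaussAvg A f =ᵐ[volume] gaussAvg A g := by
  have hs : MeasurableSet {q : E m × E n | f (q.1 + act A q.2) = g (q.1 + act A q.2)} :=
    measurableSet_eq_fun (by fun_prop) (by fun_prop)
  have h1 : ∀ᵐ x : E m, ∀ᵐ ξ ∂stdGaussian (E n), f (x + act A ξ) = g (x + act A ξ) := by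
    rw [Measure.ae_ae_comm hs]
    refine Filter.Eventually.of_forall fun ξ => ?_
    exact (quasiMeasurePreserving_add_right volume (act A ξ)).ae h
  filter_upwards [h1] with x hx
  exact lintegral_congr_ae hx

lemma smul_mul_transpose (s : ℝ) (A : Matrix (Fin d) (Fin d) ℝ) :
    (s • A) * (s • A).transpose = (s ^ 2) • (A * A.transpose) := by
  rw [Matrix.transpose_smul, Matrix.smul_mul, Matrix.mul_smul, smul_smul, pow_two]

lemma gaussAvg_sqrt_succ (hπ : Measurable π) (k : ℕ) (b : E d) :
    gaussAvg (Real.sqrt (k + 1 : ℕ) • A) π b = gaussAvg A (gaussAvg (Real.sqrt k • A) π) b := by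
  refine (gaussAvg_gaussAvg ?_ hπ b).symm
  rw [smul_mul_transpose, smul_mul_transpose, Real.sq_sqrt (by positivity),
    Real.sq_sqrt (by positivity)]
  push_cast
  rw [add_smul, one_smul, add_comm]

lemma gaussAvg_sqrt_smul_le (hπ : Measurable π) (hle : ∀ b, gaussAvg A π b ≤ π b) (k : ℕ)
    (b : E d) : gaussAvg (Real.sqrt k • A) π b ≤ π b := by
  induction k generalizing b with
  | zero => simp [gaussAvg]
  | succ k ih =>
    rw [gaussAvg_sqrt_succ hπ]
    exact (gaussAvg_mono A ih b).trans (hle b)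

lemma gaussAvg_sqrt_smul_ae_eq (hπ : Measurable π) (h : gaussAvg A π =ᵐ[volume] π) (k : ℕ) :
    gaussAvg (Real.sqrt k • A) π =ᵐ[volume] π := by
  induction k with
  | zero => exact Filter.Eventually.of_forall fun b => by simp [gaussAvg]
  | succ k ih =>
    have := gaussAvg_ae_congr A (measurable_gaussAvg (Real.sqrt k • A) hπ) hπ ih
    filter_upwards [this, h] with b hb hb'
    rw [gaussAvg_sqrt_succ hπ, hb, hb']

/-- The `k`-fold iterate of `P_A` has covariance `k A Aᵀ`; take `k = n²`. -/
lemma gaussAvg_nat_smul_le (hπ : Measurable π) (hle : ∀ b, gaussAvg A π b ≤ π b) (n : ℕ)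
    (b : E d) : gaussAvg ((n : ℝ) • A) π b ≤ π b := by
  have := gaussAvg_sqrt_smul_le hπ hle (n ^ 2) b
  rwa [Nat.cast_pow, Real.sqrt_sq (by positivity)] at this

lemma gaussAvg_nat_smul_ae_eq (hπ : Measurable π) (h : gaussAvg A π =ᵐ[volume] π) (n : ℕ) :
    gaussAvg ((n : ℝ) • A) π =ᵐ[volume] π := by
  have := gaussAvg_sqrt_smul_ae_eq hπ h (n ^ 2)
  rwa [Nat.cast_pow, Real.sqrt_sq (by positivity)] at this

/-- Times `(n + 1)² (2n + 3)`, the right side minus the left is the square `‖(2n + 3) ω + (n + 2)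
β‖²`. -/
lemma norm_sq_le_harnack (n : ℕ) (β ω : E d) :
    ‖ω‖ ^ 2 ≤ ‖((n + 1 : ℕ) : ℝ)⁻¹ • (β + ((n + 2 : ℕ) : ℝ) • ω)‖ ^ 2 + ‖β‖ ^ 2 / (2 * n + 3) := by
  have h : 0 ≤ ‖((2 : ℝ) * n + 3) • ω + ((n : ℝ) + 2) • β‖ ^ 2 := by positivity
  rw [norm_smul, mul_pow, norm_add_sq_real, norm_smul, inner_smul_right]
  rw [norm_add_sq_real, norm_smul, norm_smul, inner_smul_left, inner_smul_right,
    real_inner_comm] at h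
  simp only [Real.norm_eq_abs, mul_pow, sq_abs, conj_trivial] at h ⊢
  push_cast
  have hn : (0 : ℝ) ≤ n := n.cast_nonneg
  rw [← sub_nonneg]
  have e : ((n : ℝ) + 1)⁻¹ ^ 2 *
      (‖β‖ ^ 2 + 2 * (((n : ℝ) + 2) * ⟪β, ω⟫) + ((n : ℝ) + 2) ^ 2 * ‖ω‖ ^ 2)
      + ‖β‖ ^ 2 / (2 * n + 3) - ‖ω‖ ^ 2 =
      ((2 * n + 3) ^ 2 * ‖ω‖ ^ 2 + 2 * ((2 * n + 3) * ((n + 2) * ⟪β, ω⟫)) + (n + 2) ^ 2 * ‖β‖ ^ 2) /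
        ((n + 1) ^ 2 * (2 * n + 3)) := by
    field_simp
    ring
  rw [e]
  exact div_nonneg h (by positivity)

/-- A Harnack inequality for Gaussian averages. -/
lemma gaussAvg_nat_smul_le_harnack (hπ : Measurable π) (n : ℕ) (b β : E d) :
    gaussAvg (((n + 1 : ℕ) : ℝ) • A) π b ≤
      ENNReal.ofReal ((((n + 2 : ℕ) : ℝ) / ((n + 1 : ℕ) : ℝ)) ^ d *
        Real.exp (‖β‖ ^ 2 / (2 * n + 3) / 2)) *
      gaussAvg (((n + 2 : ℕ) : ℝ) • A) π (b + act A β) := by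
  set t : ℝ := ((n + 1 : ℕ) : ℝ) with ht
  set s : ℝ := ((n + 2 : ℕ) : ℝ) with hs
  have ht0 : 0 < t := by positivity
  have hs0 : 0 < s := by positivity
  have hdet : ((s / t) • (1 : Matrix (Fin d) (Fin d) ℝ)).det = (s / t) ^ d := by simp
  have hu : IsUnit ((s / t) • (1 : Matrix (Fin d) (Fin d) ℝ)).det := by
    rw [hdet]; exact isUnit_iff_ne_zero.2 (by positivity)
  unfold gaussAvg
  rw [lintegral_stdGaussian (by fun_prop), lintegral_stdGaussian (by fun_prop)]
  have mf : Measurable (fun x : E d => gaussDensity x * π (b + act (t • A) x)) :=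
    measurable_gaussDensity.mul (by fun_prop)
  -- The substitution `ξ = t⁻¹ (β + s ω)` sends `b + t A ξ` to `b + A β + s A ω`. As `s > t`, the
  -- ratio of the Gaussian weights is bounded uniformly in `ω`.
  rw [lintegral_comp_affine hu (t⁻¹ • β) mf, hdet, abs_of_nonneg (by positivity),
    ENNReal.ofReal_mul (by positivity), mul_assoc]
  refine mul_le_mul_right ?_ _
  have mf' : Measurable (fun x : E d => gaussDensity x * π (b + act A β + act (s • A) x)) :=
    measurable_gaussDensity.mul (by fun_prop)
  rw [← lintegral_const_mul _ mf']
  refine lintegral_mono fun ω => ?_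
  have e : t⁻¹ • β + act ((s / t) • (1 : Matrix (Fin d) (Fin d) ℝ)) ω = t⁻¹ • (β + s • ω) := by
    rw [smul_act, one_act, smul_add, smul_smul, div_eq_inv_mul]
  have e2 : b + act (t • A) (t⁻¹ • (β + s • ω)) = b + act A β + act (s • A) ω := by
    rw [smul_act, act_smul, smul_smul, mul_inv_cancel₀ ht0.ne', one_smul, act_add, act_smul,
      smul_act, add_assoc]
  rw [e, e2, ← mul_assoc]
  refine mul_le_mul_left ?_ _
  rw [gaussDensity, gaussDensity, ← ENNReal.ofReal_mul (by positivity)]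
  refine ENNReal.ofReal_le_ofReal ?_
  rw [mul_left_comm, ← Real.exp_add]
  refine mul_le_mul_of_nonneg_left (Real.exp_le_exp.2 ?_) (by positivity)
  have := norm_sq_le_harnack n β ω
  rw [← ht, ← hs] at this
  linarith

lemma tendsto_harnack_const (d : ℕ) (r : ℝ) :
    Filter.Tendsto (fun n : ℕ => ENNReal.ofReal ((((n + 2 : ℕ) : ℝ) / ((n + 1 : ℕ) : ℝ)) ^ d *
        Real.exp (r / (2 * n + 3) / 2))) Filter.atTop (nhds 1) := by
  have h1 : Filter.Tendsto (fun n : ℕ => (1 : ℝ) / ((n : ℝ) + 1)) Filter.atTop (nhds 0) :=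
    tendsto_one_div_add_atTop_nhds_zero_nat
  have h2 : Filter.Tendsto (fun n : ℕ => ((n + 2 : ℕ) : ℝ) / ((n + 1 : ℕ) : ℝ)) Filter.atTop
      (nhds 1) := by
    have := h1.const_add 1
    rw [add_zero] at this
    refine this.congr fun n => ?_
    push_cast
    field_simp
    ring
  have h3 : Filter.Tendsto (fun n : ℕ => r / (2 * n + 3) / 2) Filter.atTop (nhds 0) := by
    have : Filter.Tendsto (fun n : ℕ => (2 * (n : ℝ) + 3)) Filter.atTop Filter.atTop :=
      Filter.tendsto_atTop_add_const_right _ _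
        (tendsto_natCast_atTop_atTop.const_mul_atTop (by norm_num))
    simpa using (this.const_div_atTop r).div_const 2
  have := ENNReal.tendsto_ofReal ((h2.pow d).mul (Real.continuous_exp.tendsto _ |>.comp h3))
  simpa using this

/-- A Liouville theorem: a supermean-valued function that is almost everywhere mean-valued is
constant on almost every translate of the range of `A`. -/
theorem ae_forall_eq_of_gaussAvg_ae_eq (hπ : Measurable π) (hle : ∀ b, gaussAvg A π b ≤ π b)
    (hlsc : ∀ b, LowerSemicontinuous fun β => π (b + act A β))
    (h : gaussAvg A π =ᵐ[volume] π) : ∀ᵐ b, ∀ β, π (b + act A β) = π b := by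
  have hall : ∀ᵐ b, ∀ n : ℕ, gaussAvg ((n : ℝ) • A) π b = π b :=
    ae_all_iff.2 fun n => gaussAvg_nat_smul_ae_eq hπ h n
  filter_upwards [hall, h] with b hb hb1
  -- `π b` equals its averages, Harnack compares them with averages around `b + A β`, and these are
  -- at most `π (b + A β)`; the constants tend to one.
  have hmin : ∀ β, π b ≤ π (b + act A β) := by
    intro β
    have hn : ∀ n : ℕ, π b ≤ ENNReal.ofReal ((((n + 2 : ℕ) : ℝ) / ((n + 1 : ℕ) : ℝ)) ^ d *
        Real.exp (‖β‖ ^ 2 / (2 * n + 3) / 2)) * π (b + act A β) := fun n => by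
      rw [← hb (n + 1)]
      exact (gaussAvg_nat_smul_le_harnack hπ n b β).trans
        (mul_le_mul_right (gaussAvg_nat_smul_le hπ hle (n + 2) _) _)
    have := ENNReal.Tendsto.mul_const (b := π (b + act A β))
      (tendsto_harnack_const d (‖β‖ ^ 2)) (Or.inl one_ne_zero)
    rw [one_mul] at this
    exact ge_of_tendsto' this hn
  intro β
  refine le_antisymm ?_ (hmin β)
  by_cases ht : π b = ∞
  · rw [ht]; exact le_top
  -- A finite minimum that equals its own Gaussian average is attained almost everywhere; lower
  -- semicontinuity then removes the exceptional set.
  have hae : ∀ᵐ η : E d, π (b + act A η) = π b := by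
    have mη : Measurable (fun η => π (b + act A η)) := by fun_prop
    refine (volume_absolutelyContinuous_stdGaussian d).ae_le ?_
    have := ae_eq_of_ae_le_of_lintegral_le (μ := stdGaussian (E d)) (f := fun _ => π b)
      (g := fun η => π (b + act A η)) (Filter.Eventually.of_forall hmin) (by simp [ht])
      mη.aemeasurable (by simpa [gaussAvg] using hb1.le)
    exact this.mono fun η hη => hη.symm
  by_contra hlt
  push Not at hlt
  have hopen : IsOpen {η : E d | π b < π (b + act A η)} := (hlsc b).isOpen_preimage _
  have hpos := hopen.measure_pos volume ⟨β, hlt⟩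
  refine hpos.ne' (measure_mono_null (fun η hη => ?_) (ae_iff.1 hae))
  exact (ne_of_gt hη)

end Liouville

/-! ### Comparison of the risks -/

section comparison

variable {d p p' : ℕ} {X : Matrix (Fin d) (Fin p) ℝ} {X' : Matrix (Fin d) (Fin p') ℝ} {σ σ' : ℝ}
  {A : Matrix (Fin d) (Fin d) ℝ} {π : E d → ℝ≥0∞}

section domination

/-- The mean likelihood ratio between the uniform-prior and the `π`-prior predictions. -/
lemma lintegral_bayes_one_div_bayes (hX : IsUnit (X * X.transpose).det) (hσ : 0 < σ)
    (hσ' : 0 < σ') (hA : A * A.transpose = covMat X σ - covMatW X X' σ σ') (hπ : Measurable π)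
    (hm : ∀ y, marginal X σ π y ≠ 0 ∧ marginal X σ π y ≠ ⊤) (β : E d) :
    ∫⁻ y, density X σ β y * ∫⁻ z, density X' σ' β z *
      (bayesPredictive X X' σ σ' (fun _ => 1) y z / bayesPredictive X X' σ σ' π y z) =
    gaussAvg (sqrtMat (covMatW X X' σ σ')) (fun x =>
      gaussAvg A (gaussAvg A (gaussAvg (sqrtMat (covMatW X X' σ σ')) π)) x /
        gaussAvg (sqrtMat (covMatW X X' σ σ')) π x) β := by
  rw [lintegral_bayes_div_bayes hX hσ hσ' hA hπ measurable_const β]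
  congr 1
  ext x
  have hu := gaussAvg_sqrt_ne (X' := X') hX hσ hσ' hπ hm x
  set u := gaussAvg (sqrtMat (covMatW X X' σ σ')) π
  have e : ∀ x, gaussAvg A (gaussAvg (sqrtMat (covMatW X X' σ σ')) fun _ => 1) x = 1 := by
    intro x
    have : gaussAvg (sqrtMat (covMatW X X' σ σ')) (fun _ => 1) = fun _ => 1 :=
      funext fun x => gaussAvg_const _ _ x
    rw [this, gaussAvg_const]
  simp only [e, gaussAvg_const, one_div, inv_one]
  have e2 : ∀ ξ : E d, (u x / gaussAvg A u (x + act A ξ))⁻¹ =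
      gaussAvg A u (x + act A ξ) * (u x)⁻¹ := by
    intro ξ
    rw [ENNReal.inv_div (Or.inr hu.2) (Or.inr hu.1), div_eq_mul_inv]
  simp only [e2]
  rw [lintegral_mul_const' _ _ (ENNReal.inv_ne_top.2 hu.1)]
  rfl

lemma gaussAvg_gaussAvg_le (hπ : Measurable π) (hle : ∀ b, gaussAvg A π b ≤ π b)
    (S : Matrix (Fin d) (Fin d) ℝ) (x : E d) :
    gaussAvg A (gaussAvg S π) x ≤ gaussAvg S π x := by
  rw [gaussAvg_comm A S hπ]
  exact gaussAvg_mono S hle x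

/-- Under a supermean-valued prior the risk is at most that under the uniform prior. -/
theorem risk_bayes_le (hX : IsUnit (X * X.transpose).det) (hσ : 0 < σ) (hσ' : 0 < σ')
    (hA : A * A.transpose = covMat X σ - covMatW X X' σ σ') (hπ : Measurable π)
    (hm : ∀ y, marginal X σ π y ≠ 0 ∧ marginal X σ π y ≠ ⊤)
    (hle : ∀ b, gaussAvg A π b ≤ π b) (β : E d) :
    risk X X' σ σ' (bayesPredictive X X' σ σ' π) β ≤
      risk X X' σ σ' (bayesPredictive X X' σ σ' fun _ => 1) β := by
  have h := risk_add_one_le (X := X) (X' := X') hσ hσ'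
    (isPredictiveDensity_bayes (X' := X') hσ' hπ hm)
    (isPredictiveDensity_bayes (X' := X') hσ' measurable_const (marginal_one_ne hX hσ))
    (fun y z => (bayesPredictive_ne hX hσ hσ' hA hπ hm y z).1)
    (fun y z => (bayesPredictive_ne hX hσ hσ' hA hπ hm y z).2) β
  rw [lintegral_bayes_one_div_bayes hX hσ hσ' hA hπ hm β] at h
  refine ENNReal.le_of_add_le_add_right ENNReal.one_ne_top (h.trans ?_)
  gcongr
  rw [← gaussAvg_const (sqrtMat (covMatW X X' σ σ')) 1 β]
  refine gaussAvg_mono _ (fun x => ENNReal.div_le_of_le_mul ?_) β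
  rw [one_mul]
  exact (gaussAvg_mono A (gaussAvg_gaussAvg_le hπ hle _) x).trans (gaussAvg_gaussAvg_le hπ hle _ x)

/-- Equality of the Gaussian averages of two ordered functions at one point. -/
lemma ae_eq_of_gaussAvg_eq {S : Matrix (Fin d) (Fin d) ℝ} (hS : IsUnit S.det)
    {f g : E d → ℝ≥0∞} (hg : Measurable g) (hfg : ∀ x, f x ≤ g x) {x : E d}
    (h : gaussAvg S f x = gaussAvg S g x) (hfin : gaussAvg S g x ≠ ∞) : f =ᵐ[volume] g := by
  have hae : (fun ξ => f (x + act S ξ)) =ᵐ[stdGaussian (E d)] fun ξ => g (x + act S ξ) :=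
    ae_eq_of_ae_le_of_lintegral_le (Filter.Eventually.of_forall fun ξ => hfg _)
      ((gaussAvg_mono S hfg x).trans_lt hfin.lt_top).ne (by fun_prop) h.ge
  have hae' := (volume_absolutelyContinuous_stdGaussian d).ae_le hae
  -- Invertibility of `S` carries the almost-everywhere statement from the noise variable back to
  -- the argument of `f` and `g`.
  have hq : Measure.QuasiMeasurePreserving (fun y : E d => act S⁻¹ (y - x)) := by
    have m : Measurable (fun y : E d => act S⁻¹ (y - x)) := by fun_prop
    refine ⟨m, Measure.AbsolutelyContinuous.mk fun s hs h0 => ?_⟩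
    rw [Measure.map_apply m hs, ← lintegral_indicator_one (m hs),
      lintegral_comp_affine hS x (measurable_one.indicator (m hs))]
    have : ∀ y : E d, ((fun y : E d => act S⁻¹ (y - x)) ⁻¹' s).indicator
        (1 : E d → ℝ≥0∞) (x + act S y) = s.indicator 1 y := by
      intro y
      have hmem : x + act S y ∈ (fun y : E d => act S⁻¹ (y - x)) ⁻¹' s ↔ y ∈ s := by
        rw [Set.mem_preimage, add_sub_cancel_left, act_inv_act hS]
      by_cases hy : y ∈ s
      · rw [Set.indicator_of_mem hy, Set.indicator_of_mem (hmem.2 hy)]; rfl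
      · rw [Set.indicator_of_notMem hy, Set.indicator_of_notMem fun h => hy (hmem.1 h)]
    simp only [this]
    rw [lintegral_indicator_one hs, h0, mul_zero]
  filter_upwards [hq.ae hae'] with y hy
  simpa [act_act_inv hS] using hy

/-- The inequality is strict unless the prior is almost everywhere mean-valued. -/
theorem risk_bayes_lt (hX : IsUnit (X * X.transpose).det) (hσ : 0 < σ) (hσ' : 0 < σ')
    (hA : A * A.transpose = covMat X σ - covMatW X X' σ σ') (hπ : Measurable π)
    (hm : ∀ y, marginal X σ π y ≠ 0 ∧ marginal X σ π y ≠ ⊤)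
    (hle : ∀ b, gaussAvg A π b ≤ π b) (hne : ¬ gaussAvg A π =ᵐ[volume] π) (β : E d)
    (hfin : risk X X' σ σ' (bayesPredictive X X' σ σ' fun _ => 1) β ≠ ⊤) :
    risk X X' σ σ' (bayesPredictive X X' σ σ' π) β <
      risk X X' σ σ' (bayesPredictive X X' σ σ' fun _ => 1) β := by
  have h := risk_add_one_le (X := X) (X' := X') hσ hσ'
    (isPredictiveDensity_bayes (X' := X') hσ' hπ hm)
    (isPredictiveDensity_bayes (X' := X') hσ' measurable_const (marginal_one_ne hX hσ))
    (fun y z => (bayesPredictive_ne hX hσ hσ' hA hπ hm y z).1)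
    (fun y z => (bayesPredictive_ne hX hσ hσ' hA hπ hm y z).2) β
  rw [lintegral_bayes_one_div_bayes hX hσ hσ' hA hπ hm β] at h
  have hu := fun x => gaussAvg_sqrt_ne (X' := X') hX hσ hσ' hπ hm x
  have hS : IsUnit (sqrtMat (covMatW X X' σ σ')).det :=
    isUnit_det_sqrtMat (posDef_covMatW (X' := X') (σ' := σ') hX hσ)
  set S := sqrtMat (covMatW X X' σ σ')
  -- Equality at one point would force `P_A π = π` almost everywhere, because `P_S` averages with a
  -- positive density.
  have hlt : ∀ x, gaussAvg A (gaussAvg A (gaussAvg S π)) x < gaussAvg S π x := by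
    intro x
    have h1 := gaussAvg_mono A (gaussAvg_gaussAvg_le hπ hle S) x
    have h2 : gaussAvg A (gaussAvg S π) x < gaussAvg S π x := by
      rw [gaussAvg_comm A S hπ]
      exact lt_of_le_of_ne (gaussAvg_mono S hle x) fun heq =>
        hne (ae_eq_of_gaussAvg_eq hS hπ hle heq (hu x).2)
    exact h1.trans_lt h2
  have hE : gaussAvg S (fun x => gaussAvg A (gaussAvg A (gaussAvg S π)) x / gaussAvg S π x) β <
      1 := by
    have hlt1 : ∀ x, gaussAvg A (gaussAvg A (gaussAvg S π)) x / gaussAvg S π x < 1 := fun x => by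
      rw [ENNReal.div_lt_iff (Or.inl (hu x).1) (Or.inl (hu x).2), one_mul]
      exact hlt x
    have e1 : ∫⁻ _ : E d, (1 : ℝ≥0∞) ∂stdGaussian (E d) = 1 := by simp
    refine lt_of_lt_of_eq (lintegral_strict_mono (NeZero.ne _) aemeasurable_const ?_
      (Filter.Eventually.of_forall fun ξ => hlt1 _)) e1
    refine ((lintegral_mono fun ξ => (hlt1 _).le).trans_lt ?_).ne
    rw [e1]; exact ENNReal.one_lt_top
  have h3 := h.trans_lt (ENNReal.add_lt_add_left hfin hE)
  exact lt_of_add_lt_add_right h3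

end domination

/-! ### Constant risk by translation invariance -/

section invariance

lemma density_add (X : Matrix (Fin d) (Fin p) ℝ) (σ : ℝ) (β β₀ : E d) (y : E p) :
    density X σ (β + β₀) (y + act X.transpose β₀) = density X σ β y := by
  simp only [density, act_add, add_sub_add_right_eq_sub]

lemma marginal_one_add (X : Matrix (Fin d) (Fin p) ℝ) (σ : ℝ) (β₀ : E d) (y : E p) :
    marginal X σ (fun _ => 1) (y + act X.transpose β₀) = marginal X σ (fun _ => 1) y := by
  unfold marginal
  rw [← lintegral_add_right_eq_self _ β₀]
  simp only [density_add]

lemma bayesPredictive_one_add (X : Matrix (Fin d) (Fin p) ℝ) (X' : Matrix (Fin d) (Fin p') ℝ)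
    (σ σ' : ℝ) (β₀ : E d) (y : E p) (z : E p') :
    bayesPredictive X X' σ σ' (fun _ => 1) (y + act X.transpose β₀) (z + act X'.transpose β₀) =
      bayesPredictive X X' σ σ' (fun _ => 1) y z := by
  unfold bayesPredictive
  rw [marginal_one_add, ← lintegral_add_right_eq_self _ β₀]
  simp only [density_add]

/-- A predictive density that is invariant under translations has constant risk. -/
theorem risk_eq_of_invariant (hσ' : 0 < σ') {q : E p → E p' → ℝ≥0∞}
    (hq : IsPredictiveDensity q) (hq0 : ∀ y z, q y z ≠ 0)
    (hinv : ∀ (β : E d) y z, q (y + act X.transpose β) (z + act X'.transpose β) = q y z)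
    (β : E d) : risk X X' σ σ' q β = risk X X' σ σ' q 0 := by
  have hk : ∀ (β : E d) y, InformationTheory.klDiv (volume.withDensity (density X' σ' β))
      (volume.withDensity (q y)) =
      ∫⁻ z, ENNReal.ofReal (InformationTheory.klFun (density X' σ' β z / q y z).toReal) *
        q y z := fun β y =>
    klDiv_withDensity (measurable_density_right X' σ' β) (hq.1.comp measurable_prodMk_left)
      (lintegral_density_eq_one hσ' β) (hq.2 y) (Filter.Eventually.of_forall (hq0 y))
  have hd : ∀ y, density X σ β (y + act X.transpose β) = density X σ 0 y := fun y => by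
    simpa using density_add X σ 0 β y
  have hd' : ∀ z, density X' σ' β (z + act X'.transpose β) = density X' σ' 0 z := fun z => by
    simpa using density_add X' σ' 0 β z
  unfold risk
  simp only [hk]
  refine (lintegral_add_right_eq_self _ (act X.transpose β)).symm.trans ?_
  refine lintegral_congr fun y => ?_
  rw [hd]
  congr 1
  refine (lintegral_add_right_eq_self _ (act X'.transpose β)).symm.trans ?_
  refine lintegral_congr fun z => ?_
  rw [hd', hinv]

/-- The prediction based on the uniform prior has constant risk. -/
theorem risk_bayes_one_eq (hX : IsUnit (X * X.transpose).det) (hσ : 0 < σ) (hσ' : 0 < σ')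
    (hA : A * A.transpose = covMat X σ - covMatW X X' σ σ') (β : E d) :
    risk X X' σ σ' (bayesPredictive X X' σ σ' fun _ => 1) β =
      risk X X' σ σ' (bayesPredictive X X' σ σ' fun _ => 1) 0 :=
  risk_eq_of_invariant hσ'
    (isPredictiveDensity_bayes hσ' measurable_const (marginal_one_ne hX hσ))
    (fun y z => (bayesPredictive_ne hX hσ hσ' hA measurable_const (marginal_one_ne hX hσ) y z).1)
    (bayesPredictive_one_add X X' σ σ') β

end invariance

end comparison

/-! ### Proper priors -/

section properPriors

variable {d p p' : ℕ} {X : Matrix (Fin d) (Fin p) ℝ} {X' : Matrix (Fin d) (Fin p') ℝ} {σ σ' : ℝ}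
  {A : Matrix (Fin d) (Fin d) ℝ} {ρ : E d → ℝ≥0∞}

section proper

/-- Exchange of the integrals over the parameter and over the future sample. -/
lemma lintegral_mul_density_mul_lintegral_le (hρ : Measurable ρ) {q b : E p' → ℝ≥0∞} {m : ℝ≥0∞}
    (mq : Measurable q) (mb : Measurable b) (hq : ∫⁻ z, q z = 1) (y : E p)
    (hb : ∀ z, ∫⁻ β, density X' σ' β z * density X σ β y * ρ β = m * b z) :
    ∫⁻ β, ρ β * (density X σ β y * ∫⁻ z, density X' σ' β z * (q z / b z)) ≤ m := by
  have mr : Measurable (fun z => q z / b z) := mq.div mb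
  have mG : Measurable (fun w : E d × E p' =>
      density X' σ' w.1 w.2 * density X σ w.1 y * ρ w.1 * (q w.2 / b w.2)) :=
    (((measurable_density X' σ').mul ((measurable_density_left X σ y).comp measurable_fst)).mul
      (hρ.comp measurable_fst)).mul (mr.comp measurable_snd)
  have e1 : ∀ β, ρ β * (density X σ β y * ∫⁻ z, density X' σ' β z * (q z / b z)) =
      ∫⁻ z, density X' σ' β z * density X σ β y * ρ β * (q z / b z) := by
    intro β
    have mβ : Measurable (fun z => density X' σ' β z * (q z / b z)) :=
      (measurable_density_right X' σ' β).mul mr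
    rw [← mul_assoc, ← lintegral_const_mul _ mβ]
    refine lintegral_congr fun z => ?_
    ring
  have e2 : ∀ z, ∫⁻ β, density X' σ' β z * density X σ β y * ρ β * (q z / b z) ≤ m * q z := by
    intro z
    have mz : Measurable (fun β => density X' σ' β z * density X σ β y * ρ β) :=
      ((measurable_density_left X' σ' z).mul (measurable_density_left X σ y)).mul hρ
    rw [lintegral_mul_const _ mz, hb, mul_assoc]
    -- `b * (q / b) ≤ q` also where `b` is zero or infinite.
    exact mul_le_mul_right ENNReal.mul_div_le _
  calc _ = ∫⁻ β, ∫⁻ z, density X' σ' β z * density X σ β y * ρ β * (q z / b z) :=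
        lintegral_congr e1
    _ = ∫⁻ z, ∫⁻ β, density X' σ' β z * density X σ β y * ρ β * (q z / b z) :=
        lintegral_lintegral_swap mG.aemeasurable
    _ ≤ ∫⁻ z, m * q z := lintegral_mono e2
    _ = m := by rw [lintegral_const_mul _ mq, hq, mul_one]

lemma lintegral_mul_lintegral_density_le (hσ : 0 < σ) (hρ : Measurable ρ)
    {K : E d → E p → ℝ≥0∞} (mK : Measurable (Function.uncurry K))
    (hK : ∀ y, ∫⁻ β, ρ β * (density X σ β y * K β y) ≤ marginal X σ ρ y) :
    ∫⁻ β, ρ β * ∫⁻ y, density X σ β y * K β y ≤ ∫⁻ β, ρ β := by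
  have md := measurable_density X σ
  have mF : Measurable (fun w : E d × E p => ρ w.1 * (density X σ w.1 w.2 * K w.1 w.2)) :=
    (hρ.comp measurable_fst).mul (md.mul mK)
  have mKβ : ∀ β, Measurable (K β) := fun β => mK.comp measurable_prodMk_left
  have m1 : ∀ β, Measurable (fun y => density X σ β y * K β y) := fun β =>
    (measurable_density_right X σ β).mul (mKβ β)
  have m2 : Measurable (fun w : E p × E d => density X σ w.2 w.1 * ρ w.2) :=
    (md.comp measurable_swap).mul (hρ.comp measurable_snd)
  calc ∫⁻ β, ρ β * ∫⁻ y, density X σ β y * K β y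
      = ∫⁻ β, ∫⁻ y, ρ β * (density X σ β y * K β y) :=
        lintegral_congr fun β => (lintegral_const_mul _ (m1 β)).symm
    _ = ∫⁻ y, ∫⁻ β, ρ β * (density X σ β y * K β y) := lintegral_lintegral_swap mF.aemeasurable
    _ ≤ ∫⁻ y, marginal X σ ρ y := lintegral_mono hK
    _ = ∫⁻ β, ∫⁻ y, density X σ β y * ρ β :=
        lintegral_lintegral_swap (f := fun y β => density X σ β y * ρ β) m2.aemeasurable
    _ = ∫⁻ β, ρ β := by
        refine lintegral_congr fun β => ?_
        rw [lintegral_mul_const _ (measurable_density_right X σ β), lintegral_density_eq_one hσ,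
          one_mul]

lemma lintegral_mul_lintegral_div_le (hσ : 0 < σ) (hρ : Measurable ρ) {q b : E p → E p' → ℝ≥0∞}
    (hq : IsPredictiveDensity q) (mb : Measurable (Function.uncurry b))
    (hb : ∀ y z, ∫⁻ β, density X' σ' β z * density X σ β y * ρ β = marginal X σ ρ y * b y z) :
    ∫⁻ β, ρ β * ∫⁻ y, density X σ β y * ∫⁻ z, density X' σ' β z * (q y z / b y z) ≤
      ∫⁻ β, ρ β := by
  have mq : Measurable (fun w : E p × E p' => q w.1 w.2 / b w.1 w.2) := hq.1.div mb
  have mk : Measurable (fun w : (E d × E p) × E p' => density X' σ' w.1.1 w.2 *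
      (q w.1.2 w.2 / b w.1.2 w.2)) :=
    ((measurable_density X' σ').comp
      ((measurable_fst.comp measurable_fst).prodMk measurable_snd)).mul
      (mq.comp ((measurable_snd.comp measurable_fst).prodMk measurable_snd))
  exact lintegral_mul_lintegral_density_le hσ hρ
    (K := fun β y => ∫⁻ z, density X' σ' β z * (q y z / b y z)) mk.lintegral_prod_right'
    fun y => lintegral_mul_density_mul_lintegral_le hρ (hq.1.comp measurable_prodMk_left)
      (mb.comp measurable_prodMk_left) (hq.2 y) y (hb y)

/-- The mean likelihood ratio averages to at most one over a prior. -/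
lemma lintegral_mul_lintegral_div_bayes_le (hσ : 0 < σ) (hσ' : 0 < σ') (hρ : Measurable ρ)
    (hm : ∀ y, marginal X σ ρ y ≠ 0 ∧ marginal X σ ρ y ≠ ⊤)
    {q : E p → E p' → ℝ≥0∞} (hq : IsPredictiveDensity q) :
    ∫⁻ β, ρ β * ∫⁻ y, density X σ β y * ∫⁻ z, density X' σ' β z *
      (q y z / bayesPredictive X X' σ σ' ρ y z) ≤ ∫⁻ β, ρ β :=
  lintegral_mul_lintegral_div_le hσ hρ hq (isPredictiveDensity_bayes hσ' hρ hm).1 fun y _ =>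
    (ENNReal.mul_div_cancel (hm y).1 (hm y).2).symm

lemma marginal_ne_of_lintegral_ne_top (hσ : 0 < σ) (hρ : Measurable ρ) (h0 : ∀ β, ρ β ≠ 0)
    (ht : ∫⁻ β, ρ β ≠ ∞) (y : E p) : marginal X σ ρ y ≠ 0 ∧ marginal X σ ρ y ≠ ⊤ := by
  have m := (measurable_density_left X σ y).mul hρ
  constructor
  · intro h
    have := (lintegral_eq_zero_iff m).1 h
    obtain ⟨β, hβ⟩ := this.exists
    exact mul_ne_zero (density_pos hσ β y).ne' (h0 β) hβ
  · refine ((lintegral_mono fun β => mul_le_mul_left (density_le X σ β y) _).trans_lt ?_).ne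
    rw [lintegral_const_mul _ hρ]
    exact ENNReal.mul_lt_top ENNReal.ofReal_lt_top ht.lt_top

/-- A prior with finite mass compares the constant risk of the uniform prior with any risk. -/
lemma risk_bayes_one_add_mul_le (hX : IsUnit (X * X.transpose).det) (hσ : 0 < σ) (hσ' : 0 < σ')
    (hA : A * A.transpose = covMat X σ - covMatW X X' σ σ') (hρ : Measurable ρ)
    (h0 : ∀ β, ρ β ≠ 0) (ht : ∫⁻ β, ρ β ≠ ∞) {κ : ℝ≥0∞}
    (hκ : ∀ β, ∫⁻ y, density X σ β y * ∫⁻ z, density X' σ' β z *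
      (bayesPredictive X X' σ σ' ρ y z / bayesPredictive X X' σ σ' (fun _ => 1) y z) ≤ κ)
    {q : E p → E p' → ℝ≥0∞} (hq : IsPredictiveDensity q) {g : E d → ℝ≥0∞} (hg : Measurable g)
    (hqg : ∀ β, risk X X' σ σ' q β ≤ g β) :
    (risk X X' σ σ' (bayesPredictive X X' σ σ' fun _ => 1) 0 + 1 + 1) * ∫⁻ β, ρ β ≤
      (∫⁻ β, ρ β * (g β + κ)) + ∫⁻ β, ρ β := by
  have hm := marginal_ne_of_lintegral_ne_top (X := X) hσ hρ h0 ht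
  have hb := isPredictiveDensity_bayes (X := X) (X' := X') hσ' hρ hm
  have h1 := isPredictiveDensity_bayes (X' := X') (σ' := σ') hσ' measurable_const
    (marginal_one_ne hX hσ)
  have hbne := bayesPredictive_ne (X' := X') hX hσ hσ' hA hρ hm
  have h1ne := bayesPredictive_ne (X' := X') hX hσ hσ' hA measurable_const
    (marginal_one_ne hX hσ)
  set r := risk X X' σ σ' (bayesPredictive X X' σ σ' fun _ => 1) 0 with hr
  set E' : E d → ℝ≥0∞ := fun β => ∫⁻ y, density X σ β y * ∫⁻ z, density X' σ' β z *
      (q y z / bayesPredictive X X' σ σ' ρ y z) with hE'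
  -- Two comparisons are chained, uniform against `ρ` and `ρ` against `q`. The majorant `g` replaces
  -- the risk of `q`, whose measurability in `β` is thus not needed.
  have hpt : ∀ β, (r + 1 + 1) * ρ β ≤ ρ β * (g β + κ) + ρ β * E' β := by
    intro β
    have c1 := risk_add_one_le (X := X) (X' := X') hσ hσ' h1 hb
      (fun y z => (h1ne y z).1) (fun y z => (h1ne y z).2) β
    have c2 := risk_add_one_le (X := X) (X' := X') hσ hσ' hb hq
      (fun y z => (hbne y z).1) (fun y z => (hbne y z).2) β
    rw [risk_bayes_one_eq hX hσ hσ' hA β] at c1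
    rw [← mul_add, mul_comm]
    refine mul_le_mul_right ?_ _
    calc r + 1 + 1 ≤ risk X X' σ σ' (bayesPredictive X X' σ σ' ρ) β + κ + 1 := by
          exact add_le_add_left (c1.trans (add_le_add_right (hκ β) _)) _
      _ = risk X X' σ σ' (bayesPredictive X X' σ σ' ρ) β + 1 + κ := by ring
      _ ≤ g β + E' β + κ := by exact add_le_add_left (c2.trans (add_le_add_left (hqg β) _)) _
      _ = g β + κ + E' β := by ring
  rw [← lintegral_const_mul _ hρ]
  have mρg : Measurable fun β => ρ β * (g β + κ) := hρ.mul (hg.add_const κ)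
  refine (lintegral_mono hpt).trans ?_
  have hE : ∫⁻ β, ρ β * E' β ≤ ∫⁻ β, ρ β :=
    lintegral_mul_lintegral_div_bayes_le (X' := X') hσ hσ' hρ hm hq
  calc ∫⁻ β, ρ β * (g β + κ) + ρ β * E' β
      = (∫⁻ β, ρ β * (g β + κ)) + ∫⁻ β, ρ β * E' β := lintegral_add_left mρg _
    _ ≤ (∫⁻ β, ρ β * (g β + κ)) + ∫⁻ β, ρ β := add_le_add le_rfl hE

end proper

/-! ### Flat priors of finite mass -/

section laplace

/-- The mean of `exp (t ‖B ξ‖)` for a standard Gaussian `ξ`. -/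
def expNorm (B : Matrix (Fin d) (Fin d) ℝ) (t : ℝ) : ℝ≥0∞ :=
  ∫⁻ ξ, ENNReal.ofReal (Real.exp (t * ‖act B ξ‖)) ∂stdGaussian (E d)

lemma expNorm_ne_top (B : Matrix (Fin d) (Fin d) ℝ) (t : ℝ) : expNorm B t ≠ ∞ := by
  unfold expNorm
  rw [lintegral_stdGaussian (by fun_prop)]
  set c := |t| * ‖actL B‖ with hc
  have hi := ((integrable_exp_neg_mul_norm_sq (n := d) (b := 1 / 4) (by norm_num)).const_mul
    ((2 * Real.pi) ^ (-(d : ℝ) / 2) * Real.exp (c ^ 2))).lintegral_lt_top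
  refine ((lintegral_mono fun ξ => ?_).trans_lt hi).ne
  rw [gaussDensity, ← ENNReal.ofReal_mul (by positivity)]
  refine ENNReal.ofReal_le_ofReal ?_
  rw [mul_assoc, mul_assoc, ← Real.exp_add, ← Real.exp_add]
  refine mul_le_mul_of_nonneg_left (Real.exp_le_exp.2 ?_) (by positivity)
  have h1 : t * ‖act B ξ‖ ≤ c * ‖ξ‖ := by
    rw [hc, mul_assoc]
    exact mul_le_mul (le_abs_self t) (norm_act_le B ξ) (norm_nonneg _) (abs_nonneg t)
  -- From `c‖ξ‖ ≤ c² + ‖ξ‖²/4`, half of the Gaussian exponent is left for integrability.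
  nlinarith [sq_nonneg (c - ‖ξ‖ / 2)]

lemma expNorm_ne_zero (B : Matrix (Fin d) (Fin d) ℝ) (t : ℝ) : expNorm B t ≠ 0 := by
  intro h
  have := (lintegral_eq_zero_iff (by fun_prop)).1 h
  obtain ⟨ξ, hξ⟩ := this.exists
  exact (ENNReal.ofReal_pos.2 (Real.exp_pos _)).ne' hξ

lemma tendsto_expNorm (B : Matrix (Fin d) (Fin d) ℝ) :
    Filter.Tendsto (expNorm B) (nhds 0) (nhds 1) := by
  have h1 : expNorm B 0 = 1 := by simp [expNorm]
  rw [← h1]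
  unfold expNorm
  refine tendsto_lintegral_filter_of_dominated_convergence
    (fun ξ => ENNReal.ofReal (Real.exp (1 * ‖act B ξ‖)))
    (Filter.Eventually.of_forall fun t => by fun_prop)
    ?_ (expNorm_ne_top B 1) (Filter.Eventually.of_forall fun ξ => ?_)
  · filter_upwards [Iic_mem_nhds (zero_lt_one (α := ℝ))] with t ht
    refine Filter.Eventually.of_forall fun ξ => ENNReal.ofReal_le_ofReal (Real.exp_le_exp.2 ?_)
    exact mul_le_mul_of_nonneg_right ht (norm_nonneg _)
  · refine ENNReal.tendsto_ofReal ?_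
    have : Continuous fun t : ℝ => Real.exp (t * ‖act B ξ‖) := by fun_prop
    exact this.tendsto 0

/-- The prior density `exp (-ε ‖β‖)`, up to normalization. -/
def laplacePrior (ε : ℝ) (β : E d) : ℝ≥0∞ := ENNReal.ofReal (Real.exp (-ε * ‖β‖))

lemma measurable_laplacePrior (ε : ℝ) : Measurable (laplacePrior (d := d) ε) := by
  unfold laplacePrior; fun_prop

lemma laplacePrior_ne_zero (ε : ℝ) (β : E d) : laplacePrior ε β ≠ 0 :=
  (ENNReal.ofReal_pos.2 (Real.exp_pos _)).ne'

lemma lintegral_laplacePrior_mul_ne_top {ε : ℝ} (hε : 0 < ε) (k : ℕ) :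
    ∫⁻ β : E d, laplacePrior ε β * ENNReal.ofReal ((1 + ‖β‖) ^ k) ≠ ∞ := by
  have hi := ((integrable_one_add_norm (E := E d) (μ := volume) (r := (d + 1 : ℕ))
    (by simp)).const_mul (((d + 1 + k).factorial : ℝ) / ε ^ (d + 1 + k) *
      Real.exp ε)).lintegral_lt_top
  refine ((lintegral_mono fun β => ?_).trans_lt hi).ne
  rw [laplacePrior, ← ENNReal.ofReal_mul (by positivity)]
  refine ENNReal.ofReal_le_ofReal ?_
  have h0 : 0 < 1 + ‖β‖ := by positivity
  -- The exponent `d + 1 + k` absorbs the polynomial and leaves the integrable `(1 + ‖β‖)^{-(d+1)}`.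
  have h := Real.pow_div_factorial_le_exp (ε * (1 + ‖β‖)) (by positivity) (d + 1 + k)
  rw [Real.rpow_neg h0.le, Real.rpow_natCast, ← div_eq_mul_inv, le_div_iff₀ (by positivity),
    mul_assoc, ← pow_add, add_comm k, neg_mul, Real.exp_neg, inv_mul_le_iff₀ (Real.exp_pos _)]
  rw [div_le_iff₀ (by positivity), mul_pow, mul_add, Real.exp_add, mul_one] at h
  rw [div_mul_eq_mul_div, mul_div_assoc', le_div_iff₀ (by positivity)]
  linarith

lemma lintegral_laplacePrior_ne_top {ε : ℝ} (hε : 0 < ε) :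
    ∫⁻ β : E d, laplacePrior ε β ≠ ∞ := by
  simpa using lintegral_laplacePrior_mul_ne_top (d := d) hε 0

/-- The logarithm of the prior is `ε`-Lipschitz, which is why its Gaussian averages stay comparable
to it. -/
lemma laplacePrior_add_le {ε : ℝ} (hε : 0 ≤ ε) (x v : E d) :
    laplacePrior ε (x + v) ≤ laplacePrior ε x * ENNReal.ofReal (Real.exp (ε * ‖v‖)) := by
  rw [laplacePrior, laplacePrior, ← ENNReal.ofReal_mul (by positivity), ← Real.exp_add]
  refine ENNReal.ofReal_le_ofReal (Real.exp_le_exp.2 ?_)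
  have : ‖x‖ ≤ ‖x + v‖ + ‖v‖ := by simpa using norm_sub_le (x + v) v
  nlinarith

lemma le_laplacePrior_add {ε : ℝ} (hε : 0 ≤ ε) (x v : E d) :
    laplacePrior ε x * ENNReal.ofReal (Real.exp (-ε * ‖v‖)) ≤ laplacePrior ε (x + v) := by
  rw [laplacePrior, laplacePrior, ← ENNReal.ofReal_mul (by positivity), ← Real.exp_add]
  refine ENNReal.ofReal_le_ofReal (Real.exp_le_exp.2 ?_)
  have := norm_add_le x v
  nlinarith

lemma gaussAvg_laplacePrior_le {ε : ℝ} (hε : 0 ≤ ε) (S : Matrix (Fin d) (Fin d) ℝ) (x : E d) :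
    gaussAvg S (laplacePrior ε) x ≤ laplacePrior ε x * expNorm S ε := by
  unfold gaussAvg expNorm
  rw [← lintegral_const_mul _ (by fun_prop)]
  exact lintegral_mono fun ξ => laplacePrior_add_le hε _ _

lemma le_gaussAvg_laplacePrior {ε : ℝ} (hε : 0 ≤ ε) (S : Matrix (Fin d) (Fin d) ℝ) (x : E d) :
    laplacePrior ε x * expNorm S (-ε) ≤ gaussAvg S (laplacePrior ε) x := by
  unfold gaussAvg expNorm
  rw [← lintegral_const_mul _ (by fun_prop)]
  exact lintegral_mono fun ξ => le_laplacePrior_add hε _ _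

/-- Replacing each average by the prior costs an `expNorm` factor. The remaining ratio of priors at
`x` and `x + A ξ` is at most `exp(ε‖A ξ‖)`, with mean `expNorm A ε`. All factors tend to one with
`ε`. -/
lemma laplacePrior_div_le {ε : ℝ} (hε : 0 ≤ ε) (S A : Matrix (Fin d) (Fin d) ℝ) (x : E d) :
    ∫⁻ ξ, gaussAvg S (laplacePrior ε) x / gaussAvg A (gaussAvg S (laplacePrior ε)) (x + act A ξ)
      ∂stdGaussian (E d) ≤
    expNorm S ε * expNorm A ε / (expNorm A (-ε) * expNorm S (-ε)) := by
  have hx0 := laplacePrior_ne_zero ε x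
  have hxt : laplacePrior ε x ≠ ∞ := ENNReal.ofReal_ne_top
  set D := expNorm A (-ε) * expNorm S (-ε) with hD
  have hD0 : D ≠ 0 := mul_ne_zero (expNorm_ne_zero _ _) (expNorm_ne_zero _ _)
  have hDt : D ≠ ∞ := ENNReal.mul_ne_top (expNorm_ne_top _ _) (expNorm_ne_top _ _)
  have hpt : ∀ ξ : E d, gaussAvg S (laplacePrior ε) x /
      gaussAvg A (gaussAvg S (laplacePrior ε)) (x + act A ξ) ≤
      expNorm S ε / D * ENNReal.ofReal (Real.exp (ε * ‖act A ξ‖)) := by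
    intro ξ
    have hv : laplacePrior ε (x + act A ξ) * D ≤
        gaussAvg A (gaussAvg S (laplacePrior ε)) (x + act A ξ) := by
      refine le_trans ?_ (gaussAvg_mono A (le_gaussAvg_laplacePrior hε S) _)
      have : gaussAvg A (fun x => laplacePrior ε x * expNorm S (-ε)) (x + act A ξ) =
          gaussAvg A (laplacePrior ε) (x + act A ξ) * expNorm S (-ε) :=
        lintegral_mul_const' _ _ (expNorm_ne_top _ _)
      rw [this, hD, ← mul_assoc]
      exact mul_le_mul_left (le_gaussAvg_laplacePrior hε A _) _
    refine ENNReal.div_le_of_le_mul ?_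
    refine (gaussAvg_laplacePrior_le hε S x).trans ?_
    refine le_trans ?_ (mul_le_mul_right hv _)
    have h2 : laplacePrior ε x ≤
        laplacePrior ε (x + act A ξ) * ENNReal.ofReal (Real.exp (ε * ‖act A ξ‖)) := by
      simpa using laplacePrior_add_le hε (x + act A ξ) (-act A ξ)
    calc laplacePrior ε x * expNorm S ε
        ≤ laplacePrior ε (x + act A ξ) * ENNReal.ofReal (Real.exp (ε * ‖act A ξ‖)) *
          expNorm S ε := mul_le_mul_left h2 _
      _ = (expNorm S ε / D * D) * (laplacePrior ε (x + act A ξ) *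
          ENNReal.ofReal (Real.exp (ε * ‖act A ξ‖))) := by
        rw [ENNReal.div_mul_cancel hD0 hDt]; ring
      _ = _ := by ring
  refine (lintegral_mono hpt).trans ?_
  rw [lintegral_const_mul _ (by fun_prop)]
  refine le_of_eq ?_
  rw [← expNorm, div_eq_mul_inv, div_eq_mul_inv]
  ring

lemma lintegral_bayes_laplacePrior_div_le (hX : IsUnit (X * X.transpose).det) (hσ : 0 < σ)
    (hσ' : 0 < σ') (hA : A * A.transpose = covMat X σ - covMatW X X' σ σ') {ε : ℝ} (hε : 0 ≤ ε)
    (β : E d) :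
    ∫⁻ y, density X σ β y * ∫⁻ z, density X' σ' β z *
      (bayesPredictive X X' σ σ' (laplacePrior ε) y z /
        bayesPredictive X X' σ σ' (fun _ => 1) y z) ≤
    expNorm (sqrtMat (covMatW X X' σ σ')) ε * expNorm A ε /
      (expNorm A (-ε) * expNorm (sqrtMat (covMatW X X' σ σ')) (-ε)) := by
  rw [lintegral_bayes_div_bayes hX hσ hσ' hA measurable_const (measurable_laplacePrior ε) β]
  set S := sqrtMat (covMatW X X' σ σ')
  rw [← gaussAvg_const S (_ / _) β]
  refine gaussAvg_mono S (fun x => le_trans (le_of_eq ?_) (laplacePrior_div_le hε S A x)) β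
  refine lintegral_congr fun ξ => ?_
  have : gaussAvg S (fun _ => 1) = fun _ => 1 := funext fun x => gaussAvg_const _ _ x
  rw [this, gaussAvg_const, div_one, div_one]

end laplace

end properPriors

/-! ### Minimaxity and domination -/

section minimaxity

variable {d p p' : ℕ} {X : Matrix (Fin d) (Fin p) ℝ} {X' : Matrix (Fin d) (Fin p') ℝ} {σ σ' : ℝ}
  {A : Matrix (Fin d) (Fin d) ℝ} {π : E d → ℝ≥0∞}

section minimax

/-- The log ratio of the two densities is at most `‖z‖²/(2σ'²)`, since the exponent of the numerator
is nonpositive. -/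
lemma ofReal_klFun_density_le (hσ' : 0 < σ') (β : E d) (z : E p') :
    ENNReal.ofReal (InformationTheory.klFun
      (density X' σ' β z / density X' σ' 0 z).toReal) * density X' σ' 0 z ≤
    density X' σ' β z * ENNReal.ofReal (‖z‖ ^ 2 / (2 * σ' ^ 2)) + density X' σ' 0 z := by
  simp only [density, act_zero, sub_zero]
  set c := (2 * Real.pi * σ' ^ 2) ^ (-(p' : ℝ) / 2) with hc
  have hc0 : 0 < c := by positivity
  set a := c * Real.exp (-‖z - act X'.transpose β‖ ^ 2 / (2 * σ' ^ 2)) with ha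
  set b := c * Real.exp (-‖z‖ ^ 2 / (2 * σ' ^ 2)) with hb
  have ha0 : 0 < a := by positivity
  have hb0 : 0 < b := by positivity
  rw [← ENNReal.ofReal_div_of_pos hb0, ENNReal.toReal_ofReal (by positivity),
    ← ENNReal.ofReal_mul (InformationTheory.klFun_nonneg (by positivity)),
    ← ENNReal.ofReal_mul ha0.le, ← ENNReal.ofReal_add (by positivity) hb0.le]
  refine ENNReal.ofReal_le_ofReal ?_
  have hlog : Real.log (a / b) ≤ ‖z‖ ^ 2 / (2 * σ' ^ 2) := by
    rw [ha, hb, mul_div_mul_left _ _ hc0.ne', ← Real.exp_sub, Real.log_exp, neg_div, neg_div]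
    have : 0 ≤ ‖z - act X'.transpose β‖ ^ 2 / (2 * σ' ^ 2) := by positivity
    linarith
  have e : InformationTheory.klFun (a / b) * b = a * Real.log (a / b) + b - a := by
    rw [InformationTheory.klFun_apply]; field_simp
  rw [e]
  have := mul_le_mul_of_nonneg_left hlog ha0.le
  linarith

lemma lintegral_norm_sq_ne_top (n : ℕ) :
    ∫⁻ ε : E n, ENNReal.ofReal (‖ε‖ ^ 2) ∂stdGaussian (E n) ≠ ∞ := by
  refine ((lintegral_mono fun ε => ENNReal.ofReal_le_ofReal ?_).trans_lt
    (integrable_one_add_norm_pow n 2).lintegral_lt_top).ne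
  have := norm_nonneg ε
  nlinarith

/-- A quadratic bound for the risk of a fixed density of the model. -/
lemma risk_density_zero_le (hσ : 0 < σ) (hσ' : 0 < σ') (β : E d) :
    risk X X' σ σ' (fun _ => density X' σ' 0) β ≤
      ENNReal.ofReal (‖act X'.transpose β‖ ^ 2 / σ' ^ 2) +
        ∫⁻ ε : E p', ENNReal.ofReal (‖ε‖ ^ 2) ∂stdGaussian (E p') + 1 := by
  set C := ∫⁻ ε : E p', ENNReal.ofReal (‖ε‖ ^ 2) ∂stdGaussian (E p')
  have m1 := measurable_density_right X' σ' β
  have m0 := measurable_density_right X' σ' (0 : E d)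
  have mz : Measurable (fun z : E p' => ENNReal.ofReal (‖z‖ ^ 2 / (2 * σ' ^ 2))) := by fun_prop
  have mdz : Measurable (fun z : E p' =>
      density X' σ' β z * ENNReal.ofReal (‖z‖ ^ 2 / (2 * σ' ^ 2))) := m1.mul mz
  have hkl : InformationTheory.klDiv (volume.withDensity (density X' σ' β))
      (volume.withDensity (density X' σ' 0)) ≤
      ENNReal.ofReal (‖act X'.transpose β‖ ^ 2 / σ' ^ 2) + C + 1 := by
    rw [klDiv_withDensity m1 m0 (lintegral_density_eq_one hσ' β) (lintegral_density_eq_one hσ' 0)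
      (Filter.Eventually.of_forall fun z => (density_pos hσ' 0 z).ne')]
    refine (lintegral_mono fun z => ofReal_klFun_density_le hσ' β z).trans ?_
    refine (lintegral_add_left mdz _).trans_le ?_
    refine add_le_add ?_ (lintegral_density_eq_one hσ' 0).le
    rw [lintegral_density hσ' β mz]
    have hpt : ∀ ε : E p', ENNReal.ofReal (‖act X'.transpose β + σ' • ε‖ ^ 2 / (2 * σ' ^ 2)) ≤
        ENNReal.ofReal (‖act X'.transpose β‖ ^ 2 / σ' ^ 2) + ENNReal.ofReal (‖ε‖ ^ 2) := by
      intro ε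
      rw [← ENNReal.ofReal_add (by positivity) (by positivity)]
      refine ENNReal.ofReal_le_ofReal ?_
      have h1 := norm_add_le (act X'.transpose β) (σ' • ε)
      rw [norm_smul, Real.norm_of_nonneg hσ'.le] at h1
      have h2 : ‖act X'.transpose β + σ' • ε‖ ^ 2 ≤ (‖act X'.transpose β‖ + σ' * ‖ε‖) ^ 2 :=
        pow_le_pow_left₀ (norm_nonneg _) h1 2
      rw [div_add' _ _ _ (by positivity), div_le_div_iff₀ (by positivity) (by positivity)]
      have h3 : 0 ≤ (‖act X'.transpose β‖ - σ' * ‖ε‖) ^ 2 := sq_nonneg _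
      have h4 : ‖act X'.transpose β + σ' • ε‖ ^ 2 ≤
          2 * (‖act X'.transpose β‖ ^ 2 + ‖ε‖ ^ 2 * σ' ^ 2) := by linarith
      have := mul_le_mul_of_nonneg_right h4 (sq_nonneg σ')
      linarith
    refine (lintegral_mono hpt).trans ?_
    rw [lintegral_add_left measurable_const]
    simp [C]
  calc risk X X' σ σ' (fun _ => density X' σ' 0) β
      ≤ ∫⁻ y, density X σ β y * (ENNReal.ofReal (‖act X'.transpose β‖ ^ 2 / σ' ^ 2) + C + 1) :=
        lintegral_mono fun y => mul_le_mul_right hkl _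
    _ = _ := by
      rw [lintegral_mul_const _ (measurable_density_right X σ β), lintegral_density_eq_one hσ,
        one_mul]

/-- The bound on the mean likelihood ratio between the predictions based on `laplacePrior ε` and
on the uniform prior. -/
def laplaceBound (S A : Matrix (Fin d) (Fin d) ℝ) (ε : ℝ) : ℝ≥0∞ :=
  expNorm S ε * expNorm A ε / (expNorm A (-ε) * expNorm S (-ε))

lemma laplaceBound_ne_top (S A : Matrix (Fin d) (Fin d) ℝ) (ε : ℝ) : laplaceBound S A ε ≠ ∞ :=
  ENNReal.div_ne_top (ENNReal.mul_ne_top (expNorm_ne_top _ _) (expNorm_ne_top _ _))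
    (mul_ne_zero (expNorm_ne_zero _ _) (expNorm_ne_zero _ _))

lemma tendsto_laplaceBound (S A : Matrix (Fin d) (Fin d) ℝ) :
    Filter.Tendsto (fun n : ℕ => laplaceBound S A (1 / ((n : ℝ) + 1))) Filter.atTop (nhds 1) := by
  have h := tendsto_one_div_add_atTop_nhds_zero_nat (𝕜 := ℝ)
  have h' := h.neg
  rw [neg_zero] at h'
  have t : ∀ B : Matrix (Fin d) (Fin d) ℝ, Filter.Tendsto
      (fun n : ℕ => expNorm B (1 / ((n : ℝ) + 1))) Filter.atTop (nhds 1) := fun B =>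
    (tendsto_expNorm B).comp h
  have t' : ∀ B : Matrix (Fin d) (Fin d) ℝ, Filter.Tendsto
      (fun n : ℕ => expNorm B (-(1 / ((n : ℝ) + 1)))) Filter.atTop (nhds 1) := fun B =>
    (tendsto_expNorm B).comp h'
  have num := ENNReal.Tendsto.mul (t S) (Or.inl one_ne_zero) (t A) (Or.inl one_ne_zero)
  have den := ENNReal.Tendsto.mul (t' A) (Or.inl one_ne_zero) (t' S) (Or.inl one_ne_zero)
  have := ENNReal.Tendsto.div num (Or.inl (by simp)) den (Or.inl (by simp))
  simpa [laplaceBound] using this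

lemma lintegral_laplacePrior_ne_zero {ε : ℝ} : ∫⁻ β : E d, laplacePrior ε β ≠ 0 := by
  intro h
  obtain ⟨β, hβ⟩ := ((lintegral_eq_zero_iff (measurable_laplacePrior ε)).1 h).exists
  exact laplacePrior_ne_zero ε β hβ

/-- The risk of the prediction based on the uniform prior is finite. -/
theorem risk_bayes_one_ne_top (hX : IsUnit (X * X.transpose).det) (hσ : 0 < σ) (hσ' : 0 < σ')
    (hA : A * A.transpose = covMat X σ - covMatW X X' σ σ') (β : E d) :
    risk X X' σ σ' (bayesPredictive X X' σ σ' fun _ => 1) β ≠ ⊤ := by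
  rw [risk_bayes_one_eq hX hσ hσ' hA β]
  -- Any competitor whose risk is integrable against the prior will do; ignoring `y` gives quadratic
  -- growth in `β`.
  have hq : IsPredictiveDensity (fun _ : E p => density X' σ' (0 : E d)) :=
    ⟨(measurable_density_right X' σ' (0 : E d)).comp measurable_snd,
      fun _ => lintegral_density_eq_one hσ' 0⟩
  set κ := laplaceBound (sqrtMat (covMatW X X' σ σ')) A 1 with hκ
  set C := ∫⁻ ε : E p', ENNReal.ofReal (‖ε‖ ^ 2) ∂stdGaussian (E p') with hC
  set L := ‖actL X'.transpose‖ ^ 2 / σ' ^ 2 with hL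
  have hqg : ∀ β, risk X X' σ σ' (fun _ : E p => density X' σ' (0 : E d)) β ≤
      (ENNReal.ofReal L + C + 1) * ENNReal.ofReal ((1 + ‖β‖) ^ 2) := by
    intro β
    have h1 : 1 ≤ ENNReal.ofReal ((1 + ‖β‖) ^ 2) := by
      rw [← ENNReal.ofReal_one]
      refine ENNReal.ofReal_le_ofReal ?_
      have := norm_nonneg β
      nlinarith
    refine (risk_density_zero_le hσ hσ' β).trans ?_
    rw [add_mul, add_mul]
    refine add_le_add (add_le_add ?_ (le_mul_of_one_le_right' h1)) (le_mul_of_one_le_right' h1)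
    rw [← ENNReal.ofReal_mul (by positivity)]
    refine ENNReal.ofReal_le_ofReal ?_
    rw [hL, div_mul_eq_mul_div, ← mul_pow]
    refine div_le_div_of_nonneg_right (pow_le_pow_left₀ (norm_nonneg _) ?_ 2) (by positivity)
    refine (norm_act_le _ β).trans (mul_le_mul_of_nonneg_left (by linarith) (norm_nonneg _))
  have key := risk_bayes_one_add_mul_le hX hσ hσ' hA (measurable_laplacePrior 1)
    (laplacePrior_ne_zero 1) (lintegral_laplacePrior_ne_top one_pos)
    (lintegral_bayes_laplacePrior_div_le hX hσ hσ' hA zero_le_one) hq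
    (g := fun β => (ENNReal.ofReal L + C + 1) * ENNReal.ofReal ((1 + ‖β‖) ^ 2))
    (by fun_prop) hqg
  rw [← laplaceBound, ← hκ] at key
  have hZ := lintegral_laplacePrior_ne_top (d := d) one_pos
  have hK : ENNReal.ofReal L + C + 1 ≠ ∞ := by
    exact ENNReal.add_ne_top.2 ⟨ENNReal.add_ne_top.2 ⟨ENNReal.ofReal_ne_top,
      lintegral_norm_sq_ne_top p'⟩, ENNReal.one_ne_top⟩
  have hfin : (∫⁻ β : E d, laplacePrior 1 β *
      ((ENNReal.ofReal L + C + 1) * ENNReal.ofReal ((1 + ‖β‖) ^ 2) + κ)) ≠ ∞ := by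
    have e : ∀ β : E d, laplacePrior 1 β *
        ((ENNReal.ofReal L + C + 1) * ENNReal.ofReal ((1 + ‖β‖) ^ 2) + κ) =
        (ENNReal.ofReal L + C + 1) * (laplacePrior 1 β * ENNReal.ofReal ((1 + ‖β‖) ^ 2)) +
          κ * laplacePrior 1 β := fun β => by ring
    have m1 : Measurable fun β : E d => κ * laplacePrior 1 β :=
      (measurable_laplacePrior 1).const_mul κ
    simp only [e]
    rw [lintegral_add_right _ m1, lintegral_const_mul' _ _ hK,
      lintegral_const_mul' _ _ (laplaceBound_ne_top _ _ _)]
    exact ENNReal.add_ne_top.2 ⟨ENNReal.mul_ne_top hK (lintegral_laplacePrior_mul_ne_top one_pos 2),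
      ENNReal.mul_ne_top (laplaceBound_ne_top _ _ _) hZ⟩
  intro hr
  rw [hr] at key
  simp only [top_add] at key
  rw [ENNReal.top_mul lintegral_laplacePrior_ne_zero, top_le_iff] at key
  exact ENNReal.add_ne_top.2 ⟨hfin, hZ⟩ key

/-- No predictive density has a smaller maximal risk than that of the uniform prior. -/
theorem risk_bayes_one_le_iSup (hX : IsUnit (X * X.transpose).det) (hσ : 0 < σ) (hσ' : 0 < σ')
    (hA : A * A.transpose = covMat X σ - covMatW X X' σ σ') {q : E p → E p' → ℝ≥0∞}
    (hq : IsPredictiveDensity q) (β : E d) :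
    risk X X' σ σ' (bayesPredictive X X' σ σ' fun _ => 1) β ≤ ⨆ β, risk X X' σ σ' q β := by
  rw [risk_bayes_one_eq hX hσ hσ' hA β]
  set r := risk X X' σ σ' (bayesPredictive X X' σ σ' fun _ => 1) 0
  set s := ⨆ β, risk X X' σ σ' q β
  set S := sqrtMat (covMatW X X' σ σ') with hS
  -- The mass of the prior cancels; in the limit the bound becomes one and `r ≤ s` remains.
  have hn : ∀ n : ℕ, r + 1 + 1 ≤ s + laplaceBound S A (1 / ((n : ℝ) + 1)) + 1 := by
    intro n
    set ε : ℝ := 1 / ((n : ℝ) + 1) with hε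
    have hε0 : 0 < ε := by positivity
    have key := risk_bayes_one_add_mul_le hX hσ hσ' hA (measurable_laplacePrior ε)
      (laplacePrior_ne_zero ε) (lintegral_laplacePrior_ne_top hε0)
      (lintegral_bayes_laplacePrior_div_le hX hσ hσ' hA hε0.le) hq
      (g := fun _ => s) measurable_const (fun β => le_iSup (risk X X' σ σ' q) β)
    rw [← laplaceBound, lintegral_mul_const _ (measurable_laplacePrior ε), mul_comm _ (s + _),
      ← add_one_mul] at key
    exact (ENNReal.mul_le_mul_iff_left lintegral_laplacePrior_ne_zero
      (lintegral_laplacePrior_ne_top hε0)).1 key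
  have ht := ((tendsto_laplaceBound S A).const_add s).add_const 1
  have := ge_of_tendsto' ht hn
  exact ENNReal.le_of_add_le_add_right ENNReal.one_ne_top
    (ENNReal.le_of_add_le_add_right ENNReal.one_ne_top this)

/-- The prediction based on a supermean-valued prior is minimax. -/
theorem isMinimax_bayes (hX : IsUnit (X * X.transpose).det) (hσ : 0 < σ) (hσ' : 0 < σ')
    (hA : A * A.transpose = covMat X σ - covMatW X X' σ σ') (hπ : Measurable π)
    (hm : ∀ y, marginal X σ π y ≠ 0 ∧ marginal X σ π y ≠ ⊤)
    (hle : ∀ b, gaussAvg A π b ≤ π b) : IsMinimax X X' σ σ' (bayesPredictive X X' σ σ' π) :=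
  ⟨isPredictiveDensity_bayes hσ' hπ hm, fun _ hq => iSup_le fun β =>
    (risk_bayes_le hX hσ hσ' hA hπ hm hle β).trans (risk_bayes_one_le_iSup hX hσ hσ' hA hq β)⟩

/-- The prediction based on a supermean-valued prior dominates that based on the uniform prior,
unless the prior is constant on almost every translate of the range of `A`. -/
theorem dominates_bayes (hX : IsUnit (X * X.transpose).det) (hσ : 0 < σ) (hσ' : 0 < σ')
    (hA : A * A.transpose = covMat X σ - covMatW X X' σ σ') (hπ : Measurable π)
    (hm : ∀ y, marginal X σ π y ≠ 0 ∧ marginal X σ π y ≠ ⊤)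
    (hle : ∀ b, gaussAvg A π b ≤ π b)
    (hlsc : ∀ b, LowerSemicontinuous fun β => π (b + act A β))
    (hne : ¬ ∀ᵐ b, ∀ β, π (b + act A β) = π b) :
    Dominates X X' σ σ' (bayesPredictive X X' σ σ' π) (bayesPredictive X X' σ σ' fun _ => 1) :=
  ⟨isPredictiveDensity_bayes hσ' hπ hm,
    isPredictiveDensity_bayes hσ' measurable_const (marginal_one_ne hX hσ),
    risk_bayes_le hX hσ hσ' hA hπ hm hle, 0,
    risk_bayes_lt hX hσ hσ' hA hπ hm hle
      (fun h => hne (ae_forall_eq_of_gaussAvg_ae_eq hπ hle hlsc h)) 0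
      (risk_bayes_one_ne_top hX hσ hσ' hA 0)⟩

end minimax

/-! ### Finiteness and positivity of the marginals for invertible `A` -/

section marginals

/-- A sufficiently wide Gaussian around any centre dominates a given one up to a factor. Hence
finiteness of `P_{nA} π` at one point for all `n` controls every marginal. -/
lemma exists_gaussDensity_act_le (T : Matrix (Fin d) (Fin d) ℝ) (hT : IsUnit T.det)
    (hA : IsUnit A.det) (x b : E d) : ∃ (n : ℕ) (K : ℝ), 0 < n ∧ ∀ β : E d,
      gaussDensity (act T⁻¹ (β - x)) ≤
        ENNReal.ofReal K * gaussDensity (act ((n : ℝ) • A)⁻¹ (β - b)) := by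
  set M := ‖actL (A⁻¹ * T)‖ with hM
  set N := ‖act A⁻¹ (x - b)‖ with hN
  -- This gives `n² ≥ 2M²`, which absorbs the factor in `(M‖w‖ + N)² ≤ 2M²‖w‖² + 2N²`.
  obtain ⟨n, hn⟩ := exists_nat_ge (2 * M ^ 2 + 1)
  have hn1 : (1 : ℝ) ≤ n := le_trans (by nlinarith [sq_nonneg M]) hn
  have hn0 : 0 < n := by exact_mod_cast (zero_lt_one.trans_le hn1)
  refine ⟨n, Real.exp (N ^ 2), hn0, fun β => ?_⟩
  rw [gaussDensity, gaussDensity, ← ENNReal.ofReal_mul (by positivity)]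
  refine ENNReal.ofReal_le_ofReal ?_
  rw [mul_left_comm, ← Real.exp_add]
  refine mul_le_mul_of_nonneg_left (Real.exp_le_exp.2 ?_) (by positivity)
  set w := act T⁻¹ (β - x) with hw
  have hnA : ((n : ℝ) • A)⁻¹ = (n : ℝ)⁻¹ • A⁻¹ := by
    refine Matrix.inv_eq_left_inv ?_
    rw [Matrix.smul_mul, Matrix.mul_smul, smul_smul, Matrix.nonsing_inv_mul _ hA,
      inv_mul_cancel₀ (by positivity), one_smul]
  have hsplit : act A⁻¹ (β - b) = act (A⁻¹ * T) w + act A⁻¹ (x - b) := by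
    rw [act_mul, hw, act_act_inv hT, ← act_add, sub_add_sub_cancel]
  have hnorm : ‖act A⁻¹ (β - b)‖ ≤ M * ‖w‖ + N := by
    rw [hsplit]
    exact (norm_add_le _ _).trans (add_le_add (norm_act_le _ _) le_rfl)
  have hsq : ‖act A⁻¹ (β - b)‖ ^ 2 ≤ (M * ‖w‖ + N) ^ 2 :=
    pow_le_pow_left₀ (norm_nonneg _) hnorm 2
  rw [hnA, smul_act, norm_smul, mul_pow, Real.norm_of_nonneg (by positivity), inv_pow]
  have hinv : ((n : ℝ) ^ 2)⁻¹ * ‖act A⁻¹ (β - b)‖ ^ 2 ≤ ‖w‖ ^ 2 + 2 * N ^ 2 := by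
    rw [inv_mul_le_iff₀ (by positivity)]
    have h1 : 2 * M ^ 2 ≤ (n : ℝ) ^ 2 := by nlinarith
    have h2 : 1 ≤ (n : ℝ) ^ 2 := by nlinarith
    have h3 := mul_le_mul_of_nonneg_right h1 (sq_nonneg ‖w‖)
    have h4 := mul_le_mul_of_nonneg_right h2 (sq_nonneg N)
    nlinarith [sq_nonneg (M * ‖w‖ - N)]
  linarith

/-- The marginals of a supermean-valued prior that is finite somewhere are finite. -/
lemma marginal_ne_top_of_gaussAvg_le (hX : IsUnit (X * X.transpose).det) (hσ : 0 < σ)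
    (hA : IsUnit A.det) (hπ : Measurable π) (hle : ∀ b, gaussAvg A π b ≤ π b) {b : E d}
    (hb : π b ≠ ∞) (y : E p) : marginal X σ π y ≠ ∞ := by
  obtain ⟨c, -, hct, hc⟩ := exists_marginal_eq hX hσ y
  rw [hc π hπ]
  have hT : IsUnit (sqrtMat (covMat X σ)).det := isUnit_det_sqrtMat (posDef_covMat hX hσ)
  set T := sqrtMat (covMat X σ)
  refine ENNReal.mul_ne_top hct ?_
  obtain ⟨n, K, hn, h⟩ := exists_gaussDensity_act_le T hT hA (est X σ y) b
  have hnA : IsUnit ((n : ℝ) • A).det := by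
    rw [Matrix.det_smul]
    exact (isUnit_iff_ne_zero.2 (by positivity)).mul hA
  have hfin : gaussAvg ((n : ℝ) • A) π b ≠ ∞ :=
    ((gaussAvg_nat_smul_le hπ hle n b).trans_lt hb.lt_top).ne
  rw [gaussAvg_eq_lintegral hnA hπ] at hfin
  rw [gaussAvg_eq_lintegral hT hπ]
  refine ENNReal.mul_ne_top ENNReal.ofReal_ne_top ?_
  have hdet : ENNReal.ofReal |((n : ℝ) • A)⁻¹.det| ≠ 0 :=
    (ENNReal.ofReal_pos.2 (abs_pos.2 (Matrix.isUnit_nonsing_inv_det _ hnA).ne_zero)).ne'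
  have hint : ∫⁻ β, gaussDensity (act ((n : ℝ) • A)⁻¹ (β - b)) * π β ≠ ∞ := fun ht => by
    rw [ht, ENNReal.mul_top hdet] at hfin
    exact hfin rfl
  refine ((lintegral_mono fun β => mul_le_mul_left (h β) (π β)).trans_lt ?_).ne
  simp only [mul_assoc]
  rw [lintegral_const_mul' _ _ ENNReal.ofReal_ne_top]
  exact ENNReal.mul_lt_top ENNReal.ofReal_lt_top hint.lt_top

lemma marginal_ne_zero_of_lowerSemicontinuous (hσ : 0 < σ) (hπ : Measurable π)
    (hlsc : LowerSemicontinuous π) {b : E d} (hb : π b ≠ 0) (y : E p) : marginal X σ π y ≠ 0 := by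
  intro h
  have m : Measurable fun β => density X σ β y * π β := (measurable_density_left X σ y).mul hπ
  have hae := (lintegral_eq_zero_iff m).1 h
  have hopen : IsOpen {β : E d | 0 < π β} := hlsc.isOpen_preimage 0
  have hpos := hopen.measure_pos volume ⟨b, pos_iff_ne_zero.2 hb⟩
  refine hpos.ne' (measure_mono_null (fun β hβ => ?_) (ae_iff.1 hae))
  exact mul_ne_zero (density_pos hσ β y).ne' (ne_of_gt hβ)

end marginals

/-! ### From superharmonicity to the supermean property -/

section superharmonic

lemma gaussAvg_le_of_superharmonic {b : E d}
    (h : Superharmonic fun β => π (b + act A β)) : gaussAvg A π b ≤ π b := by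
  simpa [gaussAvg] using h.lintegral_le 0

lemma gaussAvg_le_of_superharmonic_comp (hA : IsUnit A.det)
    (h : Superharmonic fun β => π (act A β)) (b : E d) : gaussAvg A π b ≤ π b := by
  simpa [gaussAvg, act_act_inv hA] using h.lintegral_le (act A⁻¹ b)

lemma lowerSemicontinuous_of_superharmonic_comp (hA : IsUnit A.det)
    (h : Superharmonic fun β => π (act A β)) : LowerSemicontinuous π := by
  have := h.lowerSemicontinuous.comp (continuous_act A⁻¹)
  simpa [Function.comp_def, act_act_inv hA] using this

end superharmonic

end minimaxity

end RegPred

end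

/-! ### The theorem -/

open RegPred MeasureTheory in
theorem theorem5 {d p p' : ℕ}
    (X : Matrix (Fin d) (Fin p) ℝ) (X' : Matrix (Fin d) (Fin p') ℝ)
    (hX : IsUnit (X * X.transpose).det)
    (σ σ' : ℝ) (hσ : 0 < σ) (hσ' : 0 < σ')
    (U : Matrix (Fin d) (Fin d) ℝ) (lam : Fin d → ℝ)
    (hdiag : IsDiagonalization X X' σ σ' U lam)
    (π : E d → ENNReal) (hπ : Measurable π) :
    -- `X̃ X̃ᵀ` regular, that is, `A*` invertible
    (IsUnit (X' * X'.transpose).det →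
      Superharmonic (fun β => π (act (Astar X X' σ σ' U lam) β)) → (∃ β, π β ≠ 0) →
        ((¬ ∃ c, ∀ β, π β = c) →
          Dominates X X' σ σ' (bayesPredictive X X' σ σ' π)
            (bayesPredictive X X' σ σ' (fun _ => 1))) ∧
        IsMinimax X X' σ σ' (bayesPredictive X X' σ σ' π)) ∧
    -- `X̃` arbitrary: the hypothesis on `π` is read on every translate of the range of `A*`
    ((∀ b, Superharmonic (fun β => π (b + act (Astar X X' σ σ' U lam) β))) →
      (∀ y, marginal X σ π y ≠ 0 ∧ marginal X σ π y ≠ ⊤) →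
        ((¬ ∀ᵐ b, ∀ β, π (b + act (Astar X X' σ σ' U lam) β) = π b) →
          Dominates X X' σ σ' (bayesPredictive X X' σ σ' π)
            (bayesPredictive X X' σ σ' (fun _ => 1))) ∧
        IsMinimax X X' σ σ' (bayesPredictive X X' σ σ' π)) := by
  have hA := Astar_mul_transpose hdiag hX hσ
  refine ⟨fun hX' hsup hne => ?_, fun hsup hm => ?_⟩
  · have hAu := isUnit_det_Astar hdiag hX hσ hσ' hX'
    set A := Astar X X' σ σ' U lam
    have hle := gaussAvg_le_of_superharmonic_comp hAu hsup
    have hlsc := lowerSemicontinuous_of_superharmonic_comp hAu hsup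
    obtain ⟨b, hb⟩ := hne
    -- A superharmonic function is finite somewhere, and one finite value makes all marginals
    -- finite.
    obtain ⟨a, -, ha⟩ := hsup.ne_top 0 (Set.mem_univ 0)
    have hm : ∀ y, marginal X σ π y ≠ 0 ∧ marginal X σ π y ≠ ⊤ := fun y =>
      ⟨marginal_ne_zero_of_lowerSemicontinuous hσ hπ hlsc hb y,
        marginal_ne_top_of_gaussAvg_le hX hσ hAu hπ hle (by simpa using ha) y⟩
    refine ⟨fun hc => ?_, isMinimax_bayes hX hσ hσ' hA hπ hm hle⟩
    refine dominates_bayes hX hσ hσ' hA hπ hm hle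
      (fun b => hlsc.comp (by fun_prop)) fun hae => hc ?_
    -- For invertible `A` a single translate of its range is the whole space.
    obtain ⟨b, hb⟩ := hae.exists
    refine ⟨π b, fun β => ?_⟩
    simpa [act_act_inv hAu] using hb (act A⁻¹ (β - b))
  · have hle := fun b => gaussAvg_le_of_superharmonic (hsup b)
    exact ⟨dominates_bayes hX hσ hσ' hA hπ hm hle fun b => (hsup b).lowerSemicontinuous,
      isMinimax_bayes hX hσ hσ' hA hπ hm hle⟩
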